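/- **Setting.** Let $\mathbb T=\mathbb R/\mathbb Z$, $\mathbb T_n=\mathbb Z/n\mathbb Z$, $\Omega_n=\{0,1\}^{\mathbb T_n}$, and $T>0$. Let $F:\mathbb T\to\mathbb R$ be smooth. For $n$ large, let $(\eta_t)_{t\ge0}=(\eta^n_t)_{t\ge 0}$ be the weakly asymmetric simple exclusion process, i.e. the càdlàg Markov process on $\Omega_n$ with generator $$L_nf(\eta)=\sum_{x,y\in\mathbb T_n}r_n(x,y)\,\eta(x)(1-\eta(y))\,[f(\eta^{x,y})-f(\eta)],$$ where $r_n(x,x\pm1)=1\pm\frac1nF(\frac xn)$, $r_n(x,y)=0$ otherwise, and $\eta^{x,y}$ is $\eta$ with the values at $x$ and $y$ exchanged. Let $\rho_0:\mathbb T\to\mathbb R$ be smooth and let $\rho:[0,T]\times\mathbb T\to\mathbb R$ be the classical solution of $$\partial_t\rho_t(u)=\partial_{uu}^2\rho_t(u)-2\partial_u\{\rho_t(u)(1-\rho_t(u))F(u)\},\qquad \rho(0,\cdot)=\rho_0 .$$ Assume that, for some $\varepsilon_0\in(0,1/2)$ and $\kappa>0$, one has $\rho_t(u)\in(\varepsilon_0,1-\varepsilon_0)$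 and $n\,|\rho_t(\frac{x+1}n)-\rho_t(\frac xn)|\le\kappa$ for all $t\in[0,T]$, $u\in\mathbb T$, $n\ge1$ and $x\in\mathbb T_n$. Let $\mu^n$, the law of $\eta_0$, satisfy $H(\mu^n\mid\nu^n_{\rho_0})\le K$ for all $n$, where $K\ge 0$ is a constant, $H$ is the relative entropy and $\nu^n_{\rho_0}$ is the Bernoulli product measure on $\Omega_n$ with $\nu^n_{\rho_0}\{\eta(x)=1\}=\rho_0(x/n)$. Let $q:[0,T]\to\mathbb R$ be smooth with $1/M\le q_s\le M$ for some $M\ge1$. Let $\phi:\mathbb R\to\mathbb R$ be smooth and nonnegative, vanishing outside $(0,1)$, with $\int\phi=1$, and put $\phi_\varepsilon(u)=\varepsilon^{-1}\phi(u/\varepsilon)$ for $\varepsilon\in(0,1)$, viewed on $[0,1)\cong\mathbb T$. Write $\mathcal X(r)=r(1-r)$ and define $$X^n_t(f)=\frac1{\sqrt n}\sum_{x\in\mathbb T_n}\Big[\eta_{tn^2}(x)-\rho_t\Big(\frac xn\Big)\Big]f\Big(\frac xn\Big),\qquad Z^\varepsilon_{t,n}=\int_0^tX^n_s\Big(\frac{\phi_\varepsilon(\cdot)\,\mathcal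 X(\rho_s(0))}{q_s\,\mathcal X(\rho_s(\cdot))}\Big)ds,$$ $$\Gamma_n(t)=\sqrt n\int_0^t\frac{\eta_{sn^2}(0)-\rho_s(0)}{q_s}\,ds .$$ **Lemma (local replacement).** For every $\lambda\in(1,2)$ there is a constant $C>0$, depending only on $\lambda,M,\varepsilon_0,\kappa,T$ and on the fixed data $F$, $\phi$, $K$ (in particular independent of $n$, $\varepsilon$, $s$ and $t$), with the following property: for every $\varepsilon\in(0,1)$ there is $n_0$ such that for all $n\ge n_0$ and all $0\le s<t\le T$, $$\mathbb E_{\mu^n}\Big[\big|Z^\varepsilon_{t,n}-Z^\varepsilon_{s,n}-(\Gamma_n(t)-\Gamma_n(s))\big|^\lambda\Big]\le C\,|t-s|^{\lambda/2}\,\varepsilon^{\lambda/2}.$$ Here $n_0$ may depend on $\varepsilon$, $\rho$, $q$ and on the data that $C$ may depend on, but not on $s$, $t$ or the laws $\mu^n$. -/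

import Mathlib

open MeasureTheory Set Filter Topology
open scoped ENNReal ContDiff

noncomputable section

namespace WASEP

/-- Particle configurations on the discrete torus `ℤ/nℤ`; `true` means occupied. -/
abbrev Config (n : ℕ) : Type := ZMod n → Bool

/-- Occupation number, equal to `1` if `x` is occupied and to `0` otherwise. -/
def occ {n : ℕ} (η : Config n) (x : ZMod n) : ℝ := if η x then 1 else 0

/-- The configuration `η^{x,y}` in which the occupations of `x` and `y` are exchanged. -/
def exchange {n : ℕ} (η : Config n) (x y : ZMod n) : Config n := fun z => η (Equiv.swap x y z)

/-- The macroscopic point `x / n`, represented in `[0, 1)`. Functions on the torus `ℝ/ℤ` are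
represented by functions on `ℝ`, evaluated at such points. -/
def pos {n : ℕ} (x : ZMod n) : ℝ := (x.val : ℝ) / n

/-- Jump rates `r_n(x, x ± 1) = 1 ± F(x/n)/n`, and `0` otherwise. -/
def rate (F : ℝ → ℝ) (n : ℕ) (x y : ZMod n) : ℝ :=
  (if y = x + 1 then 1 + F (pos x) / n else 0) + (if y = x - 1 then 1 - F (pos x) / n else 0)

/-- The generator `L_n` of the weakly asymmetric simple exclusion process. -/
def generator (F : ℝ → ℝ) (n : ℕ) [NeZero n] : (Config n → ℝ) →ₗ[ℝ] (Config n → ℝ) where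
  toFun f η := ∑ x, ∑ y, rate F n x y * occ η x * (1 - occ η y) * (f (exchange η x y) - f η)
  map_add' f g := by
    funext η
    simp only [Pi.add_apply, ← Finset.sum_add_distrib]
    refine Finset.sum_congr rfl fun x _ => Finset.sum_congr rfl fun y _ => ?_
    ring
  map_smul' c f := by
    funext η
    simp only [Pi.smul_apply, smul_eq_mul, RingHom.id_apply, Finset.mul_sum]
    refine Finset.sum_congr rfl fun x _ => Finset.sum_congr rfl fun y _ => ?_
    ring

/-- Transition probabilities `p_t(η, ξ) = (e^{t L_n} 1_{ξ})(η)`. -/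
def transition (F : ℝ → ℝ) (n : ℕ) [NeZero n] (t : ℝ) : Matrix (Config n) (Config n) ℝ :=
  NormedSpace.exp (t • LinearMap.toMatrix' (generator F n))

/-- The process `(η_t)_{t ≥ 0}` on the probability space `(Ω, P)` is a càdlàg Markov process with
generator `L_n` and initial law `μ` (its values at negative times are irrelevant). -/
structure IsProcess (F : ℝ → ℝ) (n : ℕ) [NeZero n] (μ : Measure (Config n))
    {Ω : Type*} [MeasurableSpace Ω] (P : Measure Ω) (η : ℝ → Ω → Config n) : Prop where
  measurable : ∀ t, 0 ≤ t → Measurable (η t)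
  right_continuous : ∀ a t, 0 ≤ t → ContinuousWithinAt (fun r => η r a) (Ici t) t
  left_limit : ∀ a t, 0 < t → ∃ ξ : Config n, Tendsto (fun r => η r a) (𝓝[<] t) (𝓝 ξ)
  finite_dim : ∀ (k : ℕ) (τ : Fin (k + 1) → ℝ), Monotone τ → τ 0 = 0 →
    ∀ ξ : Fin (k + 1) → Config n,
      P {a | ∀ i, η (τ i) a = ξ i} =
        μ {ξ 0} * ∏ i : Fin k,
          ENNReal.ofReal
            (transition F n (τ i.succ - τ i.castSucc) (ξ i.castSucc) (ξ i.succ))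

/-- The Bernoulli product measure on configurations with slowly varying parameter `ρ(x/n)`. -/
def productMeasure (n : ℕ) [NeZero n] (ρ : ℝ → ℝ) : Measure (Config n) :=
  Measure.pi fun x =>
    ENNReal.ofReal (ρ (pos x)) • Measure.dirac true +
      ENNReal.ofReal (1 - ρ (pos x)) • Measure.dirac false

/-- `ρ` is a classical (that is, `C^{1,2}`) solution on `[0, T] × ℝ/ℤ` of
`∂_t ρ = ∂²_u ρ - 2 ∂_u (ρ (1 - ρ) F)` with initial condition `ρ₀`. -/
structure IsHydrodynamicSolution (T : ℝ) (F ρ₀ : ℝ → ℝ) (ρ : ℝ → ℝ → ℝ) : Prop where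
  initial : ρ 0 = ρ₀
  periodic : ∀ t ∈ Icc 0 T, Function.Periodic (ρ t) 1
  contDiff : ∀ t ∈ Icc 0 T, ContDiff ℝ 2 (ρ t)
  continuousOn : ContinuousOn (fun p : ℝ × ℝ => ρ p.1 p.2) (Icc 0 T ×ˢ univ)
  continuousOn_deriv : ContinuousOn (fun p : ℝ × ℝ => deriv (ρ p.1) p.2) (Icc 0 T ×ˢ univ)
  continuousOn_deriv_deriv :
    ContinuousOn (fun p : ℝ × ℝ => deriv (deriv (ρ p.1)) p.2) (Icc 0 T ×ˢ univ)
  equation : ∀ t ∈ Icc 0 T, ∀ u : ℝ,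
    HasDerivWithinAt (fun r => ρ r u)
      (deriv (deriv (ρ t)) u - 2 * deriv (fun v => ρ t v * (1 - ρ t v) * F v) u) (Icc 0 T) t

/-- The compressibility `χ(ρ) = ρ (1 - ρ)`. -/
def compressibility (r : ℝ) : ℝ := r * (1 - r)

/-- `φ_ε(u) = ε⁻¹ φ(u / ε)`. -/
def rescale (φ : ℝ → ℝ) (ε u : ℝ) : ℝ := ε⁻¹ * φ (u / ε)

/-- The density fluctuation field
`X^n_t(f) = n^{-1/2} ∑_x (η_{t n²}(x) - ρ_t(x/n)) f(x/n)` along the path `η`. -/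
def fluctuationField (n : ℕ) [NeZero n] (ρ : ℝ → ℝ → ℝ) (η : ℝ → Config n) (t : ℝ)
    (f : ℝ → ℝ) : ℝ :=
  (1 / √(n : ℝ)) * ∑ x : ZMod n, (occ (η (t * (n : ℝ) ^ 2)) x - ρ t (pos x)) * f (pos x)

/-- `Z^ε_{t,n} = ∫_0^t X^n_s (φ_ε(·) χ(ρ_s(0)) / (q_s χ(ρ_s(·)))) ds`. -/
def Z (n : ℕ) [NeZero n] (φ q : ℝ → ℝ) (ρ : ℝ → ℝ → ℝ) (ε : ℝ) (η : ℝ → Config n) (t : ℝ) : ℝ :=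
  ∫ s in (0 : ℝ)..t, fluctuationField n ρ η s fun u =>
    rescale φ ε u * compressibility (ρ s 0) / (q s * compressibility (ρ s u))

/-- The rescaled occupation time `Γ_n(t) = √n ∫_0^t (η_{s n²}(0) - ρ_s(0)) / q_s ds`. -/
def Γ (n : ℕ) (q : ℝ → ℝ) (ρ : ℝ → ℝ → ℝ) (η : ℝ → Config n) (t : ℝ) : ℝ :=
  √(n : ℝ) * ∫ s in (0 : ℝ)..t, (occ (η (s * (n : ℝ) ^ 2)) 0 - ρ s 0) / q s

end WASEP

end

/-! Let I be the integrand of Z − Γ (`discrepancy`). It suffices to bound the second moment of Y = ∫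
I over [s, t] by C (t − s) ε; concavity of the power λ/2 < 1 then gives the moment of order λ.

Write c_x = (η(x) − α_x) / (α_x (1 − α_x)) for the normalized occupation variables (`charge`). Up to
a bounded factor, I is √n times the difference between the φ_ε-average of c and c_0. Transporting
the mass at 0 to φ_ε along the bonds writes I as Σ θ_y (c_{y+1} − c_y) plus an error O(n^{-1/2}).
Here θ is of order √n on about εn bonds and vanishes elsewhere, so that n⁻² Σ θ² = O(ε)
(`sum_sq_tail_weight_le`). The generator is accelerated by n², hence integration by parts across
bonds bounds 2γ⟨I, v²⟩ by part of the Dirichlet form plus O(ε γ²)⟨v²⟩. Through the Feynman-Kac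
formula this makes Y sub-Gaussian with variance O(ε (t − s)), provided the chain may be compared
with a suitable reference measure.

The reference measure at time t is the Bernoulli product measure with parameters α_t, the cell
averages of ρ_t. It is not invariant, so the defect between the adjoint generator and the time
derivative of the weights must be controlled as well. Since α_t satisfies an exact discrete
conservation law, the linear part of this defect is a combination of bond gradients with
coefficients n τ, where τ = O(1/n) is the error of the microscopic current. There remains Σ b_x c_x
c_{x+1} with bounded b. A telescoping sum replaces c_{x+1} by the mean over the torus, which leaves
a mean-field term, bond gradients whose coefficients `spread` are of order √n, and a cubic term
created by the inhomogeneity of α. All gradients are absorbed by the Dirichlet form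
(`form_add_sum_bondGrad_le`). What is left is collected in a function U (`residual`), and
`spectral_bound` reads 2⟨v, Lv⟩ + 2γ⟨I, v²⟩ − ⟨∂_t log m, v²⟩ ≤ ⟨U, v²⟩ + O(ε γ²)⟨v²⟩, with L
accelerated. Exponential supermartingales show that U has exponential moments uniformly in n and ε
(`exists_sum_exp_residual_le`).

This inequality is used twice. With γ = 0 it is Yau's bound on the entropy production, so the
relative entropy of the process stays bounded (`relEntropy_lawAt_le`). With arbitrary γ, Feynman-Kac
gives E[exp(γ Y − ½ ∫ U)] ≤ exp(Λ γ² (t − s)) with Λ = O(ε), for the chain started at time s from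
the reference measure. Integrating over a Gaussian γ yields an exponential moment of Y² / (8 Λ (t −
s)). The entropy inequality on path space carries this over to the actual process, at a cost given
by the entropy and the mean of ∫ U, both O(1) (`IsChain.integral_sq_le`). -/

noncomputable section

namespace WASEP

/-! ### Finite-state Markov semigroups. -/

section RateMatrix

variable {S : Type*} [Fintype S] [DecidableEq S]

/-- The infinitesimal generator of a continuous-time Markov chain on a finite set. -/
structure IsRateMatrix (A : Matrix S S ℝ) : Prop where
  nonneg : ∀ i j, i ≠ j → 0 ≤ A i j
  row_sum : ∀ i, ∑ j, A i j = 0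

lemma hasDerivAt_exp_smul_entry (A : Matrix S S ℝ) (t : ℝ) (i j : S) :
    HasDerivAt (fun r : ℝ => NormedSpace.exp (r • A) i j) ((A * NormedSpace.exp (t • A)) i j) t := by
  let _ := Matrix.linftyOpNormedRing (n := S) (α := ℝ)
  let _ := Matrix.linftyOpNormedAlgebra (n := S) (R := ℝ) (α := ℝ)
  have h := hasDerivAt_exp_smul_const' (𝕂 := ℝ) A t
  exact ((Matrix.entryLinearMap ℝ ℝ i j).toContinuousLinearMap.hasFDerivAt).comp_hasDerivAt t h

lemma exp_smul_mul_comm (A : Matrix S S ℝ) (t : ℝ) :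
    A * NormedSpace.exp (t • A) = NormedSpace.exp (t • A) * A := by
  let _ := Matrix.linftyOpNormedRing (n := S) (α := ℝ)
  let _ := Matrix.linftyOpNormedAlgebra (n := S) (R := ℝ) (α := ℝ)
  exact (((Commute.refl A).smul_right t).exp_right).eq

/-- Every power of B is entrywise nonnegative, so the exponential series dominates its zeroth term.
-/
lemma one_le_exp_of_nonneg {B : Matrix S S ℝ} (hB : ∀ i j, 0 ≤ B i j) (i j : S) :
    (1 : Matrix S S ℝ) i j ≤ NormedSpace.exp B i j := by
  let _ := Matrix.linftyOpNormedRing (n := S) (α := ℝ)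
  let _ := Matrix.linftyOpNormedAlgebra (n := S) (R := ℝ) (α := ℝ)
  have h := NormedSpace.exp_series_hasSum_exp' (𝕂 := ℝ) B
  have h2 : HasSum (fun k : ℕ => (((k.factorial : ℝ)⁻¹ • B ^ k : Matrix S S ℝ)) i j)
      (NormedSpace.exp B i j) :=
    h.mapL (Matrix.entryLinearMap ℝ ℝ i j).toContinuousLinearMap
  have hpow : ∀ k : ℕ, ∀ i j, 0 ≤ (B ^ k) i j := by
    intro k
    induction k with
    | zero => intro i j; simp only [pow_zero, Matrix.one_apply]; split_ifs <;> norm_num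
    | succ k ih =>
      intro i j
      rw [pow_succ, Matrix.mul_apply]
      exact Finset.sum_nonneg fun l _ => mul_nonneg (ih i l) (hB l j)
  have := le_hasSum h2 0 (fun k _ => by
    simp only [Matrix.smul_apply, smul_eq_mul]
    exact mul_nonneg (by positivity) (hpow k i j))
  simpa using this

/-- Uniformization: adding c times the identity makes A entrywise nonnegative, and a scalar shift
only multiplies the semigroup by a number. The bound serves both for nonnegative transition
probabilities and for positive diagonal entries. -/
lemma exists_exp_smul_ge {A : Matrix S S ℝ} (hA : IsRateMatrix A) :
    ∃ c : ℝ, ∀ t : ℝ, 0 ≤ t → ∀ i j,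
      Real.exp (-(c * t)) * (1 : Matrix S S ℝ) i j ≤ NormedSpace.exp (t • A) i j := by
  refine ⟨∑ i, |A i i|, fun t ht i j => ?_⟩
  set c := ∑ i, |A i i|
  have hB : ∀ i j, 0 ≤ (t • (A + c • (1 : Matrix S S ℝ))) i j := by
    intro i j
    simp only [Matrix.smul_apply, Matrix.add_apply, smul_eq_mul]
    refine mul_nonneg ht ?_
    rcases eq_or_ne i j with rfl | hij
    · have h1 : |A i i| ≤ c := Finset.single_le_sum (f := fun i => |A i i|)
        (fun _ _ => abs_nonneg _) (Finset.mem_univ i)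
      have := neg_abs_le (A i i)
      simp only [Matrix.one_apply_eq]
      linarith
    · simpa [Matrix.one_apply_ne hij] using hA.nonneg i j hij
  have h := one_le_exp_of_nonneg hB i j
  have hsplit : NormedSpace.exp (t • A) =
      Real.exp (-(c * t)) • NormedSpace.exp (t • (A + c • (1 : Matrix S S ℝ))) := by
    have e1 : t • A = t • (A + c • (1 : Matrix S S ℝ)) + algebraMap ℝ _ (-(c * t)) := by
      rw [Algebra.algebraMap_eq_smul_one]
      module
    have hc : Commute (t • (A + c • (1 : Matrix S S ℝ))) (algebraMap ℝ _ (-(c * t))) :=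
      (Algebra.commutes _ _).symm
    conv_lhs => rw [e1]
    have hexp : NormedSpace.exp (algebraMap ℝ (Matrix S S ℝ) (-(c * t))) =
        algebraMap ℝ (Matrix S S ℝ) (Real.exp (-(c * t))) := by
      rw [Real.exp_eq_exp_ℝ]
      let _ := Matrix.linftyOpNormedRing (n := S) (α := ℝ)
      let _ := Matrix.linftyOpNormedAlgebra (n := S) (R := ℝ) (α := ℝ)
      exact (NormedSpace.algebraMap_exp_comm (𝔸 := Matrix S S ℝ) (-(c * t))).symm
    rw [Matrix.exp_add_of_commute _ _ hc, hexp, ← Algebra.commutes, ← Algebra.smul_def]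
  rw [hsplit, Matrix.smul_apply, smul_eq_mul]
  exact mul_le_mul_of_nonneg_left h (Real.exp_pos _).le

lemma exp_smul_nonneg {A : Matrix S S ℝ} (hA : IsRateMatrix A) {t : ℝ} (ht : 0 ≤ t) (i j : S) :
    0 ≤ NormedSpace.exp (t • A) i j := by
  obtain ⟨c, hc⟩ := exists_exp_smul_ge hA
  refine le_trans (mul_nonneg (Real.exp_pos _).le ?_) (hc t ht i j)
  rw [Matrix.one_apply]; split_ifs <;> norm_num

lemma exp_smul_diag_pos {A : Matrix S S ℝ} (hA : IsRateMatrix A) {t : ℝ} (ht : 0 ≤ t) (i : S) :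
    0 < NormedSpace.exp (t • A) i i := by
  obtain ⟨c, hc⟩ := exists_exp_smul_ge hA
  refine lt_of_lt_of_le ?_ (hc t ht i i)
  simp [Real.exp_pos]

/-- The law at time `t` of the chain with generator `A` and initial law `μ`. -/
def lawAt (A : Matrix S S ℝ) (μ : S → ℝ) (t : ℝ) (j : S) : ℝ :=
  ∑ i, μ i * NormedSpace.exp (t • A) i j

lemma hasDerivAt_lawAt (A : Matrix S S ℝ) (μ : S → ℝ) (t : ℝ) (j : S) :
    HasDerivAt (fun r => lawAt A μ r j) (∑ i, lawAt A μ t i * A i j) t := by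
  have h : HasDerivAt (fun r => lawAt A μ r j)
      (∑ i, μ i * (A * NormedSpace.exp (t • A)) i j) t :=
    HasDerivAt.fun_sum fun i _ => (hasDerivAt_exp_smul_entry A t i j).const_mul (μ i)
  convert! h using 1
  rw [exp_smul_mul_comm]
  simp only [lawAt, Matrix.mul_apply, Finset.mul_sum, Finset.sum_mul]
  rw [Finset.sum_comm]
  refine Finset.sum_congr rfl fun i _ => Finset.sum_congr rfl fun k _ => by ring

lemma lawAt_nonneg {A : Matrix S S ℝ} (hA : IsRateMatrix A) {μ : S → ℝ} (hμ : ∀ i, 0 ≤ μ i)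
    {t : ℝ} (ht : 0 ≤ t) (j : S) : 0 ≤ lawAt A μ t j :=
  Finset.sum_nonneg fun i _ => mul_nonneg (hμ i) (exp_smul_nonneg hA ht i j)

lemma lawAt_pos {A : Matrix S S ℝ} (hA : IsRateMatrix A) {μ : S → ℝ} (hμ : ∀ i, 0 < μ i)
    {t : ℝ} (ht : 0 ≤ t) (j : S) : 0 < lawAt A μ t j :=
  lt_of_lt_of_le (mul_pos (hμ j) (exp_smul_diag_pos hA ht j))
    (Finset.single_le_sum (f := fun i => μ i * NormedSpace.exp (t • A) i j)
      (fun i _ => mul_nonneg (hμ i).le (exp_smul_nonneg hA ht i j)) (Finset.mem_univ j))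

lemma lawAt_zero (A : Matrix S S ℝ) (μ : S → ℝ) : lawAt A μ 0 = μ := by
  funext j
  simp [lawAt, NormedSpace.exp_zero, Matrix.one_apply]

lemma sum_lawAt {A : Matrix S S ℝ} (hA : IsRateMatrix A) (μ : S → ℝ) (t : ℝ) :
    ∑ j, lawAt A μ t j = ∑ j, μ j := by
  have h : ∀ r, HasDerivAt (fun r => ∑ j, lawAt A μ r j) 0 r := by
    intro r
    have h1 : HasDerivAt (fun r => ∑ j, lawAt A μ r j) (∑ j, ∑ i, lawAt A μ r i * A i j) r :=
      HasDerivAt.fun_sum fun j _ => hasDerivAt_lawAt A μ r j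
    convert! h1 using 1
    rw [Finset.sum_comm]
    simp [← Finset.mul_sum, hA.row_sum]
  have := is_const_of_deriv_eq_zero (fun r => (h r).differentiableAt) (fun r => (h r).deriv) t 0
  simpa [lawAt_zero] using this

end RateMatrix

/-! ### Relative entropy along a Markov chain. -/

section Entropy

variable {S : Type*} [Fintype S]

/-- The relative entropy `∑ p log (p / m)` of weights on a finite set. -/
def relEntropy (p m : S → ℝ) : ℝ := ∑ i, p i * (Real.log (p i) - Real.log (m i))

/-- The entropy inequality on a finite set. -/
lemma sum_mul_le_relEntropy_add {p m : S → ℝ} (hp : ∀ i, 0 ≤ p i) (hp1 : ∑ i, p i = 1)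
    (hm : ∀ i, 0 < m i) (f : S → ℝ) {B : ℝ} (hB : ∑ i, m i * Real.exp (f i) ≤ Real.exp B) :
    ∑ i, p i * f i ≤ relEntropy p m + B := by
  -- This is p (x + 1) ≤ p exp x with x = f − log (p / m) − B. Where p vanishes, the value of log 0
  -- is irrelevant because it is multiplied by 0.
  have key : ∀ i, p i * f i - p i * (Real.log (p i) - Real.log (m i)) - p i * B ≤
      m i * Real.exp (f i) * Real.exp (-B) - p i := by
    intro i
    rcases (hp i).eq_or_lt with h0 | h0
    · rw [← h0]
      have := mul_nonneg (mul_nonneg (hm i).le (Real.exp_pos (f i)).le) (Real.exp_pos (-B)).le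
      linarith
    · have h1 := Real.add_one_le_exp (f i - Real.log (p i) + Real.log (m i) - B)
      have h2 : p i * Real.exp (f i - Real.log (p i) + Real.log (m i) - B) =
          m i * Real.exp (f i) * Real.exp (-B) := by
        rw [show f i - Real.log (p i) + Real.log (m i) - B =
          f i + Real.log (m i) + -B - Real.log (p i) by ring, Real.exp_sub, Real.exp_add,
          Real.exp_add, Real.exp_log (hm i), Real.exp_log h0]
        field_simp
      nlinarith [mul_le_mul_of_nonneg_left h1 h0.le]
  have hsum := Finset.sum_le_sum fun i (_ : i ∈ Finset.univ) => key i
  simp only [Finset.sum_sub_distrib, ← Finset.sum_mul, hp1] at hsum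
  have h3 : (∑ i, m i * Real.exp (f i)) * Real.exp (-B) ≤ 1 := by
    calc _ ≤ Real.exp B * Real.exp (-B) := mul_le_mul_of_nonneg_right hB (Real.exp_pos _).le
      _ = 1 := by rw [← Real.exp_add]; simp
  unfold relEntropy
  linarith

/-- With v = √(p / m), the bound log (v_i / v_k) ≤ v_i / v_k − 1 turns the derivative of the entropy
into the quadratic form of the generator at v. Vanishing row sums introduce the differences, so the
bound is needed only off the diagonal, where rates are nonnegative. -/
lemma sum_mul_rate_mul_log_le {A : Matrix S S ℝ} (hA : IsRateMatrix A) {p m : S → ℝ}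
    (hp : ∀ i, 0 < p i) (hm : ∀ i, 0 < m i) :
    ∑ i, (∑ k, p k * A k i) * (Real.log (p i) - Real.log (m i)) ≤
      2 * ∑ i, m i * √(p i / m i) * ∑ j, A i j * √(p j / m j) := by
  set v : S → ℝ := fun i => √(p i / m i) with hv
  have hvpos : ∀ i, 0 < v i := fun i => Real.sqrt_pos.2 (div_pos (hp i) (hm i))
  have hv2 : ∀ i, p i = m i * v i ^ 2 := fun i => by
    rw [hv]; simp only; rw [Real.sq_sqrt (div_pos (hp i) (hm i)).le]
    have := (hm i).ne'
    field_simp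
  have hlog : ∀ i, Real.log (p i) - Real.log (m i) = 2 * Real.log (v i) := fun i => by
    rw [hv2 i, Real.log_mul (hm i).ne' (pow_pos (hvpos i) 2).ne', Real.log_pow]
    push_cast; ring
  have hL : ∑ i, (∑ k, p k * A k i) * (Real.log (p i) - Real.log (m i)) =
      ∑ k, ∑ i, p k * A k i * (2 * (Real.log (v i) - Real.log (v k))) := by
    simp only [hlog, Finset.sum_mul]
    rw [Finset.sum_comm]
    refine Finset.sum_congr rfl fun k _ => ?_
    have h0 : ∑ i, p k * A k i * (2 * Real.log (v k)) = 0 := by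
      rw [← Finset.sum_mul, ← Finset.mul_sum, hA.row_sum]; ring
    simp only [mul_sub, Finset.sum_sub_distrib, h0, sub_zero]
  have hR : 2 * ∑ i, m i * v i * ∑ j, A i j * v j =
      ∑ k, ∑ i, 2 * (m k * v k) * (A k i * (v i - v k)) := by
    rw [Finset.mul_sum]
    refine Finset.sum_congr rfl fun k _ => ?_
    have h0 : ∑ i, A k i * v k = 0 := by rw [← Finset.sum_mul, hA.row_sum]; ring
    rw [← Finset.mul_sum]
    simp only [mul_sub, Finset.sum_sub_distrib, h0, sub_zero]
    ring
  rw [hL, hR]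
  refine Finset.sum_le_sum fun k _ => Finset.sum_le_sum fun i _ => ?_
  rcases eq_or_ne k i with rfl | hki
  · simp
  · have h1 : Real.log (v i) - Real.log (v k) ≤ v i / v k - 1 := by
      rw [← Real.log_div (hvpos i).ne' (hvpos k).ne']
      exact Real.log_le_sub_one_of_pos (div_pos (hvpos i) (hvpos k))
    have h2 : 0 ≤ p k * A k i := mul_nonneg (hp k).le (hA.nonneg k i hki)
    calc p k * A k i * (2 * (Real.log (v i) - Real.log (v k)))
        ≤ p k * A k i * (2 * (v i / v k - 1)) := by gcongr
      _ = 2 * (m k * v k) * (A k i * (v i - v k)) := by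
        rw [hv2 k]; have := (hvpos k).ne'; field_simp

variable [DecidableEq S]

/-- Yau's inequality and Gronwall's lemma: if the entropy production with respect to the time
dependent weights `m` is bounded by `U`, and `U` has an exponential moment, then the relative
entropy stays bounded. -/
lemma relEntropy_lawAt_le_of_pos {A : Matrix S S ℝ} (hA : IsRateMatrix A) {T c B K : ℝ}
    (hc : 0 < c) {m m' U : ℝ → S → ℝ}
    (hm_pos : ∀ r ∈ Icc 0 T, ∀ i, 0 < m r i)
    (hm_cont : ∀ i, ContinuousOn (fun r => m r i) (Icc 0 T))
    (hm_deriv : ∀ r ∈ Ioo 0 T, ∀ i, HasDerivAt (fun r => m r i) (m' r i) r)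
    (hU : ∀ r ∈ Icc 0 T, ∀ v : S → ℝ,
      2 * ∑ i, m r i * v i * ∑ j, A i j * v j - ∑ i, m' r i * v i ^ 2 ≤
        ∑ i, m r i * U r i * v i ^ 2)
    (hexp : ∀ r ∈ Icc 0 T, ∑ i, m r i * Real.exp (c * U r i) ≤ Real.exp B)
    {μ : S → ℝ} (hμ : ∀ i, 0 < μ i) (hμ1 : ∑ i, μ i = 1) (hK : relEntropy μ (m 0) ≤ K)
    {t : ℝ} (ht : t ∈ Icc 0 T) :
    relEntropy (lawAt A μ t) (m t) ≤ Real.exp (t / c) * (K + B) - B := by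
  set p := lawAt A μ
  have hp : ∀ r, 0 ≤ r → ∀ i, 0 < p r i := fun r hr i => lawAt_pos hA hμ hr i
  set H : ℝ → ℝ := fun r => relEntropy (p r) (m r)
  have hpc : ∀ i, Continuous fun r => p r i := fun i =>
    continuous_iff_continuousAt.2 fun r => (hasDerivAt_lawAt A μ r i).continuousAt
  have hHcont : ContinuousOn H (Icc 0 T) := by
    refine continuousOn_finsetSum _ fun i _ => ?_
    refine (hpc i).continuousOn.mul (ContinuousOn.sub ?_ ?_)
    · exact (hpc i).continuousOn.log fun r hr => (hp r hr.1 i).ne'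
    · exact (hm_cont i).log fun r hr => (hm_pos r hr i).ne'
  have hHderiv : ∀ r ∈ Ioo 0 T, ∃ D, HasDerivAt H D r ∧ D ≤ (H r + B) / c := by
    intro r hr
    have hr' : r ∈ Icc 0 T := Ioo_subset_Icc_self hr
    have hd : HasDerivAt H (∑ i, ((∑ k, p r k * A k i) * (Real.log (p r i) - Real.log (m r i)) +
        p r i * ((∑ k, p r k * A k i) / p r i - m' r i / m r i))) r :=
      HasDerivAt.fun_sum fun i _ => (hasDerivAt_lawAt A μ r i).mul
        (((hasDerivAt_lawAt A μ r i).log (hp r hr.1.le i).ne').sub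
          ((hm_deriv r hr i).log (hm_pos r hr' i).ne'))
    refine ⟨_, hd, ?_⟩
    set v : S → ℝ := fun i => √(p r i / m r i)
    have hv2 : ∀ i, v i ^ 2 = p r i / m r i := fun i =>
      Real.sq_sqrt (div_pos (hp r hr.1.le i) (hm_pos r hr' i)).le
    have h1 := sum_mul_rate_mul_log_le hA (hp r hr.1.le) (hm_pos r hr')
    have h2 := hU r hr' v
    -- Conservation of the total mass removes the term in which log p is differentiated.
    have h3 : ∑ i, p r i * ((∑ k, p r k * A k i) / p r i - m' r i / m r i) =
        - ∑ i, m' r i * v i ^ 2 := by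
      have e : ∀ i, p r i * ((∑ k, p r k * A k i) / p r i - m' r i / m r i) =
          (∑ k, p r k * A k i) - m' r i * v i ^ 2 := fun i => by
        rw [hv2]; have := (hp r hr.1.le i).ne'; have := (hm_pos r hr' i).ne'; field_simp
      simp only [e, Finset.sum_sub_distrib]
      rw [Finset.sum_comm]
      simp [← Finset.mul_sum, hA.row_sum]
    have h4 : ∑ i, m r i * U r i * v i ^ 2 = (∑ i, p r i * (c * U r i)) / c := by
      rw [Finset.sum_div]
      refine Finset.sum_congr rfl fun i _ => ?_
      rw [hv2]; have := (hm_pos r hr' i).ne'; field_simp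
    have h5 := sum_mul_le_relEntropy_add (fun i => (hp r hr.1.le i).le)
      (by rw [sum_lawAt hA, hμ1]) (hm_pos r hr') (fun i => c * U r i) (hexp r hr')
    have h6 : (∑ i, p r i * (c * U r i)) / c ≤ (H r + B) / c := by gcongr
    rw [Finset.sum_add_distrib, h3]
    linarith
  -- Gronwall: H' ≤ (H + B) / c makes exp (−r / c) (H + B) nonincreasing.
  have hanti : AntitoneOn (fun r => Real.exp (-(r / c)) * (H r + B)) (Icc 0 T) := by
    refine antitoneOn_of_deriv_nonpos (convex_Icc 0 T) ?_ ?_ ?_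
    · exact ContinuousOn.mul (by fun_prop) (hHcont.add continuousOn_const)
    · rw [interior_Icc]
      intro r hr
      obtain ⟨D, hD, -⟩ := hHderiv r hr
      have : DifferentiableAt ℝ H r := hD.differentiableAt
      exact DifferentiableAt.differentiableWithinAt (by fun_prop)
    · rw [interior_Icc]
      intro r hr
      obtain ⟨D, hD, hle⟩ := hHderiv r hr
      have he : HasDerivAt (fun r : ℝ => Real.exp (-(r / c))) (Real.exp (-(r / c)) * -(1 / c)) r :=
        (((hasDerivAt_id r).div_const c).neg).exp
      rw [(he.fun_mul (hD.add_const B)).deriv]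
      have : 0 < Real.exp (-(r / c)) := Real.exp_pos _
      have h7 : Real.exp (-(r / c)) * -(1 / c) * (H r + B) + Real.exp (-(r / c)) * D =
        Real.exp (-(r / c)) * (D - (H r + B) / c) := by ring
      rw [h7]
      exact mul_nonpos_of_nonneg_of_nonpos this.le (by linarith)
  have h0 : (0 : ℝ) ∈ Icc 0 T := ⟨le_rfl, ht.1.trans ht.2⟩
  have h8 := hanti h0 ht ht.1
  simp only [zero_div, neg_zero, Real.exp_zero, one_mul] at h8
  have h9 : H 0 ≤ K := by
    show relEntropy (lawAt A μ 0) (m 0) ≤ K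
    rwa [lawAt_zero]
  have h10 : Real.exp (-(t / c)) * (H t + B) ≤ K + B := by linarith
  have h11 : H t + B ≤ Real.exp (t / c) * (K + B) := by
    have := mul_le_mul_of_nonneg_left h10 (Real.exp_pos (t / c)).le
    rwa [← mul_assoc, ← Real.exp_add, add_neg_cancel, Real.exp_zero, one_mul] at this
  linarith

/-- Positivity of the law is only needed to differentiate log p. It is removed by mixing a multiple
δ of m 0 into μ and letting δ tend to 0, since x log x is continuous at 0. -/
lemma relEntropy_lawAt_le {A : Matrix S S ℝ} (hA : IsRateMatrix A) {T c B K : ℝ}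
    (hc : 0 < c) {m m' U : ℝ → S → ℝ}
    (hm_pos : ∀ r ∈ Icc 0 T, ∀ i, 0 < m r i)
    (hm_one : ∑ i, m 0 i = 1)
    (hm_cont : ∀ i, ContinuousOn (fun r => m r i) (Icc 0 T))
    (hm_deriv : ∀ r ∈ Ioo 0 T, ∀ i, HasDerivAt (fun r => m r i) (m' r i) r)
    (hU : ∀ r ∈ Icc 0 T, ∀ v : S → ℝ,
      2 * ∑ i, m r i * v i * ∑ j, A i j * v j - ∑ i, m' r i * v i ^ 2 ≤
        ∑ i, m r i * U r i * v i ^ 2)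
    (hexp : ∀ r ∈ Icc 0 T, ∑ i, m r i * Real.exp (c * U r i) ≤ Real.exp B)
    {μ : S → ℝ} (hμ : ∀ i, 0 ≤ μ i) (hμ1 : ∑ i, μ i = 1) (hK : relEntropy μ (m 0) ≤ K)
    {t : ℝ} (ht : t ∈ Icc 0 T) :
    relEntropy (lawAt A μ t) (m t) ≤ Real.exp (t / c) * (K + B) - B := by
  have h0 : (0 : ℝ) ∈ Icc 0 T := ⟨le_rfl, ht.1.trans ht.2⟩
  set ν : ℝ → S → ℝ := fun δ i => (1 - δ) * μ i + δ * m 0 i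
  have hν0 : ν 0 = μ := by funext i; simp [ν]
  have hcont : ∀ (f : ℝ → S → ℝ) (k : S → ℝ), (∀ i, Continuous fun δ => f δ i) →
      Continuous fun δ => relEntropy (f δ) k := by
    intro f k hf
    have : (fun δ => relEntropy (f δ) k) =
        fun δ => ∑ i, (f δ i * Real.log (f δ i) - f δ i * Real.log (k i)) := by
      funext δ; simp [relEntropy, mul_sub]
    rw [this]
    refine continuous_finsetSum _ fun i _ => ?_
    exact (Real.continuous_mul_log.comp (hf i)).sub ((hf i).mul continuous_const)
  have hνc : ∀ i, Continuous fun δ => ν δ i := fun i => by fun_prop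
  have hlc : ∀ i, Continuous fun δ => lawAt A (ν δ) t i := fun i => by
    unfold lawAt
    exact continuous_finsetSum _ fun j _ => (hνc j).mul continuous_const
  have hlim1 : Tendsto (fun δ => relEntropy (lawAt A (ν δ) t) (m t)) (𝓝[>] 0)
      (𝓝 (relEntropy (lawAt A μ t) (m t))) := by
    have := ((hcont _ (m t) hlc).tendsto 0).mono_left (nhdsWithin_le_nhds (s := Ioi 0))
    rwa [hν0] at this
  have hlim2 : Tendsto (fun δ => Real.exp (t / c) * (relEntropy (ν δ) (m 0) + B) - B) (𝓝[>] 0)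
      (𝓝 (Real.exp (t / c) * (relEntropy μ (m 0) + B) - B)) := by
    have h := hcont ν (m 0) hνc
    have h' : Continuous fun δ => Real.exp (t / c) * (relEntropy (ν δ) (m 0) + B) - B := by
      fun_prop
    have := (h'.tendsto 0).mono_left (nhdsWithin_le_nhds (s := Ioi 0))
    rwa [hν0] at this
  have hle : ∀ᶠ δ in 𝓝[>] (0 : ℝ), relEntropy (lawAt A (ν δ) t) (m t) ≤
      Real.exp (t / c) * (relEntropy (ν δ) (m 0) + B) - B := by
    filter_upwards [Ioo_mem_nhdsGT (zero_lt_one' ℝ)] with δ hδ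
    refine relEntropy_lawAt_le_of_pos hA hc hm_pos hm_cont hm_deriv hU hexp ?_ ?_ le_rfl ht
    · intro i
      have h1 := mul_nonneg (sub_nonneg.2 hδ.2.le) (hμ i)
      have h2 := mul_pos hδ.1 (hm_pos 0 h0 i)
      simp only [ν]; linarith
    · simp only [ν, Finset.sum_add_distrib, ← Finset.mul_sum, hμ1, hm_one]; ring
  refine (le_of_tendsto_of_tendsto hlim1 hlim2 hle).trans ?_
  gcongr

end Entropy

/-! ### One step of the Feynman-Kac semigroup. -/

section FeynmanKac

variable {S : Type*} [Fintype S]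

lemma exists_abs_le_of_continuousOn {a b : ℝ} {f : ℝ → S → ℝ}
    (hf : ∀ i, ContinuousOn (fun r => f r i) (Icc a b)) :
    ∃ C, 0 ≤ C ∧ ∀ r ∈ Icc a b, ∀ i, |f r i| ≤ C := by
  choose C hC using fun i => isCompact_Icc.exists_bound_of_continuousOn (hf i)
  refine ⟨∑ i, |C i|, Finset.sum_nonneg fun _ _ => abs_nonneg _, fun r hr i => ?_⟩
  exact (hC i r hr).trans ((le_abs_self _).trans
    (Finset.single_le_sum (f := fun i => |C i|) (fun _ _ => abs_nonneg _) (Finset.mem_univ i)))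

/-- Stability of the spectral bound under a small perturbation of the potential and of the
weights. -/
lemma perturbed_form_le {A : Matrix S S ℝ} {m m' G G' e : S → ℝ} {C c β Λ δ : ℝ}
    (hc : 0 < c) (hΛ : 0 ≤ Λ) (hβ : 0 ≤ β) (hδ0 : 0 ≤ δ)
    (hC : 0 ≤ C) (hm_ge : ∀ i, c ≤ m i) (hm_le : ∀ i, m i ≤ C) (hm' : ∀ i, |m' i| ≤ C)
    (hG' : ∀ i, |G' i| ≤ C) (hA : ∀ i j, |A i j| ≤ C)
    (hGG : ∀ i, |G' i - G i| ≤ β) (he : ∀ i, |e i - 1| ≤ β)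
    (hδ : β * (2 + (2 * C ^ 2 * Fintype.card S + 2 * C ^ 2 + C) / c + 2 * Λ + δ) ≤ δ)
    (z : S → ℝ)
    (hspec : 2 * ∑ i, m i * z i * ∑ j, A i j * z j + 2 * ∑ i, m i * G i * z i ^ 2
      - ∑ i, m' i * z i ^ 2 ≤ 2 * Λ * ∑ i, m i * z i ^ 2) :
    ∑ i, e i * (2 * (m i * z i * ∑ j, A i j * z j) + 2 * (m i * G' i * z i ^ 2)
      - m' i * z i ^ 2) ≤ (2 * Λ + δ) * ∑ i, e i * (m i * z i ^ 2) := by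
  set N : ℝ := (Fintype.card S : ℝ)
  set Q := ∑ i, z i ^ 2
  set E := ∑ i, m i * z i ^ 2
  have hQ : 0 ≤ Q := Finset.sum_nonneg fun i _ => sq_nonneg _
  have hmpos : ∀ i, 0 < m i := fun i => hc.trans_le (hm_ge i)
  have hE : 0 ≤ E := Finset.sum_nonneg fun i _ => mul_nonneg (hmpos i).le (sq_nonneg _)
  have hQE : Q ≤ E / c := by
    rw [le_div_iff₀ hc, Finset.sum_mul]
    exact Finset.sum_le_sum fun i _ => by nlinarith [hm_ge i, sq_nonneg (z i)]
  -- The form splits into the unperturbed one, the change of the potential and the change of the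
  -- weights. In `hδ`, the summand 2 pays for the potential, the fraction for the weights, and 2Λ +
  -- δ for replacing E by its reweighted version on the right.
  have h1 : ∑ i, e i * (2 * (m i * z i * ∑ j, A i j * z j) + 2 * (m i * G' i * z i ^ 2)
      - m' i * z i ^ 2) =
      (2 * ∑ i, m i * z i * ∑ j, A i j * z j + 2 * ∑ i, m i * G i * z i ^ 2
        - ∑ i, m' i * z i ^ 2) + ∑ i, 2 * (G' i - G i) * (m i * z i ^ 2) +
      ∑ i, (e i - 1) * (2 * (m i * z i * ∑ j, A i j * z j) + 2 * (m i * G' i * z i ^ 2)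
      - m' i * z i ^ 2) := by
    simp only [Finset.mul_sum, ← Finset.sum_add_distrib, ← Finset.sum_sub_distrib]
    refine Finset.sum_congr rfl fun i _ => ?_
    simp only [← Finset.mul_sum]
    ring
  have h2 : ∑ i, 2 * (G' i - G i) * (m i * z i ^ 2) ≤ 2 * β * E := by
    rw [Finset.mul_sum]
    refine Finset.sum_le_sum fun i _ => ?_
    have := (abs_le.1 (hGG i)).2
    have h0 := mul_nonneg (hmpos i).le (sq_nonneg (z i))
    nlinarith
  have hAz : ∀ i, |∑ j, A i j * z j| ≤ C * ∑ j, |z j| := by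
    intro i
    refine (Finset.abs_sum_le_sum_abs _ _).trans ?_
    rw [Finset.mul_sum]
    refine Finset.sum_le_sum fun j _ => ?_
    rw [abs_mul]
    exact mul_le_mul_of_nonneg_right (hA i j) (abs_nonneg _)
  have hz1 : (∑ j, |z j|) ^ 2 ≤ N * Q := by
    have := sq_sum_le_card_mul_sum_sq (s := (Finset.univ : Finset S)) (f := fun j => |z j|)
    simpa [N, Q, Finset.card_univ] using this
  have h3 : ∑ i, (e i - 1) * (2 * (m i * z i * ∑ j, A i j * z j) + 2 * (m i * G' i * z i ^ 2)
      - m' i * z i ^ 2) ≤ β * ((2 * C ^ 2 * N + 2 * C ^ 2 + C) * Q) := by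
    have hterm : ∀ i, (e i - 1) * (2 * (m i * z i * ∑ j, A i j * z j) + 2 * (m i * G' i * z i ^ 2)
        - m' i * z i ^ 2) ≤
        β * (2 * C ^ 2 * (|z i| * ∑ j, |z j|) + (2 * C ^ 2 + C) * z i ^ 2) := by
      intro i
      have hsq : 0 ≤ z i ^ 2 := sq_nonneg _
      have hs : 0 ≤ ∑ j, |z j| := Finset.sum_nonneg fun _ _ => abs_nonneg _
      have a1 : |m i * z i * ∑ j, A i j * z j| ≤ C ^ 2 * (|z i| * ∑ j, |z j|) := by
        rw [abs_mul, abs_mul, abs_of_pos (hmpos i)]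
        calc m i * |z i| * |∑ j, A i j * z j| ≤ C * |z i| * (C * ∑ j, |z j|) := by
              gcongr
              · exact hm_le i
              · exact hAz i
          _ = _ := by ring
      have a2 : |m i * G' i * z i ^ 2| ≤ C ^ 2 * z i ^ 2 := by
        rw [abs_mul, abs_mul, abs_of_pos (hmpos i), abs_of_nonneg hsq]
        calc m i * |G' i| * z i ^ 2 ≤ C * C * z i ^ 2 := by
              gcongr
              · exact hm_le i
              · exact hG' i
          _ = _ := by ring
      have a3 : |m' i * z i ^ 2| ≤ C * z i ^ 2 := by
        rw [abs_mul, abs_of_nonneg hsq]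
        exact mul_le_mul_of_nonneg_right (hm' i) hsq
      have a4 : |2 * (m i * z i * ∑ j, A i j * z j) + 2 * (m i * G' i * z i ^ 2)
          - m' i * z i ^ 2| ≤ 2 * C ^ 2 * (|z i| * ∑ j, |z j|) + (2 * C ^ 2 + C) * z i ^ 2 := by
        rw [abs_le] at a1 a2 a3 ⊢
        constructor <;> linarith [a1.1, a1.2, a2.1, a2.2, a3.1, a3.2]
      refine (le_abs_self _).trans ?_
      rw [abs_mul]
      exact mul_le_mul (he i) a4 (abs_nonneg _) hβ
    refine (Finset.sum_le_sum fun i _ => hterm i).trans ?_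
    rw [← Finset.mul_sum]
    refine mul_le_mul_of_nonneg_left ?_ hβ
    rw [Finset.sum_add_distrib, ← Finset.mul_sum, ← Finset.mul_sum, ← Finset.sum_mul]
    have : 2 * C ^ 2 * ((∑ j, |z j|) * ∑ j, |z j|) ≤ 2 * C ^ 2 * (N * Q) :=
      mul_le_mul_of_nonneg_left (by rw [← sq]; exact hz1) (by positivity)
    show _ + (2 * C ^ 2 + C) * Q ≤ _
    linarith
  have h4 : (1 - β) * E ≤ ∑ i, e i * (m i * z i ^ 2) := by
    rw [Finset.mul_sum]
    refine Finset.sum_le_sum fun i _ => ?_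
    have := (abs_le.1 (he i)).1
    have h0 := mul_nonneg (hmpos i).le (sq_nonneg (z i))
    nlinarith
  have h5 : (2 * C ^ 2 * N + 2 * C ^ 2 + C) * Q ≤ (2 * C ^ 2 * N + 2 * C ^ 2 + C) / c * E := by
    have hN : 0 ≤ N := Nat.cast_nonneg _
    calc _ ≤ (2 * C ^ 2 * N + 2 * C ^ 2 + C) * (E / c) :=
          mul_le_mul_of_nonneg_left hQE (by positivity)
      _ = _ := by ring
  have h6 := mul_le_mul_of_nonneg_left h5 hβ
  have h7 := mul_le_mul_of_nonneg_right hδ hE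
  have h8 := mul_le_mul_of_nonneg_left h4 (by positivity : 0 ≤ 2 * Λ + δ)
  rw [h1]
  refine le_trans ?_ h8
  nlinarith

variable [DecidableEq S]

lemma hasDerivAt_exp_sub_smul_mulVec (A : Matrix S S ℝ) (f : S → ℝ) (b r : ℝ) (i : S) :
    HasDerivAt (fun r => ∑ j, NormedSpace.exp ((b - r) • A) i j * f j)
      (-∑ k, A i k * ∑ j, NormedSpace.exp ((b - r) • A) k j * f j) r := by
  have h : HasDerivAt (fun r => ∑ j, NormedSpace.exp ((b - r) • A) i j * f j)
      (∑ j, (A * NormedSpace.exp ((b - r) • A)) i j * (-1) * f j) r := by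
    refine HasDerivAt.fun_sum fun j _ => HasDerivAt.mul_const ?_ _
    exact (hasDerivAt_exp_smul_entry A (b - r) i j).comp r ((hasDerivAt_id r).const_sub b)
  convert! h using 1
  simp only [Matrix.mul_apply, Finset.mul_sum, Finset.sum_mul, ← Finset.sum_neg_distrib]
  rw [Finset.sum_comm]
  refine Finset.sum_congr rfl fun i _ => Finset.sum_congr rfl fun k _ => by ring

/-- The short-time `L²` bound for one Trotter step of the Feynman-Kac semigroup. -/
lemma feynmanKac_step {A : Matrix S S ℝ} {m m' G : ℝ → S → ℝ} {a b Λ δ : ℝ}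
    (hΛ : 0 ≤ Λ) (hδ : 0 < δ)
    (hm_pos : ∀ r ∈ Icc a b, ∀ i, 0 < m r i)
    (hm_cont : ∀ i, ContinuousOn (fun r => m r i) (Icc a b))
    (hm'_cont : ∀ i, ContinuousOn (fun r => m' r i) (Icc a b))
    (hG_cont : ∀ i, ContinuousOn (fun r => G r i) (Icc a b))
    (hm_deriv : ∀ r ∈ Ioo a b, ∀ i, HasDerivAt (fun r => m r i) (m' r i) r)
    (hspec : ∀ r ∈ Icc a b, ∀ v : S → ℝ,
      2 * ∑ i, m r i * v i * ∑ j, A i j * v j + 2 * ∑ i, m r i * G r i * v i ^ 2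
        - ∑ i, m' r i * v i ^ 2 ≤ 2 * Λ * ∑ i, m r i * v i ^ 2) :
    ∃ h₀ > 0, ∀ σ ∈ Icc a b, ∀ τ ∈ Icc a b, σ ≤ τ → τ - σ ≤ h₀ → ∀ u : S → ℝ,
      ∑ i, m σ i * (∑ j, NormedSpace.exp ((τ - σ) • A) i j *
        (Real.exp ((τ - σ) * G τ j) * u j)) ^ 2 ≤
        Real.exp ((2 * Λ + δ) * (τ - σ)) * ∑ i, m τ i * u i ^ 2 := by
  rcases lt_or_ge b a with hab | hab
  · exact ⟨1, one_pos, fun σ hσ => absurd (hσ.1.trans hσ.2) (not_le.2 hab)⟩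
  obtain ⟨C1, hC1, hm_le⟩ := exists_abs_le_of_continuousOn hm_cont
  obtain ⟨C2, hC2, hm'_le⟩ := exists_abs_le_of_continuousOn hm'_cont
  obtain ⟨C3, hC3, hG_le⟩ := exists_abs_le_of_continuousOn hG_cont
  obtain ⟨C4, hC4, hinv⟩ := exists_abs_le_of_continuousOn (f := fun r i => (m r i)⁻¹) fun i =>
    (hm_cont i).inv₀ fun r hr => (hm_pos r hr i).ne'
  set C5 := ∑ i, ∑ j, |A i j|
  have hC5 : 0 ≤ C5 := Finset.sum_nonneg fun _ _ => Finset.sum_nonneg fun _ _ => abs_nonneg _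
  have hA_le : ∀ i j, |A i j| ≤ C5 := fun i j =>
    (Finset.single_le_sum (f := fun j => |A i j|) (fun _ _ => abs_nonneg _)
      (Finset.mem_univ j)).trans
    (Finset.single_le_sum (f := fun i => ∑ j, |A i j|)
      (fun _ _ => Finset.sum_nonneg fun _ _ => abs_nonneg _) (Finset.mem_univ i))
  set C := C1 + C2 + C3 + C5
  have hC : 0 ≤ C := by positivity
  set c := (C4 + 1)⁻¹
  have hc : 0 < c := by positivity
  have hm_ge : ∀ r ∈ Icc a b, ∀ i, c ≤ m r i := by
    intro r hr i
    have h1 := hinv r hr i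
    have h2 := hm_pos r hr i
    rw [abs_of_pos (inv_pos.2 h2)] at h1
    exact inv_le_of_inv_le₀ h2 (h1.trans (by linarith))
  set R := 2 + (2 * C ^ 2 * Fintype.card S + 2 * C ^ 2 + C) / c + 2 * Λ + δ
  have hR : 0 < R := by positivity
  -- β bounds both the oscillation of G over a step and the deviation of the exponential weight from
  -- 1; its value is dictated by the smallness condition of `perturbed_form_le`.
  set β := min 1 (δ / R)
  have hβ : 0 < β := lt_min one_pos (by positivity)
  have hβR : β * R ≤ δ := by
    calc β * R ≤ δ / R * R := mul_le_mul_of_nonneg_right (min_le_right _ _) hR.le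
      _ = δ := by field_simp
  have huc : ∀ i, ∃ d > 0, ∀ r ∈ Icc a b, ∀ r' ∈ Icc a b, |r - r'| < d → |G r i - G r' i| < β := by
    intro i
    have := isCompact_Icc.uniformContinuousOn_of_continuous (hG_cont i)
    rw [Metric.uniformContinuousOn_iff] at this
    obtain ⟨d, hd, h⟩ := this β hβ
    exact ⟨d, hd, fun r hr r' hr' hrr => h r hr r' hr' hrr⟩
  choose d hd hGd using huc
  obtain ⟨h₁, hh₁, hh₁'⟩ : ∃ h₁ > 0, ∀ i, h₁ < d i := by
    rcases isEmpty_or_nonempty S with hS | hS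
    · exact ⟨1, one_pos, fun i => hS.elim i⟩
    · obtain ⟨i₀, hi₀⟩ := Finite.exists_min d
      exact ⟨d i₀ / 2, half_pos (hd i₀), fun i => (half_lt_self (hd i₀)).trans_le (hi₀ i)⟩
  refine ⟨min h₁ (β / (4 * C + 4)), lt_min hh₁ (by positivity), ?_⟩
  intro σ hσ τ hτ hστ hle u
  set D := τ - σ
  have hD0 : 0 ≤ D := sub_nonneg.2 hστ
  have hD1 : D ≤ h₁ := hle.trans (min_le_left _ _)
  have hD2 : D * (4 * C + 4) ≤ β := by
    rw [← le_div_iff₀ (by positivity)]; exact hle.trans (min_le_right _ _)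
  set f : S → ℝ := fun j => Real.exp (D * G τ j) * u j
  set z : ℝ → S → ℝ := fun r i => ∑ j, NormedSpace.exp ((τ - r) • A) i j * f j
  -- The potential is frozen at the right endpoint τ and removed gradually by e. At r = σ, where e =
  -- 1, φ is the left side of the claim; at r = τ, where e cancels the factor exp (D G) in f, it is
  -- Σ m_τ u². A differential inequality for φ connects the two.
  set e : ℝ → S → ℝ := fun r i => Real.exp (-2 * (r - σ) * G τ i)
  set φ : ℝ → ℝ := fun r => ∑ i, e r i * (m r i * z r i ^ 2)
  have hz : ∀ r i, HasDerivAt (fun r => z r i) (-∑ k, A i k * z r k) r := fun r i =>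
    hasDerivAt_exp_sub_smul_mulVec A f τ r i
  have he : ∀ r i, HasDerivAt (fun r => e r i) (e r i * (-2 * G τ i)) r := by
    intro r i
    have : HasDerivAt (fun r => -2 * (r - σ) * G τ i) (-2 * G τ i) r := by
      have := ((((hasDerivAt_id r).sub_const σ).const_mul (-2)).mul_const (G τ i))
      simpa using this
    exact this.exp
  have hsub : Icc σ τ ⊆ Icc a b := Icc_subset_Icc hσ.1 hτ.2
  have hsub' : Ioo σ τ ⊆ Ioo a b := Ioo_subset_Ioo hσ.1 hτ.2
  have hφcont : ContinuousOn φ (Icc σ τ) := by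
    refine continuousOn_finsetSum _ fun i _ => ?_
    refine ContinuousOn.mul (fun r _ => (he r i).continuousAt.continuousWithinAt) ?_
    refine ContinuousOn.mul ((hm_cont i).mono hsub) (ContinuousOn.pow ?_ 2)
    exact fun r _ => (hz r i).continuousAt.continuousWithinAt
  have hφderiv : ∀ r ∈ Ioo σ τ, HasDerivAt φ (-∑ i, e r i * (2 * (m r i * z r i *
      ∑ j, A i j * z r j) + 2 * (m r i * G τ i * z r i ^ 2) - m' r i * z r i ^ 2)) r := by
    intro r hr
    have h := HasDerivAt.fun_sum (u := Finset.univ) fun i (_ : i ∈ Finset.univ) =>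
      (he r i).fun_mul ((hm_deriv r (hsub' hr) i).fun_mul ((hz r i).fun_pow 2))
    convert! h using 1
    rw [← Finset.sum_neg_distrib]
    refine Finset.sum_congr rfl fun i _ => ?_
    simp only [Nat.cast_ofNat, Nat.add_one_sub_one, pow_one]
    ring
  have hkey : ∀ r ∈ Ioo σ τ, ∑ i, e r i * (2 * (m r i * z r i *
      ∑ j, A i j * z r j) + 2 * (m r i * G τ i * z r i ^ 2) - m' r i * z r i ^ 2) ≤
      (2 * Λ + δ) * φ r := by
    intro r hr
    have hr' : r ∈ Icc a b := hsub (Ioo_subset_Icc_self hr)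
    refine perturbed_form_le (G := G r) hc hΛ hβ.le hδ.le hC (hm_ge r hr')
      (fun i => ?_) (fun i => ?_) (fun i => ?_) (fun i j => ?_) (fun i => ?_) (fun i => ?_) hβR
      (z r) (hspec r hr' _)
    · exact (le_abs_self _).trans ((hm_le r hr' i).trans (by simp only [C]; linarith))
    · exact (hm'_le r hr' i).trans (by simp only [C]; linarith)
    · exact (hG_le τ hτ i).trans (by simp only [C]; linarith)
    · exact (hA_le i j).trans (by simp only [C]; linarith)
    · refine (hGd i τ hτ r hr' ?_).le
      rw [abs_of_nonneg (by linarith [hr.2])]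
      have := hh₁' i
      have := hr.1
      simp only [D] at hD1
      linarith
    · have hx : |-2 * (r - σ) * G τ i| ≤ β / 2 := by
        rw [abs_mul, abs_mul, abs_of_nonneg (by linarith [hr.1] : 0 ≤ r - σ)]
        have h1 : r - σ ≤ D := by simp only [D]; linarith [hr.2]
        have h2 : |G τ i| ≤ C := (hG_le τ hτ i).trans (by simp only [C]; linarith)
        have h3 : (r - σ) * |G τ i| ≤ D * C :=
          mul_le_mul h1 h2 (abs_nonneg _) hD0
        norm_num
        nlinarith
      have hβ1 : β ≤ 1 := min_le_left _ _
      have := Real.abs_exp_sub_one_le (hx.trans (by linarith))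
      exact this.trans (by linarith)
  have hmono : MonotoneOn (fun r => Real.exp ((2 * Λ + δ) * (r - σ)) * φ r) (Icc σ τ) := by
    have hder : ∀ r ∈ Ioo σ τ, HasDerivAt (fun r => Real.exp ((2 * Λ + δ) * (r - σ)) * φ r)
        (Real.exp ((2 * Λ + δ) * (r - σ)) * (2 * Λ + δ) * φ r +
          Real.exp ((2 * Λ + δ) * (r - σ)) * (-∑ i, e r i * (2 * (m r i * z r i *
      ∑ j, A i j * z r j) + 2 * (m r i * G τ i * z r i ^ 2) - m' r i * z r i ^ 2))) r := by
      intro r hr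
      have h1 : HasDerivAt (fun r => (2 * Λ + δ) * (r - σ)) (2 * Λ + δ) r := by
        simpa using ((hasDerivAt_id r).sub_const σ).const_mul (2 * Λ + δ)
      exact h1.exp.fun_mul (hφderiv r hr)
    refine monotoneOn_of_deriv_nonneg (convex_Icc σ τ) ?_ ?_ ?_
    · exact ContinuousOn.mul (by fun_prop) hφcont
    · rw [interior_Icc]
      exact fun r hr => (hder r hr).differentiableAt.differentiableWithinAt
    · rw [interior_Icc]
      intro r hr
      rw [(hder r hr).deriv]
      have h2 := mul_le_mul_of_nonneg_left (hkey r hr)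
        (Real.exp_pos ((2 * Λ + δ) * (r - σ))).le
      linarith
  have hfin := hmono (left_mem_Icc.2 hστ) (right_mem_Icc.2 hστ) hστ
  have hL : φ σ = ∑ i, m σ i * (∑ j, NormedSpace.exp (D • A) i j * f j) ^ 2 := by
    simp [φ, e, z, D]
  have hRr : φ τ = ∑ i, m τ i * u i ^ 2 := by
    refine Finset.sum_congr rfl fun i _ => ?_
    have hzτ : z τ i = f i := by simp [z, NormedSpace.exp_zero, Matrix.one_apply]
    rw [hzτ]
    simp only [e, f]
    have : Real.exp (-2 * (τ - σ) * G τ i) * Real.exp (D * G τ i) ^ 2 = 1 := by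
      rw [← Real.exp_nat_mul, ← Real.exp_add]
      simp only [D]; norm_num; ring
    linear_combination (m τ i * u i ^ 2) * this
  simp only [sub_self, mul_zero, Real.exp_zero, one_mul] at hfin
  rw [hL, hRr] at hfin
  exact hfin

end FeynmanKac

/-! ### Path integrals of a finite chain over a partition. -/

section Chain

variable {S : Type*} [Fintype S] [DecidableEq S]

/-- `backward A σ h k` is the conditional expectation of `∏ i ≤ k, h i (ζ (σ i))` given
`ζ (σ 0)`, for the chain `ζ` with generator `A`. -/
def backward (A : Matrix S S ℝ) : ℕ → (ℕ → ℝ) → (ℕ → S → ℝ) → S → ℝ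
  | 0, _, h => h 0
  | k + 1, σ, h => fun i => h 0 i * ∑ j, NormedSpace.exp ((σ 1 - σ 0) • A) i j *
      backward A k (fun l => σ (l + 1)) (fun l => h (l + 1)) j

/-- Induction on the number of times: once the first state is fixed, the transition row out of it
plays the role of the initial law for the rest of the path. -/
lemma sum_path_weights (A : Matrix S S ℝ) (k : ℕ) (σ : ℕ → ℝ) (h : ℕ → S → ℝ) (μ : S → ℝ) :
    ∑ ξ : Fin (k + 1) → S, μ (ξ 0) * (∏ i : Fin k,
        NormedSpace.exp ((σ (i + 1) - σ i) • A) (ξ i.castSucc) (ξ i.succ)) *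
      ∏ i : Fin (k + 1), h i (ξ i) = ∑ j, μ j * backward A k σ h j := by
  induction k generalizing σ h μ with
  | zero =>
    rw [← (Equiv.funUnique (Fin 1) S).symm.sum_comp]
    simp [backward]
  | succ k ih =>
    rw [← (Fin.consEquiv fun _ : Fin (k + 2) => S).sum_comp, Fintype.sum_prod_type]
    refine Finset.sum_congr rfl fun x _ => ?_
    have := ih (fun l => σ (l + 1)) (fun l => h (l + 1))
      (fun j => NormedSpace.exp ((σ 1 - σ 0) • A) x j)
    simp only [backward]
    rw [← this, ← mul_assoc, Finset.mul_sum]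
    refine Finset.sum_congr rfl fun ξ _ => ?_
    simp only [Fin.consEquiv_apply, Fin.prod_univ_succ (n := k + 1), Fin.prod_univ_succ (n := k),
      Fin.cons_zero, Fin.cons_succ, Fin.val_zero, Fin.val_succ, Fin.castSucc_zero,
      ← Fin.succ_castSucc]
    simp only [zero_add]
    ring

variable [MeasurableSpace S] [MeasurableSingletonClass S]

/-- `ζ` is a right-continuous Markov chain on the finite set `S` with generator `A` and initial
law `μ`. -/
structure IsChain (A : Matrix S S ℝ) (μ : Measure S) {Ω : Type*} [MeasurableSpace Ω]
    (P : Measure Ω) (ζ : ℝ → Ω → S) : Prop where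
  measurable : ∀ t, 0 ≤ t → Measurable (ζ t)
  right_continuous : ∀ a t, 0 ≤ t → ∀ᶠ r in 𝓝[≥] t, ζ r a = ζ t a
  finite_dim : ∀ (k : ℕ) (τ : Fin (k + 1) → ℝ), Monotone τ → τ 0 = 0 →
    ∀ ξ : Fin (k + 1) → S,
      P {a | ∀ i, ζ (τ i) a = ξ i} = μ {ξ 0} * ∏ i : Fin k,
        ENNReal.ofReal (NormedSpace.exp ((τ i.succ - τ i.castSucc) • A)
          (ξ i.castSucc) (ξ i.succ))

variable {A : Matrix S S ℝ} {μ : Measure S} {Ω : Type*} [MeasurableSpace Ω] {P : Measure Ω}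
  {ζ : ℝ → Ω → S}

lemma IsChain.integral_prod [IsFiniteMeasure P] (hζ : IsChain A μ P ζ)
    (hA : IsRateMatrix A) (k : ℕ) (σ : ℕ → ℝ) (hσ : Monotone σ) (hσ0 : σ 0 = 0) (h : ℕ → S → ℝ) :
    ∫ a, ∏ i : Fin (k + 1), h i (ζ (σ i) a) ∂P = ∑ j, μ.real {j} * backward A k σ h j := by
  have hσn : ∀ i, 0 ≤ σ i := fun i => hσ0 ▸ hσ (Nat.zero_le i)
  set X : Ω → (Fin (k + 1) → S) := fun a i => ζ (σ i) a
  have hX : Measurable X := measurable_pi_lambda _ fun i => hζ.measurable _ (hσn _)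
  have h1 : ∫ a, ∏ i : Fin (k + 1), h i (ζ (σ i) a) ∂P =
      ∫ ξ, ∏ i : Fin (k + 1), h i (ξ i) ∂(P.map X) := by
    rw [integral_map hX.aemeasurable (measurable_of_countable _).aestronglyMeasurable]
  have : IsFiniteMeasure (P.map X) := by infer_instance
  rw [h1, integral_fintype (Integrable.of_finite), ← sum_path_weights A k σ h (fun j => μ.real {j})]
  refine Finset.sum_congr rfl fun ξ _ => ?_
  rw [smul_eq_mul]
  congr 1
  rw [measureReal_def, Measure.map_apply hX (measurableSet_singleton ξ)]
  have hset : X ⁻¹' {ξ} = {a | ∀ i : Fin (k + 1), ζ ((fun i : Fin (k + 1) => σ i) i) a = ξ i} := by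
    ext a; simp [X, funext_iff]
  rw [hset, hζ.finite_dim k (fun i => σ i) (fun i j hij => hσ hij) (by simpa using hσ0),
    ENNReal.toReal_mul, ENNReal.toReal_prod]
  congr 1
  refine Finset.prod_congr rfl fun i _ => ?_
  rw [ENNReal.toReal_ofReal]
  · simp
  · exact exp_smul_nonneg hA (by simpa using hσ (Nat.le_succ _)) _ _

lemma IsChain.measureReal_eq [IsFiniteMeasure P] (hζ : IsChain A μ P ζ) (hA : IsRateMatrix A)
    {t : ℝ} (ht : 0 ≤ t) (j : S) :
    P.real {a | ζ t a = j} = lawAt A (fun i => μ.real {i}) t j := by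
  have h := hζ.integral_prod hA 1 (fun i => if i = 0 then 0 else t)
    (monotone_nat_of_le_succ fun n => by rcases n with _ | n <;> simp [ht]) (by simp)
    (fun i => if i = 0 then fun _ => 1 else fun k => if k = j then 1 else 0)
  simp only [backward, if_true, one_ne_zero, if_false, one_mul, zero_add,
    sub_zero, mul_ite, mul_one, mul_zero, Finset.sum_ite_eq', Finset.mem_univ] at h
  rw [lawAt, ← h]
  have hs : MeasurableSet {a | ζ t a = j} := hζ.measurable t ht (measurableSet_singleton j)
  rw [← integral_indicator_one hs]
  congr 1
  funext a
  erw [Fin.prod_univ_two]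
  simp [indicator]

lemma IsChain.integral_comp [IsFiniteMeasure P] (hζ : IsChain A μ P ζ) (hA : IsRateMatrix A)
    {t : ℝ} (ht : 0 ≤ t) (f : S → ℝ) :
    ∫ a, f (ζ t a) ∂P = ∑ j, lawAt A (fun i => μ.real {i}) t j * f j := by
  have hm := hζ.measurable t ht
  have h1 : ∫ a, f (ζ t a) ∂P = ∫ ξ, f ξ ∂(P.map (ζ t)) := by
    rw [integral_map hm.aemeasurable (measurable_of_countable _).aestronglyMeasurable]
  have : IsFiniteMeasure (P.map (ζ t)) := by infer_instance
  rw [h1, integral_fintype (Integrable.of_finite)]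
  refine Finset.sum_congr rfl fun j _ => ?_
  rw [smul_eq_mul, ← hζ.measureReal_eq hA ht, measureReal_def,
    Measure.map_apply hm (measurableSet_singleton j)]
  rfl

/-- The Feynman-Kac bound along a partition, with the initial law changed to `m a`. -/
lemma IsChain.integral_feynmanKac_partition_le [IsFiniteMeasure P] (hζ : IsChain A μ P ζ)
    (hA : IsRateMatrix A)
    {m m' G : ℝ → S → ℝ} {a b Λ δ : ℝ} (ha : 0 ≤ a) (hab : a ≤ b)
    (hΛ : 0 ≤ Λ) (hδ : 0 < δ)
    (hm_pos : ∀ r ∈ Icc a b, ∀ i, 0 < m r i)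
    (hm_one : ∀ r ∈ Icc a b, ∑ i, m r i = 1)
    (hm_cont : ∀ i, ContinuousOn (fun r => m r i) (Icc a b))
    (hm'_cont : ∀ i, ContinuousOn (fun r => m' r i) (Icc a b))
    (hG_cont : ∀ i, ContinuousOn (fun r => G r i) (Icc a b))
    (hm_deriv : ∀ r ∈ Ioo a b, ∀ i, HasDerivAt (fun r => m r i) (m' r i) r)
    (hspec : ∀ r ∈ Icc a b, ∀ v : S → ℝ,
      2 * ∑ i, m r i * v i * ∑ j, A i j * v j + 2 * ∑ i, m r i * G r i * v i ^ 2
        - ∑ i, m' r i * v i ^ 2 ≤ 2 * Λ * ∑ i, m r i * v i ^ 2) :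
    ∀ᶠ N : ℕ in atTop, ∫ x, m a (ζ a x) / lawAt A (fun i => μ.real {i}) a (ζ a x) *
        Real.exp ((b - a) / N * ∑ k ∈ Finset.range N,
          G (a + (k + 1 : ℕ) * ((b - a) / N)) (ζ (a + (k + 1 : ℕ) * ((b - a) / N)) x)) ∂P ≤
      Real.exp ((Λ + δ) * (b - a)) := by
  obtain ⟨h₀, hh₀, hstep⟩ := feynmanKac_step hΛ (mul_pos two_pos hδ) hm_pos hm_cont hm'_cont
    hG_cont hm_deriv hspec
  have hlim : Tendsto (fun N : ℕ => (b - a) / N) atTop (𝓝 0) :=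
    tendsto_const_div_atTop_nhds_zero_nat (b - a)
  filter_upwards [hlim.eventually (ge_mem_nhds hh₀), eventually_ge_atTop 1] with N hN hN1
  have hNpos : (0 : ℝ) < N := by exact_mod_cast hN1
  set D := (b - a) / N with hD
  have hD0 : 0 ≤ D := div_nonneg (sub_nonneg.2 hab) hNpos.le
  have hND : N * D = b - a := by rw [hD]; field_simp
  set p := lawAt A (fun i => μ.real {i}) a
  set τ : ℕ → ℝ := fun k => a + k * D
  have hτ : ∀ k ≤ N, τ k ∈ Icc a b := by
    intro k hk
    have hk' : (k : ℝ) ≤ N := by exact_mod_cast hk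
    have h1 : 0 ≤ (k : ℝ) * D := by positivity
    have h2 : (k : ℝ) * D ≤ N * D := mul_le_mul_of_nonneg_right hk' hD0
    constructor <;> simp only [τ] <;> linarith
  have hτs : ∀ k, τ (k + 1) - τ k = D := fun k => by simp only [τ]; push_cast; ring
  -- The partition of [a, b] is preceded by the time 0, where μ is given. The factor at time a
  -- changes the law into m a, and the factors exp (D G) sit at the right endpoints of the cells.
  set σ : ℕ → ℝ := fun l => if l = 0 then 0 else τ (l - 1)
  set h : ℕ → S → ℝ := fun l => if l = 0 then fun _ => 1 else if l = 1 then
    fun i => m a i / p i else fun i => Real.exp (D * G (τ (l - 1)) i)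
  have hσ : Monotone σ := by
    refine monotone_nat_of_le_succ fun n => ?_
    rcases n with _ | n
    · simp only [σ, τ]; simpa using ha
    · have := hτs n
      simp only [σ, Nat.add_one_ne_zero, if_false, Nat.add_sub_cancel]
      linarith
  -- Induction backwards from b, each step paying the factor of `feynmanKac_step`. The factor h at
  -- the first time of the block is kept apart, because one step acts on exp (D G) times w.
  have hback : ∀ k l, k + l = N → ∃ w : S → ℝ,
      (backward A k (fun q => σ (q + (l + 1))) (fun q => h (q + (l + 1))) =
        fun i => h (l + 1) i * w i) ∧
      ∑ i, m (τ l) i * w i ^ 2 ≤ Real.exp ((2 * Λ + 2 * δ) * (k * D)) := by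
    intro k
    induction k with
    | zero =>
      intro l hl
      refine ⟨fun _ => 1, ?_, ?_⟩
      · funext i; simp [backward]
      · have : τ l ∈ Icc a b := hτ l (by omega)
        simp [hm_one _ this]
    | succ k ih =>
      intro l hl
      obtain ⟨w, hw, hwb⟩ := ih (l + 1) (by omega)
      refine ⟨fun i => ∑ j, NormedSpace.exp (D • A) i j * (Real.exp (D * G (τ (l + 1)) j) * w j),
        ?_, ?_⟩
      · funext i
        simp only [backward, zero_add]
        have e1 : σ (1 + (l + 1)) - σ (l + 1) = D := by
          have := hτs l
          simp only [σ, Nat.add_one_ne_zero, if_false, Nat.add_sub_cancel,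
            show 1 + (l + 1) ≠ 0 by omega, show 1 + (l + 1) - 1 = l + 1 by omega]
          exact this
        have e2 : (fun q => σ (q + 1 + (l + 1))) = fun q => σ (q + (l + 1 + 1)) := by
          funext q; congr 1; ring
        have e3 : (fun q => h (q + 1 + (l + 1))) = fun q => h (q + (l + 1 + 1)) := by
          funext q; congr 1; ring
        rw [e1, e2, e3, hw]
        congr 1
      · have hs := hstep (τ l) (hτ l (by omega)) (τ (l + 1)) (hτ (l + 1) (by omega))
          (by linarith [hτs l]) (by rw [hτs l]; exact hN) w
        rw [hτs l] at hs
        refine hs.trans ?_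
        calc _ ≤ Real.exp ((2 * Λ + 2 * δ) * D) * Real.exp ((2 * Λ + 2 * δ) * (k * D)) := by
              gcongr
          _ = _ := by rw [← Real.exp_add]; push_cast; congr 1; ring
  obtain ⟨w, hw, hwb⟩ := hback N 0 (by omega)
  have hint := hζ.integral_prod hA (N + 1) σ hσ (by simp [σ]) h
  have hLHS : ∀ x, ∏ i : Fin (N + 1 + 1), h i (ζ (σ i) x) = m a (ζ a x) / p (ζ a x) *
      Real.exp (D * ∑ k ∈ Finset.range N, G (a + (k + 1 : ℕ) * D) (ζ (a + (k + 1 : ℕ) * D) x)) := by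
    intro x
    rw [Fin.prod_univ_eq_prod_range (fun i => h i (ζ (σ i) x)) (N + 1 + 1), Finset.prod_range_succ',
      Finset.prod_range_succ', Finset.mul_sum, Real.exp_sum]
    have h00 : h 0 (ζ (σ 0) x) = 1 := by simp [h]
    have h11 : h (0 + 1) (ζ (σ (0 + 1)) x) = m a (ζ a x) / p (ζ a x) := by
      simp [h, σ, τ]
    rw [h00, h11, mul_one, mul_comm]
    congr 1
  simp only [hLHS] at hint
  rw [hint]
  have hB : ∀ i, backward A (N + 1) σ h i = ∑ j, NormedSpace.exp (a • A) i j *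
      (m a j / p j * w j) := by
    intro i
    simp only [backward]
    have e0 : σ 1 - σ 0 = a := by simp [σ, τ]
    have hw' : backward A N (fun l => σ (l + 1)) (fun l => h (l + 1)) =
        fun i => h (0 + 1) i * w i := hw
    rw [e0, hw']
    simp [h]
  simp only [hB, Finset.mul_sum]
  rw [Finset.sum_comm]
  have haI : a ∈ Icc a b := left_mem_Icc.2 hab
  have hp0 : ∀ j, 0 ≤ p j := fun j => lawAt_nonneg hA (fun _ => measureReal_nonneg) ha j
  have h5 : ∑ j, ∑ i, μ.real {i} * (NormedSpace.exp (a • A) i j * (m a j / p j * w j)) ≤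
      ∑ j, m a j * |w j| := by
    refine Finset.sum_le_sum fun j _ => ?_
    have : ∑ i, μ.real {i} * (NormedSpace.exp (a • A) i j * (m a j / p j * w j)) =
        p j * (m a j / p j * w j) := by
      simp only [p, lawAt, Finset.sum_mul]
      refine Finset.sum_congr rfl fun i _ => by ring
    rw [this]
    -- Where p vanishes, m / p is 0 and the change of law loses mass, which is harmless for an upper
    -- bound.
    rcases (hp0 j).eq_or_lt with h0 | h0
    · rw [← h0, zero_mul]
      exact mul_nonneg (hm_pos a haI j).le (abs_nonneg _)
    · have e : p j * (m a j / p j * w j) = m a j * w j := by field_simp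
      rw [e]
      exact mul_le_mul_of_nonneg_left (le_abs_self _) (hm_pos a haI j).le
  refine h5.trans ?_
  -- Cauchy-Schwarz for the probability weights m a.
  have h6 : (∑ j, m a j * |w j|) ^ 2 ≤ (∑ j, m a j) * ∑ j, m a j * w j ^ 2 := by
    refine Finset.sum_sq_le_sum_mul_sum_of_sq_le_mul _ (fun j _ => (hm_pos a haI j).le)
      (fun j _ => mul_nonneg (hm_pos a haI j).le (sq_nonneg _)) fun j _ => ?_
    rw [mul_pow, sq_abs]; exact le_of_eq (by ring)
  have hτ0 : τ 0 = a := by simp [τ]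
  rw [hm_one a haI, one_mul] at h6
  rw [hτ0, hND] at hwb
  have h7 : (∑ j, m a j * |w j|) ^ 2 ≤ Real.exp ((Λ + δ) * (b - a)) ^ 2 := by
    refine (h6.trans hwb).trans (le_of_eq ?_)
    rw [← Real.exp_nat_mul]; congr 1; push_cast; ring
  exact le_of_sq_le_sq h7 (Real.exp_pos _).le

end Chain

/-- Rounding each point of a cell up to the right endpoint makes the Riemann sum the integral of f
at arguments that tend to r from the right. Right continuity and boundedness then suffice, by
dominated convergence. -/
lemma tendsto_riemannSum_of_rightContinuous {f : ℝ → ℝ} {a b C : ℝ} (hab : a < b)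
    (hf : ∀ r ∈ Icc a b, ContinuousWithinAt f (Icc r b) r)
    (hC : ∀ r ∈ Icc a b, |f r| ≤ C) :
    Tendsto (fun N : ℕ => (b - a) / N * ∑ k ∈ Finset.range N, f (a + (k + 1 : ℕ) * ((b - a) / N)))
      atTop (𝓝 (∫ r in a..b, f r)) := by
  set c : ℕ → ℝ → ℝ := fun N r => a + ⌈(r - a) / ((b - a) / N)⌉₊ * ((b - a) / N)
  have hba : 0 < b - a := sub_pos.2 hab
  have hstep : ∀ N : ℕ, 1 ≤ N → ∀ k : ℕ, ∀ r ∈ Ioc (a + k * ((b - a) / N))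
      (a + (k + 1 : ℕ) * ((b - a) / N)), c N r = a + (k + 1 : ℕ) * ((b - a) / N) := by
    intro N hN k r hr
    have hNpos : (0 : ℝ) < N := by exact_mod_cast hN
    have hD : 0 < (b - a) / N := by positivity
    have : ⌈(r - a) / ((b - a) / N)⌉₊ = k + 1 := by
      rw [Nat.ceil_eq_iff (by omega)]
      constructor
      · rw [Nat.add_sub_cancel, lt_div_iff₀ hD]; linarith [hr.1]
      · rw [div_le_iff₀ hD]; linarith [hr.2]
    simp only [c, this]
  have hint : ∀ N : ℕ, 1 ≤ N → ∫ r in a..b, f (c N r) =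
      (b - a) / N * ∑ k ∈ Finset.range N, f (a + (k + 1 : ℕ) * ((b - a) / N)) := by
    intro N hN
    have hNpos : (0 : ℝ) < N := by exact_mod_cast hN
    have hD : 0 < (b - a) / N := by positivity
    have hle : ∀ k : ℕ, a + k * ((b - a) / N) ≤ a + (k + 1 : ℕ) * ((b - a) / N) := fun k => by
      push_cast; linarith
    have hcongr : ∀ k : ℕ, EqOn (fun r => f (c N r))
        (fun _ => f (a + (k + 1 : ℕ) * ((b - a) / N)))
        (uIoc (a + k * ((b - a) / N)) (a + (k + 1 : ℕ) * ((b - a) / N))) := by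
      intro k r hr
      rw [uIoc_of_le (hle k)] at hr
      simp only [hstep N hN k r hr]
    have hsum := intervalIntegral.sum_integral_adjacent_intervals (μ := volume)
      (f := fun r => f (c N r))
      (a := fun k : ℕ => a + k * ((b - a) / N)) (n := N) (fun k _ =>
        (intervalIntegrable_const (c := f (a + (k + 1 : ℕ) * ((b - a) / N)))).congr
          (fun r hr => (hcongr k hr).symm))
    have e0 : a + ((0 : ℕ) : ℝ) * ((b - a) / N) = a := by simp
    have e1 : a + (N : ℝ) * ((b - a) / N) = b := by field_simp; ring
    simp only [e0, e1] at hsum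
    rw [← hsum, Finset.mul_sum]
    refine Finset.sum_congr rfl fun k _ => ?_
    rw [intervalIntegral.integral_congr_ae (Eventually.of_forall fun r hr => hcongr k hr),
      intervalIntegral.integral_const, smul_eq_mul]
    push_cast
    ring
  have hcmem : ∀ N : ℕ, 1 ≤ N → ∀ r ∈ Ioc a b, c N r ∈ Icc r b ∧ c N r ≤ r + (b - a) / N := by
    intro N hN r hr
    have hNpos : (0 : ℝ) < N := by exact_mod_cast hN
    have hD : 0 < (b - a) / N := by positivity
    have h0 : 0 ≤ (r - a) / ((b - a) / N) := div_nonneg (by linarith [hr.1]) hD.le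
    have h1 := Nat.le_ceil ((r - a) / ((b - a) / N))
    have h2 := Nat.ceil_lt_add_one h0
    have h3 : ⌈(r - a) / ((b - a) / N)⌉₊ ≤ N := by
      rw [Nat.ceil_le, div_le_iff₀ hD]
      have : (N : ℝ) * ((b - a) / N) = b - a := by field_simp
      linarith [hr.2]
    have h3' : (⌈(r - a) / ((b - a) / N)⌉₊ : ℝ) ≤ N := by exact_mod_cast h3
    rw [div_le_iff₀ hD] at h1
    have h4 : (⌈(r - a) / ((b - a) / N)⌉₊ : ℝ) * ((b - a) / N) < r - a + (b - a) / N := by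
      have := mul_lt_mul_of_pos_right h2 hD
      rwa [add_mul, div_mul_cancel₀ _ hD.ne', one_mul] at this
    have h5 : (⌈(r - a) / ((b - a) / N)⌉₊ : ℝ) * ((b - a) / N) ≤ b - a := by
      have := mul_le_mul_of_nonneg_right h3' hD.le
      have e : (N : ℝ) * ((b - a) / N) = b - a := by field_simp
      linarith
    refine ⟨⟨?_, ?_⟩, ?_⟩ <;> simp only [c] <;> linarith
  have hmain : Tendsto (fun N : ℕ => ∫ r in a..b, f (c N r)) atTop (𝓝 (∫ r in a..b, f r)) := by
    refine intervalIntegral.tendsto_integral_filter_of_dominated_convergence (fun _ => C) ?_ ?_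
      intervalIntegrable_const ?_
    · refine Eventually.of_forall fun N => Measurable.aestronglyMeasurable ?_
      exact (measurable_from_nat (f := fun k : ℕ => f (a + k * ((b - a) / N)))).comp
        (Nat.measurable_ceil.comp (by fun_prop))
    · filter_upwards [eventually_ge_atTop 1] with N hN
      refine Eventually.of_forall fun r hr => ?_
      rw [uIoc_of_le hab.le] at hr
      have := (hcmem N hN r hr).1
      exact hC _ ⟨hr.1.le.trans this.1, this.2⟩
    · refine Eventually.of_forall fun r hr => ?_
      rw [uIoc_of_le hab.le] at hr
      have hr' : r ∈ Icc a b := Ioc_subset_Icc_self hr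
      refine (hf r hr').tendsto.comp ?_
      refine tendsto_nhdsWithin_iff.2 ⟨?_, ?_⟩
      · have h1 : Tendsto (fun N : ℕ => r + (b - a) / N) atTop (𝓝 r) := by
          simpa using (tendsto_const_div_atTop_nhds_zero_nat (b - a)).const_add r
        refine tendsto_of_tendsto_of_tendsto_of_le_of_le' tendsto_const_nhds h1 ?_ ?_
        · filter_upwards [eventually_ge_atTop 1] with N hN using (hcmem N hN r hr).1.1
        · filter_upwards [eventually_ge_atTop 1] with N hN using (hcmem N hN r hr).2
      · filter_upwards [eventually_ge_atTop 1] with N hN using (hcmem N hN r hr).1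
  refine hmain.congr' ?_
  filter_upwards [eventually_ge_atTop 1] with N hN using hint N hN

/-- Integrating sub-Gaussian exponential moments against a Gaussian weight gives a square
exponential moment. -/
lemma lintegral_exp_sq_le {Ω : Type*} [MeasurableSpace Ω] {P : Measure Ω} [SFinite P]
    {k Y : Ω → ℝ} (hk : Measurable k) (hk0 : ∀ x, 0 ≤ k x) (hY : Measurable Y) {σ : ℝ} (hσ : 0 < σ)
    (h : ∀ γ : ℝ, ∫⁻ x, ENNReal.ofReal (k x * Real.exp (γ * Y x)) ∂P ≤
      ENNReal.ofReal (Real.exp (σ * γ ^ 2))) :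
    ∫⁻ x, ENNReal.ofReal (k x * Real.exp (Y x ^ 2 / (8 * σ))) ∂P ≤ ENNReal.ofReal 2 := by
  -- Completing the square against the weight exp (−2σγ²). The hypothesis uses up half of this
  -- weight; the integral of the remaining exp (−σγ²) is larger only by the factor √2 ≤ 2.
  have hgauss : ∀ y : ℝ, ∫⁻ γ : ℝ, ENNReal.ofReal (Real.exp (γ * y - 2 * σ * γ ^ 2)) =
      ENNReal.ofReal (√(Real.pi / (2 * σ)) * Real.exp (y ^ 2 / (8 * σ))) := by
    intro y
    have e : ∀ γ : ℝ, Real.exp (γ * y - 2 * σ * γ ^ 2) =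
        Real.exp (-(2 * σ) * (γ - y / (4 * σ)) ^ 2) * Real.exp (y ^ 2 / (8 * σ)) := by
      intro γ
      rw [← Real.exp_add]; congr 1; field_simp; ring
    have hi : Integrable fun γ : ℝ => Real.exp (-(2 * σ) * (γ - y / (4 * σ)) ^ 2) :=
      (integrable_exp_neg_mul_sq (by positivity : 0 < 2 * σ)).comp_sub_right (y / (4 * σ))
    simp only [e]
    rw [← ofReal_integral_eq_lintegral_ofReal (hi.mul_const _)
      (Eventually.of_forall fun γ => by positivity), integral_mul_const,
      integral_sub_right_eq_self (fun γ => Real.exp (-(2 * σ) * γ ^ 2)), integral_gaussian]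
  have hc : 0 < √(Real.pi / (2 * σ)) := Real.sqrt_pos.2 (by positivity)
  have h1 : ENNReal.ofReal √(Real.pi / (2 * σ)) *
      ∫⁻ x, ENNReal.ofReal (k x * Real.exp (Y x ^ 2 / (8 * σ))) ∂P ≤
      ENNReal.ofReal √(Real.pi / (2 * σ)) * ENNReal.ofReal 2 := by
    rw [← lintegral_const_mul' _ _ ENNReal.ofReal_ne_top]
    calc _ = ∫⁻ x, (∫⁻ γ : ℝ, ENNReal.ofReal (k x * Real.exp (γ * Y x - 2 * σ * γ ^ 2))) ∂P := by
          refine lintegral_congr fun x => ?_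
          simp only [ENNReal.ofReal_mul (hk0 x)]
          rw [lintegral_const_mul' _ _ ENNReal.ofReal_ne_top, hgauss, ENNReal.ofReal_mul hc.le]
          ring
      _ = ∫⁻ γ : ℝ, ∫⁻ x, ENNReal.ofReal (k x * Real.exp (γ * Y x - 2 * σ * γ ^ 2)) ∂P := by
          refine lintegral_lintegral_swap (Measurable.aemeasurable ?_)
          simp only [Function.uncurry_def]
          fun_prop
      _ = ∫⁻ γ : ℝ, ENNReal.ofReal (Real.exp (-(2 * σ * γ ^ 2))) *
            ∫⁻ x, ENNReal.ofReal (k x * Real.exp (γ * Y x)) ∂P := by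
          refine lintegral_congr fun γ => ?_
          rw [← lintegral_const_mul' _ _ ENNReal.ofReal_ne_top]
          refine lintegral_congr fun x => ?_
          rw [← ENNReal.ofReal_mul (Real.exp_pos _).le]
          congr 1
          rw [sub_eq_add_neg, Real.exp_add]; ring
      _ ≤ ∫⁻ γ : ℝ, ENNReal.ofReal (Real.exp (-σ * γ ^ 2)) := by
          refine lintegral_mono fun γ => ?_
          refine (mul_le_mul_right (h γ) _).trans (le_of_eq ?_)
          rw [← ENNReal.ofReal_mul (Real.exp_pos _).le, ← Real.exp_add]
          congr 2; ring
      _ = ENNReal.ofReal √(Real.pi / σ) := by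
          rw [← ofReal_integral_eq_lintegral_ofReal (integrable_exp_neg_mul_sq hσ)
            (Eventually.of_forall fun γ => by positivity), integral_gaussian]
      _ ≤ ENNReal.ofReal √(Real.pi / (2 * σ)) * ENNReal.ofReal 2 := by
          rw [← ENNReal.ofReal_mul hc.le]
          refine ENNReal.ofReal_le_ofReal ?_
          have : √(Real.pi / (2 * σ)) * 2 = √(Real.pi / (2 * σ) * 4) := by
            rw [Real.sqrt_mul (by positivity), show (4 : ℝ) = 2 ^ 2 by norm_num,
              Real.sqrt_sq (by norm_num)]
          rw [this]
          refine Real.sqrt_le_sqrt ?_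
          have h3 : Real.pi / (2 * σ) * 4 = 2 * (Real.pi / σ) := by field_simp; norm_num
          have h4 : 0 < Real.pi / σ := by positivity
          linarith
  rwa [ENNReal.mul_le_mul_iff_right (by simpa using hc) ENNReal.ofReal_ne_top] at h1

/-- The finite version of `lintegral_exp_sq_le`. -/
lemma sum_exp_sq_le {S : Type*} [Fintype S] {k Y : S → ℝ} (hk0 : ∀ x, 0 ≤ k x)
    {σ : ℝ} (hσ : 0 < σ) (h : ∀ γ : ℝ, ∑ x, k x * Real.exp (γ * Y x) ≤ Real.exp (σ * γ ^ 2)) :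
    ∑ x, k x * Real.exp (Y x ^ 2 / (8 * σ)) ≤ 2 := by
  let _ : MeasurableSpace S := ⊤
  have hsum : ∀ f : S → ℝ, (∀ x, 0 ≤ f x) →
      ∫⁻ x, ENNReal.ofReal (f x) ∂Measure.count = ENNReal.ofReal (∑ x, f x) := by
    intro f hf
    rw [lintegral_count, tsum_fintype, ENNReal.ofReal_sum_of_nonneg fun x _ => hf x]
  have := lintegral_exp_sq_le (P := Measure.count) (k := k) (Y := Y) (measurable_from_top) hk0
    (measurable_from_top) hσ (fun γ => by
      rw [hsum _ fun x => mul_nonneg (hk0 x) (Real.exp_pos _).le]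
      exact ENNReal.ofReal_le_ofReal (h γ))
  rw [hsum _ fun x => mul_nonneg (hk0 x) (Real.exp_pos _).le] at this
  exact (ENNReal.ofReal_le_ofReal_iff (by norm_num)).1 this

lemma abs_integral_path_le {S Ω : Type*} {ζ : ℝ → Ω → S} {a b C : ℝ} (hab : a ≤ b)
    {G : ℝ → S → ℝ} (hC : ∀ r ∈ Icc a b, ∀ i, |G r i| ≤ C) (x : Ω) :
    |∫ r in a..b, G r (ζ r x)| ≤ C * (b - a) := by
  have := intervalIntegral.norm_integral_le_of_norm_le_const (a := a) (b := b)
    (f := fun r => G r (ζ r x)) (C := C) (fun r hr => by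
      rw [uIoc_of_le hab] at hr
      exact hC r (Ioc_subset_Icc_self hr) _)
  rwa [abs_of_nonneg (sub_nonneg.2 hab)] at this

/-! ### Additive functionals of a chain: Feynman-Kac bound and second moments. -/

section Path

variable {S : Type*} [Fintype S] [DecidableEq S] [MeasurableSpace S] [MeasurableSingletonClass S]
  {A : Matrix S S ℝ} {μ : Measure S} {Ω : Type*} [MeasurableSpace Ω] {P : Measure Ω}
  {ζ : ℝ → Ω → S}

/-- Rounding the time up to the grid of mesh 1 / (N + 1) gives jointly measurable approximations,
which converge by right continuity. The maximum with 0 is there because nothing is assumed at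
negative times. -/
lemma IsChain.measurable_indicator_eq (hζ : IsChain A μ P ζ) (i : S) :
    Measurable fun p : ℝ × Ω => if ζ (max p.1 0) p.2 = i then (1 : ℝ) else 0 := by
  set t : ℕ → ℝ → ℝ := fun N r => ((⌈max r 0 * (N + 1)⌉₊ : ℕ) : ℝ) / (N + 1)
  have hmeas : ∀ N : ℕ, Measurable fun p : ℝ × Ω => if ζ (t N p.1) p.2 = i then (1 : ℝ) else 0 := by
    intro N
    have h1 : Measurable fun p : ℕ × Ω => if ζ ((p.1 : ℝ) / (N + 1)) p.2 = i then (1 : ℝ) else 0 :=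
      measurable_from_prod_countable_right fun k =>
        Measurable.ite (hζ.measurable ((k : ℝ) / (N + 1)) (by positivity)
          (measurableSet_singleton i)) measurable_const measurable_const
    have h2 : Measurable fun p : ℝ × Ω => ((⌈max p.1 0 * (N + 1)⌉₊ : ℕ), p.2) :=
      (Nat.measurable_ceil.comp (by fun_prop)).prodMk measurable_snd
    exact h1.comp h2
  refine measurable_of_tendsto_metrizable hmeas (tendsto_pi_nhds.2 fun p => ?_)
  have hp : (0 : ℝ) ≤ max p.1 0 := le_max_right _ _
  have hlim : Tendsto (fun N => t N p.1) atTop (𝓝[≥] (max p.1 0)) := by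
    refine tendsto_nhdsWithin_iff.2 ⟨?_, Eventually.of_forall fun N => ?_⟩
    · have h1 : Tendsto (fun N : ℕ => max p.1 0 + 1 / ((N : ℝ) + 1)) atTop (𝓝 (max p.1 0)) := by
        simpa using (tendsto_one_div_add_atTop_nhds_zero_nat (𝕜 := ℝ)).const_add (max p.1 0)
      refine tendsto_of_tendsto_of_tendsto_of_le_of_le tendsto_const_nhds h1 (fun N => ?_)
        (fun N => ?_)
      · have hN : (0 : ℝ) < N + 1 := by positivity
        simp only [t]
        rw [le_div_iff₀ hN]
        exact Nat.le_ceil _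
      · have hN : (0 : ℝ) < N + 1 := by positivity
        simp only [t]
        rw [div_le_iff₀ hN, add_mul, one_div_mul_cancel hN.ne']
        exact (Nat.ceil_lt_add_one (by positivity)).le
    · have hN : (0 : ℝ) < N + 1 := by positivity
      show max p.1 0 ≤ t N p.1
      simp only [t]
      rw [le_div_iff₀ hN]
      exact Nat.le_ceil _
  refine tendsto_const_nhds.congr' ?_
  filter_upwards [hlim.eventually (hζ.right_continuous p.2 _ hp)] with N hN
  rw [hN]

lemma IsChain.measurable_uncurry (hζ : IsChain A μ P ζ) {a b : ℝ} (ha : 0 ≤ a) {G : ℝ → S → ℝ}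
    (hG : ∀ i, ContinuousOn (fun r => G r i) (Icc a b)) :
    Measurable fun p : ℝ × Ω => (Icc a b).indicator (fun r => G r (ζ r p.2)) p.1 := by
  classical
  have h1 : ∀ i, Measurable ((Icc a b).indicator fun r => G r i) := by
    intro i
    have := (hG i).measurable_piecewise (g := 0) continuousOn_const measurableSet_Icc
    rwa [piecewise_eq_indicator] at this
  have h2 : (fun p : ℝ × Ω => (Icc a b).indicator (fun r => G r (ζ r p.2)) p.1) =
      fun p => ∑ i, (Icc a b).indicator (fun r => G r i) p.1 *
        if ζ (max p.1 0) p.2 = i then (1 : ℝ) else 0 := by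
    funext p
    by_cases hp : p.1 ∈ Icc a b
    · have : max p.1 0 = p.1 := max_eq_left (ha.trans hp.1)
      simp [hp, this]
    · simp [hp]
  rw [h2]
  exact Finset.measurable_sum _ fun i _ =>
    ((h1 i).comp measurable_fst).mul (hζ.measurable_indicator_eq i)

lemma IsChain.intervalIntegrable (hζ : IsChain A μ P ζ) {a b : ℝ} (ha : 0 ≤ a) (hab : a ≤ b)
    {G : ℝ → S → ℝ} (hG : ∀ i, ContinuousOn (fun r => G r i) (Icc a b)) (x : Ω) :
    IntervalIntegrable (fun r => G r (ζ r x)) volume a b := by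
  obtain ⟨C, -, hC⟩ := exists_abs_le_of_continuousOn hG
  rw [intervalIntegrable_iff_integrableOn_Icc_of_le hab]
  have hm := (hζ.measurable_uncurry ha hG).comp (measurable_prodMk_right (y := x))
  have h1 : IntegrableOn ((Icc a b).indicator fun r => G r (ζ r x)) (Icc a b) := by
    refine Measure.integrableOn_of_bounded (M := C) (by simp) hm.aestronglyMeasurable ?_
    filter_upwards [ae_restrict_mem measurableSet_Icc] with r hr
    rw [indicator_of_mem hr]
    exact hC r hr _
  exact h1.congr_fun (fun r hr => indicator_of_mem hr _) measurableSet_Icc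

lemma IsChain.measurable_integral (hζ : IsChain A μ P ζ) {a b : ℝ} (ha : 0 ≤ a) (hab : a ≤ b)
    {G : ℝ → S → ℝ} (hG : ∀ i, ContinuousOn (fun r => G r i) (Icc a b)) :
    Measurable fun x => ∫ r in a..b, G r (ζ r x) := by
  have h : (fun x => ∫ r in a..b, G r (ζ r x)) =
      fun x => ∫ r in Ioc a b, (Icc a b).indicator (fun r => G r (ζ r x)) r := by
    funext x
    rw [intervalIntegral.integral_of_le hab]
    refine setIntegral_congr_fun measurableSet_Ioc fun r hr => ?_
    simp only [indicator_of_mem (Ioc_subset_Icc_self hr)]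
  rw [h]
  exact ((hζ.measurable_uncurry ha hG).stronglyMeasurable.integral_prod_left'
    (μ := volume.restrict (Ioc a b))).measurable

lemma IsChain.integral_integral [IsFiniteMeasure P] (hζ : IsChain A μ P ζ) {a b : ℝ} (ha : 0 ≤ a)
    (hab : a ≤ b) {G : ℝ → S → ℝ} (hG : ∀ i, ContinuousOn (fun r => G r i) (Icc a b)) :
    ∫ x, (∫ r in a..b, G r (ζ r x)) ∂P = ∫ r in a..b, (∫ x, G r (ζ r x) ∂P) := by
  obtain ⟨C, -, hC⟩ := exists_abs_le_of_continuousOn hG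
  set g : ℝ × Ω → ℝ := fun p => (Icc a b).indicator (fun r => G r (ζ r p.2)) p.1
  have hg : Measurable g := hζ.measurable_uncurry ha hG
  have h1 : ∀ x, ∫ r in a..b, G r (ζ r x) = ∫ r in Ioc a b, g (r, x) := by
    intro x
    rw [intervalIntegral.integral_of_le hab]
    refine setIntegral_congr_fun measurableSet_Ioc fun r hr => ?_
    simp only [g, indicator_of_mem (Ioc_subset_Icc_self hr)]
  have h2 : ∫ r in a..b, (∫ x, G r (ζ r x) ∂P) = ∫ r in Ioc a b, ∫ x, g (r, x) ∂P := by
    rw [intervalIntegral.integral_of_le hab]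
    refine setIntegral_congr_fun measurableSet_Ioc fun r hr => ?_
    simp only [g, indicator_of_mem (Ioc_subset_Icc_self hr)]
  simp only [h1, h2]
  refine (integral_integral_swap (f := fun r x => g (r, x)) ?_).symm
  refine Integrable.of_bound hg.aestronglyMeasurable (max C 0) (Eventually.of_forall fun p => ?_)
  simp only [g, Function.uncurry]
  by_cases hp : p.1 ∈ Icc a b
  · rw [indicator_of_mem hp]; exact (hC _ hp _).trans (le_max_left _ _)
  · rw [indicator_of_notMem hp]; simp

omit [MeasurableSingletonClass S] in
lemma IsChain.tendsto_riemannSum (hζ : IsChain A μ P ζ) {a b : ℝ} (ha : 0 ≤ a)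
    (hab : a < b) {G : ℝ → S → ℝ} (hG : ∀ i, ContinuousOn (fun r => G r i) (Icc a b)) (x : Ω) :
    Tendsto (fun N : ℕ => (b - a) / N * ∑ k ∈ Finset.range N,
        G (a + (k + 1 : ℕ) * ((b - a) / N)) (ζ (a + (k + 1 : ℕ) * ((b - a) / N)) x))
      atTop (𝓝 (∫ r in a..b, G r (ζ r x))) := by
  obtain ⟨C, -, hC⟩ := exists_abs_le_of_continuousOn hG
  refine tendsto_riemannSum_of_rightContinuous (f := fun r => G r (ζ r x)) hab (fun r hr => ?_)
    (fun r hr => hC r hr _)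
  have h1 : ContinuousWithinAt (fun q => G q (ζ r x)) (Icc r b) r :=
    ((hG _).mono (Icc_subset_Icc_left hr.1)) r ⟨le_rfl, hr.2⟩
  refine h1.congr_of_eventuallyEq ?_ rfl
  have h2 := hζ.right_continuous x r (ha.trans hr.1)
  have h3 : 𝓝[Icc r b] r ≤ 𝓝[≥] r := nhdsWithin_mono _ Icc_subset_Ici_self
  filter_upwards [h3 h2] with q hq
  show G q (ζ q x) = _
  rw [hq]

/-- The Feynman-Kac bound, with the initial law at time `a` changed to `m a`. -/
lemma IsChain.integral_feynmanKac_le [IsFiniteMeasure P] (hζ : IsChain A μ P ζ)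
    (hA : IsRateMatrix A)
    {m m' G : ℝ → S → ℝ} {a b Λ : ℝ} (ha : 0 ≤ a) (hab : a < b) (hΛ : 0 ≤ Λ)
    (hm_pos : ∀ r ∈ Icc a b, ∀ i, 0 < m r i)
    (hm_one : ∀ r ∈ Icc a b, ∑ i, m r i = 1)
    (hm_cont : ∀ i, ContinuousOn (fun r => m r i) (Icc a b))
    (hm'_cont : ∀ i, ContinuousOn (fun r => m' r i) (Icc a b))
    (hG_cont : ∀ i, ContinuousOn (fun r => G r i) (Icc a b))
    (hm_deriv : ∀ r ∈ Ioo a b, ∀ i, HasDerivAt (fun r => m r i) (m' r i) r)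
    (hspec : ∀ r ∈ Icc a b, ∀ v : S → ℝ,
      2 * ∑ i, m r i * v i * ∑ j, A i j * v j + 2 * ∑ i, m r i * G r i * v i ^ 2
        - ∑ i, m' r i * v i ^ 2 ≤ 2 * Λ * ∑ i, m r i * v i ^ 2) :
    ∫ x, m a (ζ a x) / lawAt A (fun i => μ.real {i}) a (ζ a x) *
        Real.exp (∫ r in a..b, G r (ζ r x)) ∂P ≤ Real.exp (Λ * (b - a)) := by
  obtain ⟨C, hC0, hC⟩ := exists_abs_le_of_continuousOn hG_cont
  set p := lawAt A (fun i => μ.real {i}) a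
  set R : ℕ → Ω → ℝ := fun N x => (b - a) / N * ∑ k ∈ Finset.range N,
        G (a + (k + 1 : ℕ) * ((b - a) / N)) (ζ (a + (k + 1 : ℕ) * ((b - a) / N)) x)
  have hba : 0 < b - a := sub_pos.2 hab
  have hRmeas : ∀ N, Measurable (R N) := by
    intro N
    refine measurable_const.mul (Finset.measurable_sum _ fun k _ => ?_)
    exact (measurable_of_countable (G (a + (k + 1 : ℕ) * ((b - a) / N)))).comp
      (hζ.measurable _ (by positivity))
  have hmp : Measurable fun x => m a (ζ a x) / p (ζ a x) :=
    (measurable_of_countable fun i => m a i / p i).comp (hζ.measurable a ha)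
  set D := ∑ i, |m a i / p i|
  have hD : ∀ i, |m a i / p i| ≤ D := fun i =>
    Finset.single_le_sum (f := fun i => |m a i / p i|) (fun _ _ => abs_nonneg _) (Finset.mem_univ i)
  have hRbdd : ∀ N : ℕ, 1 ≤ N → ∀ x, R N x ≤ C * (b - a) := by
    intro N hN x
    have hNpos : (0 : ℝ) < N := by exact_mod_cast hN
    have h1 : ∑ k ∈ Finset.range N, G (a + (k + 1 : ℕ) * ((b - a) / N))
        (ζ (a + (k + 1 : ℕ) * ((b - a) / N)) x) ≤ N * C := by
      refine (Finset.sum_le_card_nsmul _ _ C fun k hk => ?_).trans (by simp)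
      refine (le_abs_self _).trans (hC _ ⟨?_, ?_⟩ _)
      · have : (0 : ℝ) ≤ (k + 1 : ℕ) * ((b - a) / N) := by positivity
        linarith
      · have hk' : ((k + 1 : ℕ) : ℝ) ≤ N := by exact_mod_cast Finset.mem_range.1 hk
        have h2 := mul_le_mul_of_nonneg_right hk' (by positivity : 0 ≤ (b - a) / N)
        have h3 : (N : ℝ) * ((b - a) / N) = b - a := by field_simp
        linarith
    calc R N x ≤ (b - a) / N * (N * C) := by
          simp only [R]
          exact mul_le_mul_of_nonneg_left h1 (by positivity)
      _ = C * (b - a) := by field_simp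
  have hlim : Tendsto (fun N : ℕ => ∫ x, m a (ζ a x) / p (ζ a x) * Real.exp (R N x) ∂P) atTop
      (𝓝 (∫ x, m a (ζ a x) / p (ζ a x) * Real.exp (∫ r in a..b, G r (ζ r x)) ∂P)) := by
    refine tendsto_integral_filter_of_dominated_convergence
      (fun _ => D * Real.exp (C * (b - a))) ?_ ?_ (integrable_const _) ?_
    · exact Eventually.of_forall fun N => (hmp.mul (hRmeas N).exp).aestronglyMeasurable
    · filter_upwards [eventually_ge_atTop 1] with N hN
      refine Eventually.of_forall fun x => ?_
      rw [Real.norm_eq_abs, abs_mul, Real.abs_exp]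
      exact mul_le_mul (hD _) (Real.exp_le_exp.2 (hRbdd N hN x)) (Real.exp_pos _).le
        (Finset.sum_nonneg fun _ _ => abs_nonneg _)
    · refine Eventually.of_forall fun x => ?_
      have := hζ.tendsto_riemannSum ha hab hG_cont x
      exact ((Real.continuous_exp.tendsto _).comp this).const_mul _
  have hδ : ∀ δ > 0, ∫ x, m a (ζ a x) / p (ζ a x) * Real.exp (∫ r in a..b, G r (ζ r x)) ∂P ≤
      Real.exp ((Λ + δ) * (b - a)) := fun δ hδ =>
    le_of_tendsto hlim (hζ.integral_feynmanKac_partition_le hA ha hab.le hΛ hδ hm_pos hm_one hm_cont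
      hm'_cont hG_cont hm_deriv hspec)
  have hlim2 : Tendsto (fun δ : ℝ => Real.exp ((Λ + δ) * (b - a))) (𝓝[>] 0)
      (𝓝 (Real.exp (Λ * (b - a)))) := by
    have hc : Continuous fun δ : ℝ => Real.exp ((Λ + δ) * (b - a)) := by fun_prop
    have := (hc.tendsto 0).mono_left (nhdsWithin_le_nhds (s := Ioi 0))
    simpa using this
  exact ge_of_tendsto hlim2 (by filter_upwards [self_mem_nhdsWithin] with δ h using hδ δ h)

/-- Second moment bound for additive functionals of a chain which is close, in the sense of
relative entropy, to the time-dependent weights `m`. -/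
theorem IsChain.integral_sq_le [IsProbabilityMeasure μ] [IsProbabilityMeasure P]
    (hζ : IsChain A μ P ζ) (hA : IsRateMatrix A)
    {m m' I U : ℝ → S → ℝ} {T c B K Λ : ℝ} (hc : 0 < c) (hB : 0 ≤ B) (hK0 : 0 ≤ K) (hΛ : 0 < Λ)
    (hm_pos : ∀ r ∈ Icc 0 T, ∀ i, 0 < m r i)
    (hm_one : ∀ r ∈ Icc 0 T, ∑ i, m r i = 1)
    (hm_cont : ∀ i, ContinuousOn (fun r => m r i) (Icc 0 T))
    (hm'_cont : ∀ i, ContinuousOn (fun r => m' r i) (Icc 0 T))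
    (hI_cont : ∀ i, ContinuousOn (fun r => I r i) (Icc 0 T))
    (hU_cont : ∀ i, ContinuousOn (fun r => U r i) (Icc 0 T))
    (hm_deriv : ∀ r ∈ Ioo 0 T, ∀ i, HasDerivAt (fun r => m r i) (m' r i) r)
    (hspec : ∀ r ∈ Icc 0 T, ∀ (γ : ℝ) (v : S → ℝ),
      2 * ∑ i, m r i * v i * ∑ j, A i j * v j + 2 * γ * ∑ i, m r i * I r i * v i ^ 2
        - ∑ i, m' r i * v i ^ 2 ≤
        ∑ i, m r i * U r i * v i ^ 2 + 2 * Λ * γ ^ 2 * ∑ i, m r i * v i ^ 2)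
    (hexp : ∀ r ∈ Icc 0 T, ∑ i, m r i * Real.exp (c * U r i) ≤ Real.exp B)
    (hK : relEntropy (fun i => μ.real {i}) (m 0) ≤ K)
    {a b : ℝ} (ha : 0 ≤ a) (hab : a < b) (hb : b ≤ T) :
    ∫ x, (∫ r in a..b, I r (ζ r x)) ^ 2 ∂P ≤
      8 * Λ * (b - a) * (1 + (1 + T / c) * (Real.exp (T / c) * (K + B) + B)) := by
  have hsub : Icc a b ⊆ Icc 0 T := Icc_subset_Icc ha hb
  have hT : 0 ≤ T := ha.trans (hab.le.trans hb)
  have haT : a ∈ Icc 0 T := hsub (left_mem_Icc.2 hab.le)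
  have hba : 0 < b - a := sub_pos.2 hab
  set μ' : S → ℝ := fun i => μ.real {i}
  have hμ1 : ∑ i, μ' i = 1 := by
    simp [μ']
  set p : ℝ → S → ℝ := lawAt A μ'
  have hp0 : ∀ r, 0 ≤ r → ∀ i, 0 ≤ p r i := fun r hr i =>
    lawAt_nonneg hA (fun _ => measureReal_nonneg) hr i
  set H := Real.exp (T / c) * (K + B)
  have hH0 : 0 ≤ H := by positivity
  -- At γ = 0, `hspec` is exactly the bound on the entropy production.
  have hent : ∀ r ∈ Icc 0 T, relEntropy (p r) (m r) ≤ H := by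
    intro r hr
    have h1 := relEntropy_lawAt_le hA hc hm_pos (hm_one 0 ⟨le_rfl, hT⟩) hm_cont hm_deriv
      (fun r hr v => by simpa using hspec r hr 0 v) hexp (fun _ => measureReal_nonneg) hμ1 hK hr
    have h2 : Real.exp (r / c) ≤ Real.exp (T / c) :=
      Real.exp_le_exp.2 (div_le_div_of_nonneg_right hr.2 hc.le)
    have h3 := mul_le_mul_of_nonneg_right h2 (add_nonneg hK0 hB)
    linarith
  have hEU : ∀ r ∈ Icc 0 T, ∫ x, U r (ζ r x) ∂P ≤ (H + B) / c := by
    intro r hr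
    rw [hζ.integral_comp hA hr.1, le_div_iff₀ hc]
    have h1 := sum_mul_le_relEntropy_add (hp0 r hr.1) (by rw [sum_lawAt hA, hμ1]) (hm_pos r hr)
      (fun i => c * U r i) (hexp r hr)
    have h2 : (∑ j, lawAt A (fun i => μ.real {i}) r j * U r j) * c =
        ∑ i, p r i * (c * U r i) := by
      rw [Finset.sum_mul]
      exact Finset.sum_congr rfl fun i _ => by simp only [p, μ']; ring
    rw [h2]
    linarith [hent r hr]
  set Y : Ω → ℝ := fun x => ∫ r in a..b, I r (ζ r x)
  set w : Ω → ℝ := fun x => ∫ r in a..b, U r (ζ r x) / 2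
  have hIc : ∀ i, ContinuousOn (fun r => I r i) (Icc a b) := fun i => (hI_cont i).mono hsub
  have hUc : ∀ i, ContinuousOn (fun r => U r i / 2) (Icc a b) := fun i =>
    ((hU_cont i).mono hsub).div_const 2
  have hYm : Measurable Y := hζ.measurable_integral ha hab.le hIc
  have hwm : Measurable w := hζ.measurable_integral (G := fun r i => U r i / 2) ha hab.le hUc
  obtain ⟨C1, hC10, hC1⟩ := exists_abs_le_of_continuousOn hIc
  obtain ⟨C2, hC20, hC2⟩ := exists_abs_le_of_continuousOn (f := fun r i => U r i / 2) hUc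
  have hYb : ∀ x, |Y x| ≤ C1 * (b - a) := abs_integral_path_le hab.le hC1
  have hwb : ∀ x, |w x| ≤ C2 * (b - a) :=
    abs_integral_path_le (G := fun r i => U r i / 2) hab.le hC2
  have hYint : Integrable (fun x => Y x ^ 2) P := by
    refine Integrable.of_bound (hYm.pow_const 2).aestronglyMeasurable ((C1 * (b - a)) ^ 2)
      (Eventually.of_forall fun x => ?_)
    rw [Real.norm_eq_abs, abs_pow]
    exact pow_le_pow_left₀ (abs_nonneg _) (hYb x) 2
  have hwint : Integrable w P :=
    Integrable.of_bound hwm.aestronglyMeasurable _ (Eventually.of_forall hwb)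
  have hEw : ∫ x, w x ∂P ≤ (H + B) / c * T := by
    have h1 : ∫ x, w x ∂P = ∫ r in a..b, (∫ x, U r (ζ r x) / 2 ∂P) :=
      hζ.integral_integral (G := fun r i => U r i / 2) ha hab.le hUc
    have h3 : 0 ≤ (H + B) / c := by positivity
    have h4 : ∫ r in a..b, (∫ x, U r (ζ r x) / 2 ∂P) ≤ ∫ _ in a..b, (H + B) / c := by
      refine intervalIntegral.integral_mono_on hab.le ?_ intervalIntegrable_const fun r hr => ?_
      · have hcts : ContinuousOn (fun r => ∑ j, lawAt A μ' r j * (U r j / 2)) (Icc a b) := by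
          refine continuousOn_finsetSum _ fun j _ => ContinuousOn.mul ?_ (hUc j)
          exact fun r _ => (hasDerivAt_lawAt A μ' r j).continuousAt.continuousWithinAt
        refine ContinuousOn.intervalIntegrable ?_
        rw [uIcc_of_le hab.le]
        refine hcts.congr fun r hr => ?_
        exact hζ.integral_comp hA (ha.trans hr.1) (fun j => U r j / 2)
      · rw [integral_div]
        have := hEU r (hsub hr)
        linarith
    rw [h1]
    refine h4.trans ?_
    rw [intervalIntegral.integral_const, smul_eq_mul, mul_comm]
    exact mul_le_mul_of_nonneg_left (by linarith) h3
  set σ := Λ * (b - a)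
  have hσ : 0 < σ := mul_pos hΛ hba
  -- The density of m a against the true law at time a, times exp (−½ ∫ U), which compensates the
  -- term U in `hspec`.
  set k : Ω → ℝ := fun x => m a (ζ a x) / p a (ζ a x) * Real.exp (-w x)
  have hmp : Measurable fun x => m a (ζ a x) / p a (ζ a x) :=
    (measurable_of_countable fun i => m a i / p a i).comp (hζ.measurable a ha)
  have hk : Measurable k := hmp.mul hwm.neg.exp
  have hk0 : ∀ x, 0 ≤ k x := fun x =>
    mul_nonneg (div_nonneg (hm_pos a haT _).le (hp0 a ha _)) (Real.exp_pos _).le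
  set D := ∑ i, |m a i / p a i|
  have hD : ∀ i, |m a i / p a i| ≤ D := fun i =>
    Finset.single_le_sum (f := fun i => |m a i / p a i|) (fun _ _ => abs_nonneg _)
      (Finset.mem_univ i)
  have hkb : ∀ x, |k x| ≤ D * Real.exp (C2 * (b - a)) := by
    intro x
    simp only [k, abs_mul, Real.abs_exp]
    refine mul_le_mul (hD _) (Real.exp_le_exp.2 ?_) (Real.exp_pos _).le
      (Finset.sum_nonneg fun _ _ => abs_nonneg _)
    have := (abs_le.1 (hwb x)).1
    linarith
  have hkint : ∀ g : Ω → ℝ, Measurable g → ∀ C, (∀ x, g x ≤ C) →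
      Integrable (fun x => k x * Real.exp (g x)) P := by
    intro g hg C hgC
    refine Integrable.of_bound (hk.mul hg.exp).aestronglyMeasurable
      (D * Real.exp (C2 * (b - a)) * Real.exp C) (Eventually.of_forall fun x => ?_)
    rw [Real.norm_eq_abs, abs_mul, Real.abs_exp]
    exact mul_le_mul (hkb x) (Real.exp_le_exp.2 (hgC x)) (Real.exp_pos _).le
      ((abs_nonneg _).trans (hkb x))
  have hFK : ∀ γ : ℝ, ∫ x, k x * Real.exp (γ * Y x) ∂P ≤ Real.exp (σ * γ ^ 2) := by
    intro γ
    have h1 := hζ.integral_feynmanKac_le hA (m := m) (m' := m') (G := fun r i => γ * I r i - U r i / 2)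
      (Λ := Λ * γ ^ 2) ha hab (by positivity) (fun r hr => hm_pos r (hsub hr))
      (fun r hr => hm_one r (hsub hr)) (fun i => (hm_cont i).mono hsub)
      (fun i => (hm'_cont i).mono hsub) (fun i => (continuousOn_const.mul (hIc i)).sub (hUc i))
      (fun r hr => hm_deriv r ⟨ha.trans_lt hr.1, hr.2.trans_le hb⟩)
      (fun r hr v => by
        have := hspec r (hsub hr) γ v
        have e : 2 * ∑ i, m r i * (γ * I r i - U r i / 2) * v i ^ 2 =
            2 * γ * ∑ i, m r i * I r i * v i ^ 2 - ∑ i, m r i * U r i * v i ^ 2 := by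
          simp only [Finset.mul_sum, ← Finset.sum_sub_distrib]
          exact Finset.sum_congr rfl fun i _ => by ring
        rw [e]
        linarith)
    have h2 : ∀ x, k x * Real.exp (γ * Y x) = m a (ζ a x) / lawAt A (fun i => μ.real {i}) a (ζ a x) *
        Real.exp (∫ r in a..b, γ * I r (ζ r x) - U r (ζ r x) / 2) := by
      intro x
      have h3 : ∫ r in a..b, γ * I r (ζ r x) - U r (ζ r x) / 2 = γ * Y x - w x := by
        rw [intervalIntegral.integral_sub, intervalIntegral.integral_const_mul]
        · exact (hζ.intervalIntegrable ha hab.le hIc x).const_mul γ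
        · exact hζ.intervalIntegrable (G := fun r i => U r i / 2) ha hab.le hUc x
      rw [h3, sub_eq_neg_add, Real.exp_add]
      simp only [k, p, μ']
      ring
    simp only [h2]
    refine h1.trans (le_of_eq ?_)
    simp only [σ]; congr 1; ring
  have hsq : ∫ x, k x * Real.exp (Y x ^ 2 / (8 * σ)) ∂P ≤ 2 := by
    have h1 := lintegral_exp_sq_le (P := P) hk hk0 hYm hσ (fun γ => by
      rw [← ofReal_integral_eq_lintegral_ofReal
        (hkint _ (hYm.const_mul γ) (|γ| * (C1 * (b - a))) fun x => (le_abs_self _).trans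
          (by rw [abs_mul]; exact mul_le_mul_of_nonneg_left (hYb x) (abs_nonneg _)))
        (Eventually.of_forall fun x => mul_nonneg (hk0 x) (Real.exp_pos _).le)]
      exact ENNReal.ofReal_le_ofReal (hFK γ))
    rw [← ofReal_integral_eq_lintegral_ofReal
      (hkint _ ((hYm.pow_const 2).div_const _) ((C1 * (b - a)) ^ 2 / (8 * σ)) fun x =>
        div_le_div_of_nonneg_right (by
          rw [← sq_abs]; exact pow_le_pow_left₀ (abs_nonneg _) (hYb x) 2) (by positivity))
      (Eventually.of_forall fun x => mul_nonneg (hk0 x) (Real.exp_pos _).le)] at h1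
    exact (ENNReal.ofReal_le_ofReal_iff (by norm_num)).1 h1
  have hkint' : Integrable (fun x => k x * Real.exp (Y x ^ 2 / (8 * σ))) P :=
    hkint _ ((hYm.pow_const 2).div_const _) ((C1 * (b - a)) ^ 2 / (8 * σ)) fun x =>
        div_le_div_of_nonneg_right (by
          rw [← sq_abs]; exact pow_le_pow_left₀ (abs_nonneg _) (hYb x) 2) (by positivity)
  -- The chain almost surely avoids the states with p = 0, so that m / p may be written as the
  -- exponential of a difference of logarithms.
  have hae : ∀ᵐ x ∂P, p a (ζ a x) ≠ 0 := by
    rw [ae_iff]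
    have : {x | ¬ p a (ζ a x) ≠ 0} = ⋃ i ∈ {i | p a i = 0}, {x | ζ a x = i} := by
      ext x; simp
    rw [this]
    refine (measure_biUnion_null_iff (Set.to_countable _)).2 fun i hi => ?_
    have h1 := hζ.measureReal_eq hA ha i
    rw [measureReal_def] at h1
    have h2 : lawAt A (fun i => μ.real {i}) a i = 0 := hi
    rw [h2, ENNReal.toReal_eq_zero_iff] at h1
    exact h1.resolve_right (measure_ne_top _ _)
  set l : S → ℝ := fun i => Real.log (m a i) - Real.log (p a i)
  have hlint : Integrable (fun x => l (ζ a x)) P := by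
    refine Integrable.of_bound ((measurable_of_countable l).comp
      (hζ.measurable a ha)).aestronglyMeasurable (∑ i, |l i|) (Eventually.of_forall fun x => ?_)
    exact Finset.single_le_sum (f := fun i => |l i|) (fun _ _ => abs_nonneg _) (Finset.mem_univ _)
  have hl : ∫ x, l (ζ a x) ∂P = - relEntropy (p a) (m a) := by
    rw [hζ.integral_comp hA ha, relEntropy, ← Finset.sum_neg_distrib]
    exact Finset.sum_congr rfl fun i _ => by simp only [l, p, μ']; ring
  -- The entropy inequality on path space, in the form x ≤ exp x − 1 with x = log (m / p) + Y² /
  -- (8σ) − w. In expectation the first term is minus the relative entropy, and the exponential is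
  -- at most 2 by `hsq`.
  have hpt : ∀ᵐ x ∂P, l (ζ a x) + Y x ^ 2 / (8 * σ) - w x ≤
      k x * Real.exp (Y x ^ 2 / (8 * σ)) - 1 := by
    filter_upwards [hae] with x hx
    have hppos : 0 < p a (ζ a x) := lt_of_le_of_ne (hp0 a ha _) (Ne.symm hx)
    have h1 := Real.add_one_le_exp (l (ζ a x) + Y x ^ 2 / (8 * σ) - w x)
    have h2 : Real.exp (l (ζ a x) + Y x ^ 2 / (8 * σ) - w x) =
        k x * Real.exp (Y x ^ 2 / (8 * σ)) := by
      simp only [l, k]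
      rw [sub_eq_add_neg, Real.exp_add, Real.exp_add, Real.exp_sub, Real.exp_log (hm_pos a haT _),
        Real.exp_log hppos]
      ring
    linarith
  have hfin := integral_mono_ae ((hlint.add (hYint.div_const _)).sub hwint)
    (hkint'.sub (integrable_const 1)) hpt
  have e1 : ∫ x, (l (ζ a x) + Y x ^ 2 / (8 * σ) - w x) ∂P =
      - relEntropy (p a) (m a) + (∫ x, Y x ^ 2 ∂P) / (8 * σ) - ∫ x, w x ∂P := by
    have h : Integrable (fun x => l (ζ a x) + Y x ^ 2 / (8 * σ)) P := hlint.add (hYint.div_const _)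
    rw [integral_sub h hwint,
      integral_add hlint (hYint.div_const _), hl, integral_div]
  have e2 : ∫ x, (k x * Real.exp (Y x ^ 2 / (8 * σ)) - 1) ∂P =
      ∫ x, k x * Real.exp (Y x ^ 2 / (8 * σ)) ∂P - 1 := by
    rw [integral_sub hkint' (integrable_const 1)]; simp
  have hfin' : - relEntropy (p a) (m a) + (∫ x, Y x ^ 2 ∂P) / (8 * σ) - ∫ x, w x ∂P ≤
      ∫ x, k x * Real.exp (Y x ^ 2 / (8 * σ)) ∂P - 1 := by
    rw [← e1, ← e2]; exact hfin
  have h9 : (∫ x, Y x ^ 2 ∂P) / (8 * σ) ≤ 1 + (1 + T / c) * (H + B) := by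
    have h10 := hent a haT
    have h11 : (H + B) / c * T = T / c * (H + B) := by ring
    linarith
  rw [div_le_iff₀ (by positivity)] at h9
  calc ∫ x, Y x ^ 2 ∂P ≤ _ := h9
    _ = _ := by simp only [σ]; ring

end Path

/-! ### Sub-Gaussian bounds under Bernoulli product measures. -/

section Bernoulli

variable {ι : Type*} [Fintype ι]

/-- The weight of a configuration under the Bernoulli product measure of parameters `α`. -/
def bernWeight (α : ι → ℝ) (η : ι → Bool) : ℝ := ∏ x, if η x then α x else 1 - α x

/-- The normalized variable `(η x - α x) / (α x * (1 - α x))`. -/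
def charge (α : ι → ℝ) (η : ι → Bool) (x : ι) : ℝ := if η x then 1 / α x else -(1 / (1 - α x))

lemma bernWeight_pos {α : ι → ℝ} (h0 : ∀ x, 0 < α x) (h1 : ∀ x, α x < 1) (η : ι → Bool) :
    0 < bernWeight α η := by
  refine Finset.prod_pos fun x _ => ?_
  split_ifs
  · exact h0 x
  · exact sub_pos.2 (h1 x)

omit [Fintype ι] in
lemma abs_charge_le {α : ι → ℝ} {e : ℝ} (he : 0 < e) (hα : ∀ x, α x ∈ Icc e (1 - e))
    (η : ι → Bool) (x : ι) : |charge α η x| ≤ 1 / e := by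
  have h1 := (hα x).1
  have h2 := (hα x).2
  unfold charge
  split_ifs
  · rw [abs_of_pos (by have := he.trans_le h1; positivity)]
    exact one_div_le_one_div_of_le he h1
  · rw [abs_neg, abs_of_pos (by have : 0 < 1 - α x := by linarith
                                positivity)]
    exact one_div_le_one_div_of_le he (by linarith)

/-- The linear term averages to zero for a centred variable, which leaves the Gaussian bound exp
(x²). A charge is centred and bounded by 1 / e, and nothing more is used about it. -/
lemma exp_le_add_exp_sq (x : ℝ) : Real.exp x ≤ x + Real.exp (x ^ 2) := by
  have h1 := Real.add_one_le_exp (x ^ 2)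
  rcases le_or_gt |x| 1 with h | h
  · have := (abs_le.1 (Real.abs_exp_sub_one_sub_id_le h)).2
    linarith
  · rcases le_or_gt 0 x with hx | hx
    · rw [abs_of_nonneg hx] at h
      have : Real.exp x ≤ Real.exp (x ^ 2) := Real.exp_le_exp.2 (by nlinarith)
      linarith
    · rw [abs_of_neg hx] at h
      have : Real.exp x ≤ 1 := Real.exp_le_one_iff.2 hx.le
      nlinarith

lemma exp_charge_mean_le {a e : ℝ} (he : 0 < e) (ha : a ∈ Icc e (1 - e)) (θ : ℝ) :
    a * Real.exp (θ * (1 / a)) + (1 - a) * Real.exp (θ * -(1 / (1 - a))) ≤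
      Real.exp (θ ^ 2 / e ^ 2) := by
  have ha0 : 0 < a := he.trans_le ha.1
  have ha1 : 0 < 1 - a := by linarith [ha.2]
  have h1 := exp_le_add_exp_sq (θ * (1 / a))
  have h2 := exp_le_add_exp_sq (θ * -(1 / (1 - a)))
  have b1 : (θ * (1 / a)) ^ 2 ≤ θ ^ 2 / e ^ 2 := by
    rw [mul_pow, div_eq_mul_one_div (θ ^ 2), one_div_pow]
    gcongr
    exact ha.1
  have b2 : (θ * -(1 / (1 - a))) ^ 2 ≤ θ ^ 2 / e ^ 2 := by
    rw [mul_pow, neg_sq, div_eq_mul_one_div (θ ^ 2), one_div_pow]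
    gcongr
    linarith [ha.2]
  have c1 := mul_le_mul_of_nonneg_left (h1.trans (add_le_add_right (Real.exp_le_exp.2 b1) _)) ha0.le
  have c2 := mul_le_mul_of_nonneg_left (h2.trans (add_le_add_right (Real.exp_le_exp.2 b2) _)) ha1.le
  have d1 : a * (θ * (1 / a)) = θ := by field_simp
  have d2 : (1 - a) * (θ * -(1 / (1 - a))) = -θ := by field_simp
  rw [mul_add] at c1 c2
  rw [d1] at c1
  rw [d2] at c2
  linarith

variable [DecidableEq ι]

lemma sum_bernWeight (α : ι → ℝ) : ∑ η, bernWeight α η = 1 := by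
  have h := Finset.prod_univ_sum (fun _ : ι => (Finset.univ : Finset Bool))
    (fun x b => if b then α x else 1 - α x)
  rw [Fintype.piFinset_univ] at h
  unfold bernWeight
  rw [← h]
  simp

/-- Flipping the occupation of x is an involution; adding to each term that of the flipped
configuration counts every configuration twice. -/
lemma two_mul_sum_eq_sum_update (k : (ι → Bool) → ℝ) (x : ι) :
    2 * ∑ η, k η = ∑ η, (k (Function.update η x true) + k (Function.update η x false)) := by
  have hinv : Function.Involutive fun η : ι → Bool => Function.update η x (!η x) := by
    intro η
    funext y
    rcases eq_or_ne y x with rfl | hy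
    · simp
    · simp [hy]
  have h := Equiv.sum_comp (hinv.toPerm _) k
  rw [two_mul]
  nth_rewrite 2 [← h]
  rw [← Finset.sum_add_distrib]
  refine Finset.sum_congr rfl fun η _ => ?_
  simp only [Function.Involutive.coe_toPerm]
  rcases hb : η x with _ | _
  · rw [add_comm]; congr 2; rw [← hb]; simp
  · congr 2; rw [← hb]; simp

lemma bernWeight_update (α : ι → ℝ) (η : ι → Bool) (x : ι) (b : Bool) :
    bernWeight α (Function.update η x b) = (if b then α x else 1 - α x) *
      ∏ y ∈ Finset.univ.erase x, if η y then α y else 1 - α y := by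
  unfold bernWeight
  rw [← Finset.mul_prod_erase _ _ (Finset.mem_univ x)]
  congr 1
  · simp
  · refine Finset.prod_congr rfl fun y hy => ?_
    rw [Function.update_of_ne (Finset.ne_of_mem_erase hy)]

/-- Integrating out the occupation of the site `x`. -/
lemma sum_bernWeight_mul (α : ι → ℝ) (f : (ι → Bool) → ℝ) (x : ι) :
    ∑ η, bernWeight α η * f η = ∑ η, bernWeight α η *
      (α x * f (Function.update η x true) + (1 - α x) * f (Function.update η x false)) := by
  have h1 := two_mul_sum_eq_sum_update (fun η => bernWeight α η * f η) x
  have h2 := two_mul_sum_eq_sum_update (fun η => bernWeight α η *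
    (α x * f (Function.update η x true) + (1 - α x) * f (Function.update η x false))) x
  have : ∀ η, bernWeight α (Function.update η x true) * f (Function.update η x true) +
      bernWeight α (Function.update η x false) * f (Function.update η x false) =
      bernWeight α (Function.update η x true) * (α x * f (Function.update
        (Function.update η x true) x true) + (1 - α x) * f (Function.update
        (Function.update η x true) x false)) +
      bernWeight α (Function.update η x false) * (α x * f (Function.update
        (Function.update η x false) x true) + (1 - α x) * f (Function.update
        (Function.update η x false) x false)) := by
    intro η
    simp only [bernWeight_update, Function.update_idem, if_true, Bool.false_eq_true, if_false]
    ring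
  simp only [this] at h1
  linarith

/-- Exponential supermartingale bound: `H x` depends only on the sites of rank less than `r x`. -/
lemma sum_exp_martingale_le {α : ι → ℝ} {e : ℝ} (he : 0 < e) (hα : ∀ x, α x ∈ Icc e (1 - e))
    (r : ι → ℤ) (hr : Function.Injective r) (H : ι → (ι → Bool) → ℝ)
    (hH : ∀ x η η', (∀ z, r z < r x → η z = η' z) → H x η = H x η') (s : Finset ι) :
    ∑ η, bernWeight α η * Real.exp (∑ x ∈ s, (H x η * charge α η x - H x η ^ 2 / e ^ 2)) ≤ 1 := by
  induction s using Finset.induction_on_max_value r with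
  | empty => simp [sum_bernWeight]
  | insert m s hm hmax ih =>
    refine le_trans ?_ ih
    have hlt : ∀ x ∈ s, r x < r m := fun x hx => lt_of_le_of_ne (hmax x hx)
      fun h => hm (hr h ▸ hx)
    -- The site m has the highest rank, so in the exponent only its own charge depends on η m.
    -- Averaging it out costs at most exp (H² / e²), which the compensator cancels.
    rw [sum_bernWeight_mul α _ m]
    refine Finset.sum_le_sum fun η _ => ?_
    refine mul_le_mul_of_nonneg_left ?_ (bernWeight_pos (fun x => he.trans_le (hα x).1)
      (fun x => by linarith [(hα x).2]) η).le
    have hHm : ∀ b, H m (Function.update η m b) = H m η := fun b => hH m _ _ fun z hz => by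
      rw [Function.update_of_ne]; rintro rfl; exact lt_irrefl _ hz
    have hF : ∀ b, ∑ x ∈ s, (H x (Function.update η m b) * charge α (Function.update η m b) x -
        H x (Function.update η m b) ^ 2 / e ^ 2) =
        ∑ x ∈ s, (H x η * charge α η x - H x η ^ 2 / e ^ 2) := by
      intro b
      refine Finset.sum_congr rfl fun x hx => ?_
      have h1 : H x (Function.update η m b) = H x η := hH x _ _ fun z hz => by
        rw [Function.update_of_ne]; rintro rfl; exact lt_asymm hz (hlt x hx)
      have h2 : charge α (Function.update η m b) x = charge α η x := by
        unfold charge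
        rw [Function.update_of_ne]; rintro rfl; exact hm hx
      rw [h1, h2]
    simp only [Finset.sum_insert hm, hF, hHm]
    set F := ∑ x ∈ s, (H x η * charge α η x - H x η ^ 2 / e ^ 2)
    have hc1 : charge α (Function.update η m true) m = 1 / α m := by simp [charge]
    have hc2 : charge α (Function.update η m false) m = -(1 / (1 - α m)) := by simp [charge]
    rw [hc1, hc2]
    have hsplit : ∀ y, Real.exp (H m η * y - H m η ^ 2 / e ^ 2 + F) =
        Real.exp (H m η * y) * (Real.exp (-(H m η ^ 2 / e ^ 2)) * Real.exp F) := by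
      intro y; rw [← Real.exp_add, ← Real.exp_add]; congr 1; ring
    rw [hsplit, hsplit]
    have hmean := mul_le_mul_of_nonneg_right (exp_charge_mean_le he (hα m) (H m η))
      (mul_pos (Real.exp_pos (-(H m η ^ 2 / e ^ 2))) (Real.exp_pos F)).le
    refine le_trans (le_of_eq (by ring)) (hmean.trans (le_of_eq ?_))
    rw [← mul_assoc, ← Real.exp_add]
    simp

/-- Linear functionals of the charges are sub-Gaussian. -/
lemma sum_exp_linear_le {α : ι → ℝ} {e : ℝ} (he : 0 < e) (hα : ∀ x, α x ∈ Icc e (1 - e))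
    (a : ι → ℝ) (γ : ℝ) :
    ∑ η, bernWeight α η * Real.exp (γ * ∑ x, a x * charge α η x) ≤
      Real.exp ((∑ x, a x ^ 2) / e ^ 2 * γ ^ 2) := by
  have h := sum_exp_martingale_le he hα (fun x => (Fintype.equivFin ι x : ℕ))
    (fun x y hxy => (Fintype.equivFin ι).injective (Fin.ext (by simpa using hxy)))
    (fun x _ => γ * a x) (fun _ _ _ _ => rfl) Finset.univ
  have e1 : ∀ η : ι → Bool, Real.exp (∑ x, (γ * a x * charge α η x - (γ * a x) ^ 2 / e ^ 2)) =
      Real.exp (γ * ∑ x, a x * charge α η x) * Real.exp (-((∑ x, a x ^ 2) / e ^ 2 * γ ^ 2)) := by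
    intro η
    rw [← Real.exp_add, Finset.sum_sub_distrib, Finset.mul_sum, sub_eq_add_neg]
    congr 2
    · exact Finset.sum_congr rfl fun x _ => by ring
    · rw [Finset.sum_div, Finset.sum_mul]
      congr 1
      exact Finset.sum_congr rfl fun x _ => by ring
  simp only [e1, ← mul_assoc, ← Finset.sum_mul] at h
  rwa [Real.exp_neg, ← div_eq_mul_inv, div_le_one (Real.exp_pos _)] at h

/-- Integrating the sub-Gaussian bound over a Gaussian parameter. Dividing by the number of sites
makes the bound uniform in that number. -/
lemma sum_exp_linear_sq_le [Nonempty ι] {α : ι → ℝ} {e B : ℝ} (he : 0 < e)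
    (hα : ∀ x, α x ∈ Icc e (1 - e)) (hB : 0 < B) {a : ι → ℝ} (ha : ∀ x, |a x| ≤ B) :
    ∑ η, bernWeight α η * Real.exp (e ^ 2 / (8 * B ^ 2) *
      ((∑ x, a x * charge α η x) ^ 2 / Fintype.card ι)) ≤ 2 := by
  have hN : (0 : ℝ) < Fintype.card ι := by exact_mod_cast Fintype.card_pos
  have h := sum_exp_sq_le (k := bernWeight α) (Y := fun η => ∑ x, a x * charge α η x)
    (σ := Fintype.card ι * B ^ 2 / e ^ 2)
    (fun η => (bernWeight_pos (fun x => he.trans_le (hα x).1)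
      (fun x => by linarith [(hα x).2]) η).le) (by positivity) (fun γ => by
      refine (sum_exp_linear_le he hα a γ).trans (Real.exp_le_exp.2 ?_)
      refine mul_le_mul_of_nonneg_right (div_le_div_of_nonneg_right ?_ (by positivity))
        (sq_nonneg γ)
      refine (Finset.sum_le_card_nsmul _ _ (B ^ 2) fun x _ => ?_).trans (by simp)
      rw [← sq_abs]
      exact pow_le_pow_left₀ (abs_nonneg _) (ha x) 2)
  refine le_trans (le_of_eq ?_) h
  refine Finset.sum_congr rfl fun η _ => ?_
  congr 2
  field_simp

end Bernoulli

/-- Jensen's inequality for exponential moments of an average. -/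
lemma sum_exp_average_le {S κ : Type*} [Fintype S] [Fintype κ] [Nonempty κ] {w : S → ℝ}
    (hw : ∀ i, 0 ≤ w i) {D : ℝ} {f : κ → S → ℝ} (h : ∀ k, ∑ i, w i * Real.exp (f k i) ≤ D) :
    ∑ i, w i * Real.exp ((∑ k, f k i) / Fintype.card κ) ≤ D := by
  have hN : (0 : ℝ) < Fintype.card κ := by exact_mod_cast Fintype.card_pos
  have hJ : ∀ i, Real.exp ((∑ k, f k i) / Fintype.card κ) ≤
      (∑ k, Real.exp (f k i)) / Fintype.card κ := by
    intro i
    have := convexOn_exp.map_sum_le (t := (Finset.univ : Finset κ))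
      (w := fun _ => (Fintype.card κ : ℝ)⁻¹) (p := fun k => f k i)
      (fun _ _ => by positivity) (by simp) (fun _ _ => mem_univ _)
    simp only [smul_eq_mul, ← Finset.mul_sum] at this
    rwa [inv_mul_eq_div, inv_mul_eq_div] at this
  calc _ ≤ ∑ i, w i * ((∑ k, Real.exp (f k i)) / Fintype.card κ) :=
        Finset.sum_le_sum fun i _ => mul_le_mul_of_nonneg_left (hJ i) (hw i)
    _ = (∑ k, ∑ i, w i * Real.exp (f k i)) / Fintype.card κ := by
        rw [Finset.sum_comm, Finset.sum_div]
        refine Finset.sum_congr rfl fun i _ => ?_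
        rw [← Finset.mul_sum, mul_div_assoc]
    _ ≤ (∑ _ : κ, D) / Fintype.card κ :=
        div_le_div_of_nonneg_right (Finset.sum_le_sum fun k _ => h k) hN.le
    _ = D := by simp

/-! ### Bond gradients, adjoint of the generator, integration by parts. -/

section Bond

variable {n : ℕ} [NeZero n]

/-- The discrete gradient of the charges across the bond `{x, x + 1}`, corrected so that it is
antisymmetric under the exchange of the occupations of `x` and `x + 1`. -/
def bondGrad (α : ZMod n → ℝ) (η : Config n) (x : ZMod n) : ℝ :=
  charge α η (x + 1) - charge α η x +
    (α (x + 1) - α x) * (charge α η x * charge α η (x + 1))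

/-- The rate at which the occupations of `x` and `x + 1` are exchanged; `f x` stands for
`F (x / n)`. -/
def bondRate (f : ZMod n → ℝ) (η : Config n) (x : ZMod n) : ℝ :=
  (1 + f x / n) * occ η x * (1 - occ η (x + 1)) +
    (1 - f (x + 1) / n) * occ η (x + 1) * (1 - occ η x)

/-- The mean current through the bond `{x, x + 1}` under the product measure. -/
def bondCurrent (f α : ZMod n → ℝ) (x : ZMod n) : ℝ :=
  (1 + f x / n) * (α x * (1 - α (x + 1))) - (1 - f (x + 1) / n) * (α (x + 1) * (1 - α x))

/-- Jumps to the left are reindexed by their target, so that both directions across a bond are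
attached to its left end. -/
lemma sum_rate_mul (F : ℝ → ℝ) (k : ZMod n → ZMod n → ℝ) :
    ∑ x, ∑ y, rate F n x y * k x y = ∑ x, ((1 + F (pos x) / n) * k x (x + 1) +
      (1 - F (pos (x + 1)) / n) * k (x + 1) x) := by
  have h1 : ∀ x, ∑ y, rate F n x y * k x y =
      (1 + F (pos x) / n) * k x (x + 1) + (1 - F (pos x) / n) * k x (x - 1) := by
    intro x
    simp [rate, add_mul, Finset.sum_add_distrib]
  simp only [h1, Finset.sum_add_distrib]
  congr 1
  rw [← Equiv.sum_comp (Equiv.addRight (1 : ZMod n))]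
  simp

lemma generator_eq_sum_bond (F : ℝ → ℝ) (u : Config n → ℝ) (η : Config n) :
    generator F n u η =
      ∑ x, bondRate (fun x => F (pos x)) η x * (u (exchange η x (x + 1)) - u η) := by
  have h := sum_rate_mul (n := n) F
    (fun x y => occ η x * (1 - occ η y) * (u (exchange η x y) - u η))
  have hL : generator F n u η = ∑ x, ∑ y, rate F n x y *
      (occ η x * (1 - occ η y) * (u (exchange η x y) - u η)) := by
    show ∑ x, ∑ y, _ = _
    exact Finset.sum_congr rfl fun x _ => Finset.sum_congr rfl fun y _ => by ring
  rw [hL, h]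
  refine Finset.sum_congr rfl fun x _ => ?_
  have : exchange η (x + 1) x = exchange η x (x + 1) := by
    unfold exchange; rw [Equiv.swap_comm]
  rw [this, bondRate]
  ring

omit [NeZero n] in
lemma exchange_involutive (x y : ZMod n) : Function.Involutive fun η : Config n => exchange η x y := by
  intro η
  funext z
  simp [exchange]

lemma sum_exchange (x y : ZMod n) (k : Config n → ℝ) :
    ∑ η, k (exchange η x y) = ∑ η, k η :=
  Equiv.sum_comp ((exchange_involutive x y).toPerm _) k

omit [NeZero n] in
lemma exchange_eq_self {η : Config n} {x y : ZMod n} (h : η x = η y) : exchange η x y = η := by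
  funext z
  unfold exchange
  rcases eq_or_ne z x with rfl | hx
  · simp [h]
  · rcases eq_or_ne z y with rfl | hy
    · simp [h]
    · rw [Equiv.swap_apply_of_ne_of_ne hx hy]

/-- Only the factors at x and y change; the ratio of the two weights is expressed without division.
-/
lemma bernWeight_exchange (α : ZMod n → ℝ) (η : Config n) {x y : ZMod n} (hxy : x ≠ y) :
    bernWeight α (exchange η x y) *
      ((if η x then α x else 1 - α x) * (if η y then α y else 1 - α y)) =
    bernWeight α η * ((if η y then α x else 1 - α x) * (if η x then α y else 1 - α y)) := by
  unfold bernWeight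
  have hsplit : ∀ g : ZMod n → ℝ, ∏ z, g z = g x * g y * ∏ z ∈ (Finset.univ.erase x).erase y, g z := by
    intro g
    rw [mul_assoc, Finset.mul_prod_erase _ _ (Finset.mem_erase.2 ⟨hxy.symm, Finset.mem_univ y⟩),
      Finset.mul_prod_erase _ _ (Finset.mem_univ x)]
  rw [hsplit, hsplit (fun z => if η z then α z else 1 - α z)]
  have hrest : ∏ z ∈ (Finset.univ.erase x).erase y,
      (if exchange η x y z then α z else 1 - α z) =
      ∏ z ∈ (Finset.univ.erase x).erase y, (if η z then α z else 1 - α z) := by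
    refine Finset.prod_congr rfl fun z hz => ?_
    have h1 := Finset.ne_of_mem_erase hz
    have h2 := Finset.ne_of_mem_erase (Finset.mem_of_mem_erase hz)
    unfold exchange
    rw [Equiv.swap_apply_of_ne_of_ne h2 h1]
  rw [hrest]
  simp only [exchange, Equiv.swap_apply_left, Equiv.swap_apply_right]
  ring

variable {α : ZMod n → ℝ} {e : ℝ}

omit [NeZero n] in
-- The quadratic correction makes the gradient vanish when the two sites agree. Otherwise it is, up
-- to sign, the reciprocal of the local weight of the configuration, which is what antisymmetry
-- requires.
lemma bondGrad_eq (he : 0 < e) (hα : ∀ x, α x ∈ Icc e (1 - e)) (η : Config n) (x : ZMod n) :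
    bondGrad α η x = if η x then (if η (x + 1) then 0 else -(1 / (α x * (1 - α (x + 1)))))
      else (if η (x + 1) then 1 / (α (x + 1) * (1 - α x)) else 0) := by
  have h1 : α x ≠ 0 := (he.trans_le (hα x).1).ne'
  have h2 : α (x + 1) ≠ 0 := (he.trans_le (hα _).1).ne'
  have h3 : 1 - α x ≠ 0 := by have := (hα x).2; intro h; linarith
  have h4 : 1 - α (x + 1) ≠ 0 := by have := (hα (x + 1)).2; intro h; linarith
  unfold bondGrad charge
  split_ifs <;> field_simp <;> ring

omit [NeZero n] in
lemma abs_bondGrad_le (he : 0 < e) (hα : ∀ x, α x ∈ Icc e (1 - e)) (η : Config n) (x : ZMod n) :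
    |bondGrad α η x| ≤ 1 / e ^ 2 := by
  have h : ∀ y z : ZMod n, |1 / (α y * (1 - α z))| ≤ 1 / e ^ 2 := by
    intro y z
    have h1 := (hα y).1
    have h2 : e ≤ 1 - α z := by linarith [(hα z).2]
    have h3 : e ^ 2 ≤ α y * (1 - α z) := by
      rw [sq]; exact mul_le_mul h1 h2 he.le (he.le.trans h1)
    rw [abs_of_pos (by have := pow_pos he 2; have := this.trans_le h3; positivity)]
    exact one_div_le_one_div_of_le (by positivity) h3
  rw [bondGrad_eq he hα]
  split_ifs
  · simp; positivity
  · rw [abs_neg]; exact h _ _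
  · exact h _ _
  · simp; positivity

omit [NeZero n] in
lemma ne_add_one (hn : 2 ≤ n) (x : ZMod n) : x ≠ x + 1 := by
  have : Fact (1 < n) := ⟨by omega⟩
  intro h
  have := left_eq_add.1 h
  exact one_ne_zero this

/-- The local weight cancels the denominator of the gradient. A sign times the weight of the other
sites remains, and the exchange affects only the sign. -/
lemma bernWeight_mul_bondGrad_exchange (he : 0 < e) (hα : ∀ x, α x ∈ Icc e (1 - e)) (hn : 2 ≤ n)
    (η : Config n) (x : ZMod n) :
    bernWeight α (exchange η x (x + 1)) * bondGrad α (exchange η x (x + 1)) x =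
      -(bernWeight α η * bondGrad α η x) := by
  have h1 : α x ≠ 0 := (he.trans_le (hα x).1).ne'
  have h2 : α (x + 1) ≠ 0 := (he.trans_le (hα _).1).ne'
  have h3 : 1 - α x ≠ 0 := by have := (hα x).2; intro h; linarith
  have h4 : 1 - α (x + 1) ≠ 0 := by have := (hα (x + 1)).2; intro h; linarith
  have hw := bernWeight_exchange α η (ne_add_one hn x)
  rw [bondGrad_eq he hα, bondGrad_eq he hα]
  simp only [exchange, Equiv.swap_apply_left, Equiv.swap_apply_right] at hw ⊢
  rcases ha : η x <;> rcases hb : η (x + 1) <;> simp [ha, hb] at hw ⊢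
  · field_simp
    linear_combination hw
  · field_simp
    linear_combination hw

/-- The defect of reversibility across one bond. It vanishes when the sites agree and is
antisymmetric under the exchange, hence a multiple of the weighted bond gradient; the multiple is
the mean current. -/
lemma bernWeight_mul_bondRate_exchange (he : 0 < e) (hα : ∀ x, α x ∈ Icc e (1 - e)) (hn : 2 ≤ n)
    (f : ZMod n → ℝ) (η : Config n) (x : ZMod n) :
    bernWeight α (exchange η x (x + 1)) * bondRate f (exchange η x (x + 1)) x -
      bernWeight α η * bondRate f η x =
      bondCurrent f α x * (bernWeight α η * bondGrad α η x) := by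
  have h1 : α x ≠ 0 := (he.trans_le (hα x).1).ne'
  have h2 : α (x + 1) ≠ 0 := (he.trans_le (hα _).1).ne'
  have h3 : 1 - α x ≠ 0 := by have := (hα x).2; intro h; linarith
  have h4 : 1 - α (x + 1) ≠ 0 := by have := (hα (x + 1)).2; intro h; linarith
  have hw := bernWeight_exchange α η (ne_add_one hn x)
  rw [bondGrad_eq he hα]
  unfold bondRate bondCurrent occ
  simp only [exchange, Equiv.swap_apply_left, Equiv.swap_apply_right] at hw ⊢
  rcases ha : η x <;> rcases hb : η (x + 1) <;> simp [ha, hb] at hw ⊢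
  · field_simp
    linear_combination (n + f x) * hw
  · field_simp
    linear_combination (n - f (x + 1)) * hw

/-- The adjoint of the generator in `L²` of the product measure, applied to constants. -/
lemma sum_bernWeight_generator (he : 0 < e) (hα : ∀ x, α x ∈ Icc e (1 - e)) (hn : 2 ≤ n)
    (F : ℝ → ℝ) (u : Config n → ℝ) :
    ∑ η, bernWeight α η * generator F n u η =
      ∑ x, bondCurrent (fun x => F (pos x)) α x * ∑ η, bernWeight α η * bondGrad α η x * u η := by
  simp only [generator_eq_sum_bond, Finset.mul_sum]
  rw [Finset.sum_comm]
  refine Finset.sum_congr rfl fun x _ => ?_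
  set f : ZMod n → ℝ := fun x => F (pos x)
  have h1 : ∑ η, bernWeight α η * (bondRate f η x * (u (exchange η x (x + 1)) - u η)) =
      ∑ η, bernWeight α η * bondRate f η x * u (exchange η x (x + 1)) -
        ∑ η, bernWeight α η * bondRate f η x * u η := by
    rw [← Finset.sum_sub_distrib]
    exact Finset.sum_congr rfl fun η _ => by ring
  have h2 : ∑ η, bernWeight α η * bondRate f η x * u (exchange η x (x + 1)) =
      ∑ η, bernWeight α (exchange η x (x + 1)) * bondRate f (exchange η x (x + 1)) x * u η := by
    rw [← sum_exchange x (x + 1)]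
    refine Finset.sum_congr rfl fun η _ => ?_
    have : exchange (exchange η x (x + 1)) x (x + 1) = η := exchange_involutive x (x + 1) η
    rw [this]
  rw [h1, h2, ← Finset.sum_sub_distrib]
  refine Finset.sum_congr rfl fun η _ => ?_
  have := bernWeight_mul_bondRate_exchange he hα hn f η x
  linear_combination u η * this

/-- Integration by parts across a bond. -/
lemma sum_bondGrad_mul_sq_le (he : 0 < e) (hα : ∀ x, α x ∈ Icc e (1 - e)) (hn : 2 ≤ n)
    (x : ZMod n) {h : Config n → ℝ} (hh : ∀ η, h (exchange η x (x + 1)) = h η)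
    {A : ℝ} (hA : 0 < A) (v : Config n → ℝ) :
    ∑ η, bernWeight α η * h η * bondGrad α η x * v η ^ 2 ≤
      A * ∑ η, bernWeight α η * (v (exchange η x (x + 1)) - v η) ^ 2 +
        1 / (4 * A * e ^ 4) * ∑ η, bernWeight α η * h η ^ 2 * v η ^ 2 := by
  set w := bernWeight α
  set g : Config n → ℝ := fun η => bondGrad α η x
  set s : Config n → Config n := fun η => exchange η x (x + 1)
  have hw0 : ∀ η, 0 ≤ w η := fun η => (bernWeight_pos (fun x => he.trans_le (hα x).1)
      (fun x => by linarith [(hα x).2]) η).le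
  have hss : ∀ η, s (s η) = η := exchange_involutive x (x + 1)
  have hsum : ∀ k : Config n → ℝ, ∑ η, k (s η) = ∑ η, k η := sum_exchange x (x + 1)
  have hwg : ∀ η, w (s η) * g (s η) = -(w η * g η) :=
    fun η => bernWeight_mul_bondGrad_exchange he hα hn η x
  have hg : ∀ η, g η ^ 2 ≤ 1 / e ^ 4 := fun η => by
    have := pow_le_pow_left₀ (abs_nonneg _) (abs_bondGrad_le he hα η x) 2
    rw [sq_abs] at this
    refine this.trans (le_of_eq ?_)
    rw [div_pow, one_pow, ← pow_mul]
  -- Antisymmetry of w g and invariance of h turn v² into half a difference of squares, which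
  -- Young's inequality then splits.
  have hsym : ∑ η, w η * h η * g η * v η ^ 2 =
      ∑ η, 1 / 2 * (w η * h η * g η * (v η ^ 2 - v (s η) ^ 2)) := by
    have h1 := hsum fun η => w η * h η * g η * v η ^ 2
    have h2 : ∑ η, w (s η) * h (s η) * g (s η) * v (s η) ^ 2 =
        -∑ η, w η * h η * g η * v (s η) ^ 2 := by
      rw [← Finset.sum_neg_distrib]
      refine Finset.sum_congr rfl fun η _ => ?_
      have : h (s η) = h η := hh η
      rw [this]
      linear_combination h η * v (s η) ^ 2 * hwg η
    rw [h2] at h1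
    rw [← Finset.mul_sum]
    simp only [mul_sub, Finset.sum_sub_distrib]
    linarith
  have hpt : ∀ η, 1 / 2 * (w η * h η * g η * (v η ^ 2 - v (s η) ^ 2)) ≤
      A * (w η * (v (s η) - v η) ^ 2) +
        1 / (8 * A) * (w η * g η ^ 2 * h η ^ 2 * v η ^ 2 + w η * g η ^ 2 * h η ^ 2 * v (s η) ^ 2) := by
    intro η
    have h1 : 1 / 2 * (h η * g η * (v η ^ 2 - v (s η) ^ 2)) ≤ A * (v (s η) - v η) ^ 2 +
        1 / (8 * A) * (g η ^ 2 * h η ^ 2 * v η ^ 2 + g η ^ 2 * h η ^ 2 * v (s η) ^ 2) := by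
      rw [← sub_nonneg]
      have : A * (v (s η) - v η) ^ 2 +
          1 / (8 * A) * (g η ^ 2 * h η ^ 2 * v η ^ 2 + g η ^ 2 * h η ^ 2 * v (s η) ^ 2) -
          1 / 2 * (h η * g η * (v η ^ 2 - v (s η) ^ 2)) =
          1 / A * ((A * (v (s η) - v η) + 1 / 4 * (h η * g η * (v η + v (s η)))) ^ 2 +
            1 / 16 * (h η * g η * (v η - v (s η))) ^ 2) := by
        field_simp; ring
      rw [this]
      positivity
    have := mul_le_mul_of_nonneg_left h1 (hw0 η)
    linarith
  have hb1 : ∑ η, w η * g η ^ 2 * h η ^ 2 * v η ^ 2 ≤ 1 / e ^ 4 * ∑ η, w η * h η ^ 2 * v η ^ 2 := by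
    rw [Finset.mul_sum]
    refine Finset.sum_le_sum fun η _ => ?_
    have h0 : 0 ≤ w η * h η ^ 2 * v η ^ 2 := by have := hw0 η; positivity
    have := mul_le_mul_of_nonneg_right (hg η) h0
    linarith
  have hb2 : ∑ η, w η * g η ^ 2 * h η ^ 2 * v (s η) ^ 2 ≤
      1 / e ^ 4 * ∑ η, w η * h η ^ 2 * v η ^ 2 := by
    rw [← hsum, Finset.mul_sum]
    refine Finset.sum_le_sum fun η _ => ?_
    have hhs : h (s η) = h η := hh η
    rw [hss, hhs]
    -- Antisymmetry trades w ∘ s for w, so no bound on the ratio of the two weights is needed.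
    have h1 : w (s η) * g (s η) ^ 2 ≤ 1 / e ^ 4 * w η := by
      have e1 : w (s η) * g (s η) ^ 2 = w η * (-(g η * g (s η))) := by
        linear_combination g (s η) * hwg η
      rw [e1, mul_comm]
      refine mul_le_mul_of_nonneg_right ?_ (hw0 η)
      nlinarith [hg η, hg (s η), sq_nonneg (g η + g (s η))]
    have h0 : 0 ≤ h η ^ 2 * v η ^ 2 := by positivity
    have := mul_le_mul_of_nonneg_right h1 h0
    linarith
  have h4 : 0 < 1 / (8 * A) := by positivity
  calc ∑ η, w η * h η * g η * v η ^ 2 ≤ _ := hsym.le.trans (Finset.sum_le_sum fun η _ => hpt η)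
    _ = A * ∑ η, w η * (v (s η) - v η) ^ 2 + 1 / (8 * A) * (∑ η, w η * g η ^ 2 * h η ^ 2 * v η ^ 2 +
          ∑ η, w η * g η ^ 2 * h η ^ 2 * v (s η) ^ 2) := by
        rw [Finset.sum_add_distrib, ← Finset.mul_sum, ← Finset.mul_sum, ← Finset.sum_add_distrib]
    _ ≤ A * ∑ η, w η * (v (s η) - v η) ^ 2 + 1 / (8 * A) *
          (1 / e ^ 4 * ∑ η, w η * h η ^ 2 * v η ^ 2 + 1 / e ^ 4 * ∑ η, w η * h η ^ 2 * v η ^ 2) := by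
        gcongr
    _ = _ := by field_simp; ring

/-- The Dirichlet form absorbs all the bond gradients. -/
lemma form_add_sum_bondGrad_le (he : 0 < e) (hα : ∀ x, α x ∈ Icc e (1 - e)) (hn : 2 ≤ n)
    {F : ℝ → ℝ} (hF : ∀ x : ZMod n, |F (pos x)| ≤ n / 2)
    {h : ZMod n → Config n → ℝ} (hh : ∀ x η, h x (exchange η x (x + 1)) = h x η)
    (v : Config n → ℝ) :
    2 * (n : ℝ) ^ 2 * ∑ η, bernWeight α η * v η * generator F n v η +
        ∑ x, ∑ η, bernWeight α η * h x η * bondGrad α η x * v η ^ 2 ≤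
      (n : ℝ) ^ 2 * ∑ x, bondCurrent (fun x => F (pos x)) α x *
          ∑ η, bernWeight α η * bondGrad α η x * v η ^ 2 +
        1 / (2 * (n : ℝ) ^ 2 * e ^ 4) * ∑ x, ∑ η, bernWeight α η * h x η ^ 2 * v η ^ 2 := by
  have hnpos : (0 : ℝ) < n := by exact_mod_cast (by omega : 0 < n)
  have hw0 : ∀ η, 0 ≤ bernWeight α η := fun η => (bernWeight_pos (fun x => he.trans_le (hα x).1)
      (fun x => by linarith [(hα x).2]) η).le
  set f : ZMod n → ℝ := fun x => F (pos x)
  have hgen := sum_bernWeight_generator he hα hn F (fun η => v η ^ 2)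
  -- 2 v L v is L v² minus the carré du champ. The mean of the first is given by the adjoint formula
  -- `hgen`; the second is the Dirichlet form.
  have hE : 2 * ∑ η, bernWeight α η * v η * generator F n v η =
      ∑ η, bernWeight α η * generator F n (fun η => v η ^ 2) η -
        ∑ x, ∑ η, bernWeight α η * (bondRate f η x * (v (exchange η x (x + 1)) - v η) ^ 2) := by
    rw [Finset.sum_comm (s := (Finset.univ : Finset (ZMod n))), ← Finset.sum_sub_distrib,
      Finset.mul_sum]
    refine Finset.sum_congr rfl fun η _ => ?_
    simp only [generator_eq_sum_bond, Finset.mul_sum, ← Finset.sum_sub_distrib]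
    exact Finset.sum_congr rfl fun x _ => by ring
  -- When the occupations differ, exactly one direction is open, and its rate is at least 1/2
  -- because |F| ≤ n / 2.
  have hrate : ∀ x η, 1 / 2 * (v (exchange η x (x + 1)) - v η) ^ 2 ≤
      bondRate f η x * (v (exchange η x (x + 1)) - v η) ^ 2 := by
    intro x η
    by_cases heq : η x = η (x + 1)
    · rw [exchange_eq_self heq]; simp
    · refine mul_le_mul_of_nonneg_right ?_ (sq_nonneg _)
      have h1 : |f x / n| ≤ 1 / 2 := by
        rw [abs_div, abs_of_pos hnpos, div_le_iff₀ hnpos]; linarith [hF x]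
      have h2 : |f (x + 1) / n| ≤ 1 / 2 := by
        rw [abs_div, abs_of_pos hnpos, div_le_iff₀ hnpos]; linarith [hF (x + 1)]
      rw [abs_le] at h1 h2
      unfold bondRate occ
      rcases ha : η x <;> rcases hb : η (x + 1) <;> simp [ha, hb] at heq ⊢ <;> linarith [h1.1, h2.2]
  have hDir : 1 / 2 * ∑ x, ∑ η, bernWeight α η * (v (exchange η x (x + 1)) - v η) ^ 2 ≤
      ∑ x, ∑ η, bernWeight α η * (bondRate f η x * (v (exchange η x (x + 1)) - v η) ^ 2) := by
    simp only [Finset.mul_sum]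
    refine Finset.sum_le_sum fun x _ => Finset.sum_le_sum fun η _ => ?_
    have := mul_le_mul_of_nonneg_left (hrate x η) (hw0 η)
    linarith
  have hIBP : ∑ x, ∑ η, bernWeight α η * h x η * bondGrad α η x * v η ^ 2 ≤
      (n : ℝ) ^ 2 / 2 * ∑ x, ∑ η, bernWeight α η * (v (exchange η x (x + 1)) - v η) ^ 2 +
        1 / (2 * (n : ℝ) ^ 2 * e ^ 4) * ∑ x, ∑ η, bernWeight α η * h x η ^ 2 * v η ^ 2 := by
    rw [Finset.mul_sum, Finset.mul_sum, ← Finset.sum_add_distrib]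
    refine Finset.sum_le_sum fun x _ => ?_
    refine (sum_bondGrad_mul_sq_le he hα hn x (hh x) (A := (n : ℝ) ^ 2 / 2) (by positivity) v).trans
      (le_of_eq ?_)
    congr 2
    field_simp; norm_num
  have hmul := mul_le_mul_of_nonneg_left hDir (sq_nonneg (n : ℝ))
  have e1 : 2 * (n : ℝ) ^ 2 * ∑ η, bernWeight α η * v η * generator F n v η =
    (n : ℝ) ^ 2 * (2 * ∑ η, bernWeight α η * v η * generator F n v η) := by ring
  rw [e1, hE, hgen, mul_sub]
  linarith

end Bond

/-! ### Spreading the quadratic term; the spectral bound. -/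

section Kernel

variable {n : ℕ} [NeZero n]

/-- The weights of the telescoping sum which spreads a neighbouring site over the whole torus. -/
def spreadKernel (z : ZMod n) : ℝ := if z = 0 then 0 else ((n : ℝ) - 1 - z.val) / (n - 1)

/-- Together with the value 0 at z = 0, this makes `spread` at y independent of the occupations of y
and y + 1, hence admissible as a coefficient in the integration by parts across that bond. -/
lemma spreadKernel_neg_one (hn : 2 ≤ n) : spreadKernel (-1 : ZMod n) = 0 := by
  obtain ⟨k, rfl⟩ : ∃ k, n = k + 1 := ⟨n - 1, by omega⟩
  unfold spreadKernel
  split_ifs with h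
  · rfl
  · rw [ZMod.val_neg_one]; simp

lemma abs_spreadKernel_le (hn : 2 ≤ n) (z : ZMod n) : |spreadKernel z| ≤ 1 := by
  have hn' : (2 : ℝ) ≤ n := by exact_mod_cast hn
  unfold spreadKernel
  split_ifs
  · simp
  · have h1 : ((z.val : ℕ) : ℝ) + 1 ≤ n := by exact_mod_cast ZMod.val_lt z
    have h0 : (0 : ℝ) ≤ z.val := Nat.cast_nonneg _
    rw [abs_of_nonneg (div_nonneg (by linarith) (by linarith)), div_le_one (by linarith)]
    linarith

/-- The linear decay of the kernel moves a unit mass from z = 1 to the uniform distribution on the n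
− 1 sites other than 0. -/
lemma spreadKernel_sub_one_sub (hn : 2 ≤ n) (z : ZMod n) :
    spreadKernel (z - 1) - spreadKernel z =
      1 / ((n : ℝ) - 1) - (if z = 1 then 1 else 0) - (if z = 0 then 1 / ((n : ℝ) - 1) else 0) := by
  have hn' : (2 : ℝ) ≤ n := by exact_mod_cast hn
  have hne : (n : ℝ) - 1 ≠ 0 := by intro h; linarith
  have hf : Fact (1 < n) := ⟨by omega⟩
  by_cases h0 : z = 0
  · subst h0
    rw [zero_sub, spreadKernel_neg_one hn]
    simp [spreadKernel]
  · by_cases h1 : z = 1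
    · subst h1
      simp only [sub_self, spreadKernel, if_true, one_ne_zero, if_false, ZMod.val_one]
      field_simp
      simp
    · have hz1 : z - 1 ≠ 0 := sub_ne_zero.2 h1
      have hval : (z - 1).val = z.val - 1 := by
        rw [ZMod.val_sub, ZMod.val_one]
        rw [ZMod.val_one]
        exact Nat.one_le_iff_ne_zero.2 ((ZMod.val_ne_zero z).2 h0)
      have hpos : 1 ≤ z.val := Nat.one_le_iff_ne_zero.2 ((ZMod.val_ne_zero z).2 h0)
      simp only [spreadKernel, hz1, h0, h1, if_false, hval]
      push_cast [hpos]
      field_simp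
      ring

/-- Replacement of the product of neighbouring variables by a product with the global mean. -/
lemma sum_mul_mul_succ_eq (hn : 2 ≤ n) (b c : ZMod n → ℝ) :
    ∑ x, b x * (c x * c (x + 1)) =
      1 / ((n : ℝ) - 1) * ((∑ x, b x * c x) * (∑ x, c x) - ∑ x, b x * c x ^ 2) -
        ∑ y, (∑ x, spreadKernel (y - x) * (b x * c x)) * (c (y + 1) - c y) := by
  have h1 : ∑ y, (∑ x, spreadKernel (y - x) * (b x * c x)) * (c (y + 1) - c y) =
      ∑ x, b x * c x * ∑ y, (spreadKernel (y - x - 1) - spreadKernel (y - x)) * c y := by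
    simp only [mul_sub, sub_mul, Finset.sum_sub_distrib]
    congr 1
    · rw [← Equiv.sum_comp (Equiv.subRight (1 : ZMod n))]
      simp only [Equiv.subRight_apply, sub_add_cancel, Finset.sum_mul, Finset.mul_sum]
      rw [Finset.sum_comm]
      refine Finset.sum_congr rfl fun x _ => Finset.sum_congr rfl fun y _ => ?_
      rw [show y - 1 - x = y - x - 1 by ring]; ring
    · simp only [Finset.sum_mul, Finset.mul_sum]
      rw [Finset.sum_comm]
      exact Finset.sum_congr rfl fun x _ => Finset.sum_congr rfl fun y _ => by ring
  have h2 : ∀ x, ∑ y, (spreadKernel (y - x - 1) - spreadKernel (y - x)) * c y =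
      1 / ((n : ℝ) - 1) * ∑ y, c y - c (x + 1) - 1 / ((n : ℝ) - 1) * c x := by
    intro x
    simp only [spreadKernel_sub_one_sub hn, sub_mul, Finset.sum_sub_distrib,
      sub_eq_iff_eq_add, ← Finset.mul_sum, ite_mul, one_mul, zero_mul, Finset.sum_ite_eq',
      Finset.mem_univ, if_true, add_comm (1 : ZMod n) x, zero_add]
  rw [h1]
  simp only [h2]
  have h3 : ∑ x, b x * c x * (1 / ((n : ℝ) - 1) * ∑ y, c y - c (x + 1) - 1 / ((n : ℝ) - 1) * c x) =
      1 / ((n : ℝ) - 1) * ((∑ x, b x * c x) * ∑ x, c x) - ∑ x, b x * (c x * c (x + 1)) -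
        1 / ((n : ℝ) - 1) * ∑ x, b x * c x ^ 2 := by
    simp only [mul_sub, Finset.sum_sub_distrib]
    congr 1
    · congr 1
      · rw [← Finset.sum_mul]; ring
      · exact Finset.sum_congr rfl fun x _ => by ring
    · rw [Finset.mul_sum]
      exact Finset.sum_congr rfl fun x _ => by ring
  rw [h3]
  ring

/-- The coefficient of the bond gradient at `y` after spreading `∑ b x * c x * c (x + 1)`. -/
def spread (α b : ZMod n → ℝ) (η : Config n) (y : ZMod n) : ℝ :=
  ∑ x, spreadKernel (y - x) * (b x * charge α η x)

/-- The mean-field part of `∑ b x * c x * c (x + 1)`. -/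
def meanField (α b : ZMod n → ℝ) (η : Config n) : ℝ :=
  1 / ((n : ℝ) - 1) * ((∑ x, b x * charge α η x) * (∑ x, charge α η x) -
    ∑ x, b x * charge α η x ^ 2)

/-- The term of third degree produced by the non-homogeneity of the product measure. -/
def cubic (α b : ZMod n → ℝ) (η : Config n) : ℝ :=
  ∑ y, (α (y + 1) - α y) * spread α b η y * (charge α η y * charge α η (y + 1))

lemma spread_exchange (hn : 2 ≤ n) (α b : ZMod n → ℝ) (η : Config n) (y : ZMod n) :
    spread α b (exchange η y (y + 1)) y = spread α b η y := by
  unfold spread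
  refine Finset.sum_congr rfl fun x _ => ?_
  by_cases h1 : x = y
  · subst h1; simp [spreadKernel]
  · by_cases h2 : x = y + 1
    · subst h2
      rw [show y - (y + 1) = -1 by ring, spreadKernel_neg_one hn]; simp
    · have : charge α (exchange η y (y + 1)) x = charge α η x := by
        unfold charge exchange
        rw [Equiv.swap_apply_of_ne_of_ne h1 h2]
      rw [this]

/-- The entropy production in terms of bond gradients. -/
lemma entropyProduction_eq (hn : 2 ≤ n) (α f Φ : ZMod n → ℝ) (η : Config n) :
    (n : ℝ) ^ 2 * ∑ x, bondCurrent f α x * bondGrad α η x -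
        ∑ x, n * (Φ (x + 1) - Φ x) * charge α η x =
      -∑ x, (n * (-(n * bondCurrent f α x) - Φ (x + 1)) +
          spread α (fun x => -(n * Φ (x + 1) * (α (x + 1) - α x))) η x) * bondGrad α η x +
        (meanField α (fun x => -(n * Φ (x + 1) * (α (x + 1) - α x))) η +
          cubic α (fun x => -(n * Φ (x + 1) * (α (x + 1) - α x))) η) := by
  set c := charge α η
  set b : ZMod n → ℝ := fun x => -(n * Φ (x + 1) * (α (x + 1) - α x))
  have h1 := sum_mul_mul_succ_eq hn b c
  -- Summation by parts brings the time derivative of the weights to the same form as the current.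
  -- Correcting the plain gradient then creates the quadratic term with coefficients b, and
  -- correcting it again after spreading creates the cubic term.
  have h2 : ∑ x, (n : ℝ) * (Φ (x + 1) - Φ x) * c x = -∑ x, n * Φ (x + 1) * (c (x + 1) - c x) := by
    have : ∑ x, (n : ℝ) * Φ x * c x = ∑ x, (n : ℝ) * Φ (x + 1) * c (x + 1) :=
      (Equiv.sum_comp (Equiv.addRight (1 : ZMod n)) fun x => (n : ℝ) * Φ x * c x).symm
    simp only [mul_sub, sub_mul, Finset.sum_sub_distrib, this]
    ring
  have h3 : ∀ x, bondGrad α η x = c (x + 1) - c x + (α (x + 1) - α x) * (c x * c (x + 1)) :=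
    fun x => rfl
  rw [h2]
  have h4 : ∑ x, n * Φ (x + 1) * (c (x + 1) - c x) =
      ∑ x, n * Φ (x + 1) * bondGrad α η x + ∑ x, b x * (c x * c (x + 1)) := by
    rw [← Finset.sum_add_distrib]
    exact Finset.sum_congr rfl fun x _ => by rw [h3]; simp only [b]; ring
  have h5 : ∑ y, spread α b η y * (c (y + 1) - c y) =
      ∑ y, spread α b η y * bondGrad α η y - cubic α b η := by
    unfold cubic
    rw [← Finset.sum_sub_distrib]
    exact Finset.sum_congr rfl fun x _ => by rw [h3]; simp only [c]; ring
  have h6 : ∑ x, b x * (c x * c (x + 1)) = meanField α b η -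
      (∑ y, spread α b η y * bondGrad α η y - cubic α b η) := by
    rw [h1, ← h5]; rfl
  rw [h4, h6, Finset.mul_sum]
  have h7 : ∑ x, (n * (-(n * bondCurrent f α x) - Φ (x + 1)) + spread α b η x) * bondGrad α η x =
      -∑ x, (n : ℝ) ^ 2 * (bondCurrent f α x * bondGrad α η x) -
        ∑ x, n * Φ (x + 1) * bondGrad α η x + ∑ y, spread α b η y * bondGrad α η y := by
    rw [← Finset.sum_neg_distrib, ← Finset.sum_sub_distrib, ← Finset.sum_add_distrib]
    exact Finset.sum_congr rfl fun x _ => by ring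
  rw [h7]
  ring

/-- The part of the entropy production and of the additive functional `I` which is not controlled
by the Dirichlet form. -/
def residual (e ε : ℝ) (α b θ : ZMod n → ℝ) (I : Config n → ℝ) (η : Config n) : ℝ :=
  |meanField α b η| + |cubic α b η| +
    3 / (2 * e ^ 4) * (1 + (∑ y, spread α b η y ^ 2) / (n : ℝ) ^ 2) +
    (I η - ∑ y, θ y * bondGrad α η y) ^ 2 / ε

/-- The Dirichlet form absorbs all gradients at once, with coefficient h = −(n τ + spread) + 2γθ. In
h² the current error gives a constant, the spread goes into the residual, and θ gives a multiple of
ε γ². The part R of I which is not a gradient is split by 2γR ≤ ε γ² + R² / ε. -/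
lemma spectral_bound {e ε C : ℝ} (he : 0 < e) (hε : 0 < ε) (hn : 2 ≤ n) {α Φ θ : ZMod n → ℝ}
    (hα : ∀ x, α x ∈ Icc e (1 - e))
    {F : ℝ → ℝ} (hF : ∀ x : ZMod n, |F (pos x)| ≤ n / 2)
    (hτ : ∑ x, (-(n * bondCurrent (fun x => F (pos x)) α x) - Φ (x + 1)) ^ 2 ≤ 1)
    (hθ : (∑ x, θ x ^ 2) / (n : ℝ) ^ 2 ≤ C * ε) (I v : Config n → ℝ) (γ : ℝ) :
    2 * (n : ℝ) ^ 2 * ∑ η, bernWeight α η * v η * generator F n v η +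
        2 * γ * ∑ η, bernWeight α η * I η * v η ^ 2 -
        ∑ η, bernWeight α η * (∑ x, n * (Φ (x + 1) - Φ x) * charge α η x) * v η ^ 2 ≤
      ∑ η, bernWeight α η *
        residual e ε α (fun x => -(n * Φ (x + 1) * (α (x + 1) - α x))) θ I η * v η ^ 2 +
        (6 * C / e ^ 4 + 1) * ε * γ ^ 2 * ∑ η, bernWeight α η * v η ^ 2 := by
  have hnpos : (0 : ℝ) < n := by exact_mod_cast (by omega : 0 < n)
  have hw0 : ∀ η, 0 ≤ bernWeight α η := fun η => (bernWeight_pos (fun x => he.trans_le (hα x).1)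
      (fun x => by linarith [(hα x).2]) η).le
  set f : ZMod n → ℝ := fun x => F (pos x)
  set b : ZMod n → ℝ := fun x => -(n * Φ (x + 1) * (α (x + 1) - α x))
  set τ : ZMod n → ℝ := fun x => -(n * bondCurrent f α x) - Φ (x + 1)
  set h : ZMod n → Config n → ℝ := fun x η => -(n * τ x + spread α b η x) + 2 * γ * θ x
  have hform := form_add_sum_bondGrad_le he hα hn hF (h := h) (fun x η => by
    simp only [h, spread_exchange hn]) v
  have hpt : ∀ η, (n : ℝ) ^ 2 * ∑ x, bondCurrent f α x * bondGrad α η x -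
      ∑ x, n * (Φ (x + 1) - Φ x) * charge α η x - ∑ x, h x η * bondGrad α η x + 2 * γ * I η +
      1 / (2 * (n : ℝ) ^ 2 * e ^ 4) * ∑ x, h x η ^ 2 ≤
      residual e ε α b θ I η + (6 * C / e ^ 4 + 1) * ε * γ ^ 2 := by
    intro η
    have h1 := entropyProduction_eq hn α f Φ η
    have h2 : ∑ x, h x η * bondGrad α η x = -∑ x, (n * τ x + spread α b η x) * bondGrad α η x +
        2 * γ * ∑ x, θ x * bondGrad α η x := by
      rw [Finset.mul_sum, ← Finset.sum_neg_distrib, ← Finset.sum_add_distrib]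
      exact Finset.sum_congr rfl fun x _ => by simp only [h]; ring
    have h3 : ∑ x, h x η ^ 2 ≤ 3 * ((n : ℝ) ^ 2 * ∑ x, τ x ^ 2 + ∑ x, spread α b η x ^ 2 +
        4 * γ ^ 2 * ∑ x, θ x ^ 2) := by
      rw [Finset.mul_sum, Finset.mul_sum, ← Finset.sum_add_distrib, ← Finset.sum_add_distrib,
        Finset.mul_sum]
      refine Finset.sum_le_sum fun x _ => ?_
      simp only [h]
      nlinarith [sq_nonneg (n * τ x - spread α b η x), sq_nonneg (n * τ x + 2 * γ * θ x),
        sq_nonneg (spread α b η x + 2 * γ * θ x)]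
    have h4 : 1 / (2 * (n : ℝ) ^ 2 * e ^ 4) * ∑ x, h x η ^ 2 ≤
        3 / (2 * e ^ 4) * (1 + (∑ y, spread α b η y ^ 2) / (n : ℝ) ^ 2) +
          6 * C / e ^ 4 * ε * γ ^ 2 := by
      calc _ ≤ 1 / (2 * (n : ℝ) ^ 2 * e ^ 4) * (3 * ((n : ℝ) ^ 2 * ∑ x, τ x ^ 2 +
              ∑ x, spread α b η x ^ 2 + 4 * γ ^ 2 * ∑ x, θ x ^ 2)) :=
            mul_le_mul_of_nonneg_left h3 (by positivity)
        _ = 3 / (2 * e ^ 4) * (∑ x, τ x ^ 2 + (∑ x, spread α b η x ^ 2) / (n : ℝ) ^ 2) +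
              6 / e ^ 4 * γ ^ 2 * ((∑ x, θ x ^ 2) / (n : ℝ) ^ 2) := by field_simp; ring
        _ ≤ 3 / (2 * e ^ 4) * (1 + (∑ x, spread α b η x ^ 2) / (n : ℝ) ^ 2) +
              6 / e ^ 4 * γ ^ 2 * (C * ε) := by gcongr
        _ = _ := by ring
    have h5 : 2 * γ * (I η - ∑ y, θ y * bondGrad α η y) ≤ ε * γ ^ 2 +
        (I η - ∑ y, θ y * bondGrad α η y) ^ 2 / ε := by
      rw [← sub_nonneg]
      set R := I η - ∑ y, θ y * bondGrad α η y
      have : ε * γ ^ 2 + R ^ 2 / ε - 2 * γ * R = (ε * γ - R) ^ 2 / ε := by field_simp; ring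
      rw [this]; positivity
    have h6 := le_abs_self (meanField α b η)
    have h7 := le_abs_self (cubic α b η)
    unfold residual
    rw [h1, h2]
    linarith
  have hsum := Finset.sum_le_sum fun η (_ : η ∈ Finset.univ) =>
    mul_le_mul_of_nonneg_left (hpt η) (mul_nonneg (hw0 η) (sq_nonneg (v η)))
  have e1 : ∑ η, bernWeight α η * v η ^ 2 * (residual e ε α b θ I η +
      (6 * C / e ^ 4 + 1) * ε * γ ^ 2) = ∑ η, bernWeight α η * residual e ε α b θ I η * v η ^ 2 +
        (6 * C / e ^ 4 + 1) * ε * γ ^ 2 * ∑ η, bernWeight α η * v η ^ 2 := by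
    rw [Finset.mul_sum, ← Finset.sum_add_distrib]
    exact Finset.sum_congr rfl fun η _ => by ring
  have e2 : ∑ η, bernWeight α η * v η ^ 2 * ((n : ℝ) ^ 2 * ∑ x, bondCurrent f α x * bondGrad α η x -
      ∑ x, n * (Φ (x + 1) - Φ x) * charge α η x - ∑ x, h x η * bondGrad α η x + 2 * γ * I η +
      1 / (2 * (n : ℝ) ^ 2 * e ^ 4) * ∑ x, h x η ^ 2) =
      (n : ℝ) ^ 2 * ∑ x, bondCurrent f α x * ∑ η, bernWeight α η * bondGrad α η x * v η ^ 2 -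
      ∑ η, bernWeight α η * (∑ x, n * (Φ (x + 1) - Φ x) * charge α η x) * v η ^ 2 -
      ∑ x, ∑ η, bernWeight α η * h x η * bondGrad α η x * v η ^ 2 +
      2 * γ * ∑ η, bernWeight α η * I η * v η ^ 2 +
      1 / (2 * (n : ℝ) ^ 2 * e ^ 4) * ∑ x, ∑ η, bernWeight α η * h x η ^ 2 * v η ^ 2 := by
    have a1 : ∑ x, bondCurrent f α x * ∑ η, bernWeight α η * bondGrad α η x * v η ^ 2 =
        ∑ η, ∑ x, bondCurrent f α x * (bernWeight α η * bondGrad α η x * v η ^ 2) := by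
      rw [Finset.sum_comm]; simp only [Finset.mul_sum]
    rw [a1, Finset.sum_comm (s := (Finset.univ : Finset (ZMod n)))
      (f := fun x η => bernWeight α η * h x η * bondGrad α η x * v η ^ 2),
      Finset.sum_comm (s := (Finset.univ : Finset (ZMod n)))
      (f := fun x η => bernWeight α η * h x η ^ 2 * v η ^ 2)]
    rw [Finset.mul_sum (s := (Finset.univ : Finset (Config n))),
      Finset.mul_sum (s := (Finset.univ : Finset (Config n))),
      Finset.mul_sum (s := (Finset.univ : Finset (Config n))),
      ← Finset.sum_sub_distrib, ← Finset.sum_sub_distrib, ← Finset.sum_add_distrib,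
      ← Finset.sum_add_distrib]
    refine Finset.sum_congr rfl fun η _ => ?_
    have b1 : ∑ x, bondCurrent f α x * (bernWeight α η * bondGrad α η x * v η ^ 2) =
        (bernWeight α η * v η ^ 2) * ∑ x, bondCurrent f α x * bondGrad α η x := by
      rw [Finset.mul_sum]; exact Finset.sum_congr rfl fun x _ => by ring
    have b2 : ∑ x, bernWeight α η * h x η * bondGrad α η x * v η ^ 2 =
        (bernWeight α η * v η ^ 2) * ∑ x, h x η * bondGrad α η x := by
      rw [Finset.mul_sum]; exact Finset.sum_congr rfl fun x _ => by ring
    have b3 : ∑ x, bernWeight α η * h x η ^ 2 * v η ^ 2 =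
        (bernWeight α η * v η ^ 2) * ∑ x, h x η ^ 2 := by
      rw [Finset.mul_sum]; exact Finset.sum_congr rfl fun x _ => by ring
    rw [b1, b2, b3]
    ring
  rw [e1, e2] at hsum
  linarith

end Kernel

/-- From a two-sided exponential supermartingale bound to an exponential moment. -/
lemma sum_exp_abs_le {S : Type*} [Fintype S] {w X Q : S → ℝ} (hw : ∀ i, 0 ≤ w i)
    (h1 : ∑ i, w i * Real.exp (2 * X i - Q i) ≤ 1)
    (h2 : ∑ i, w i * Real.exp (-(2 * X i) - Q i) ≤ 1)
    (hQ : ∑ i, w i * Real.exp (Q i) ≤ 2) :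
    ∑ i, w i * Real.exp |X i| ≤ 3 := by
  have hpt : ∀ i, Real.exp |X i| ≤
      1 / 2 * Real.exp (2 * X i - Q i) + 1 / 2 * Real.exp (-(2 * X i) - Q i) + Real.exp (Q i) := by
    intro i
    -- exp x is the geometric mean of exp (2x − Q) and exp Q.
    have key : ∀ x : ℝ, Real.exp x ≤ 1 / 2 * Real.exp (2 * x - Q i) + 1 / 2 * Real.exp (Q i) := by
      intro x
      have e1 : Real.exp x = Real.exp ((2 * x - Q i) / 2) * Real.exp (Q i / 2) := by
        rw [← Real.exp_add]; congr 1; ring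
      have e2 : Real.exp (2 * x - Q i) = Real.exp ((2 * x - Q i) / 2) ^ 2 := by
        rw [← Real.exp_nat_mul]; congr 1; push_cast; ring
      have e3 : Real.exp (Q i) = Real.exp (Q i / 2) ^ 2 := by
        rw [← Real.exp_nat_mul]; congr 1; push_cast; ring
      rw [e1, e2, e3]
      nlinarith [sq_nonneg (Real.exp ((2 * x - Q i) / 2) - Real.exp (Q i / 2))]
    have p1 := Real.exp_pos (2 * X i - Q i)
    have p2 := Real.exp_pos (-(2 * X i) - Q i)
    have p3 := Real.exp_pos (Q i)
    rcases abs_cases (X i) with ⟨h, -⟩ | ⟨h, -⟩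
    · rw [h]; linarith [key (X i)]
    · rw [h]
      have := key (-X i)
      rw [show 2 * -X i - Q i = -(2 * X i) - Q i by ring] at this
      linarith
  have hs := Finset.sum_le_sum fun i (_ : i ∈ Finset.univ) =>
    mul_le_mul_of_nonneg_left (hpt i) (hw i)
  have e : ∑ i, w i * (1 / 2 * Real.exp (2 * X i - Q i) + 1 / 2 * Real.exp (-(2 * X i) - Q i) +
      Real.exp (Q i)) = 1 / 2 * ∑ i, w i * Real.exp (2 * X i - Q i) +
      1 / 2 * ∑ i, w i * Real.exp (-(2 * X i) - Q i) + ∑ i, w i * Real.exp (Q i) := by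
    rw [Finset.mul_sum, Finset.mul_sum, ← Finset.sum_add_distrib, ← Finset.sum_add_distrib]
    exact Finset.sum_congr rfl fun i _ => by ring
  rw [e] at hs
  linarith

lemma sum_exp_mono {S : Type*} [Fintype S] {w f g : S → ℝ} (hw : ∀ i, 0 ≤ w i)
    (h : ∀ i, f i ≤ g i) : ∑ i, w i * Real.exp (f i) ≤ ∑ i, w i * Real.exp (g i) :=
  Finset.sum_le_sum fun i _ => mul_le_mul_of_nonneg_left (Real.exp_le_exp.2 (h i)) (hw i)

/-! ### Exponential moments of squares and of martingale sums. -/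

section Moments

variable {n : ℕ} [NeZero n] {α : ZMod n → ℝ} {e : ℝ}

lemma val_add_one_of_ne (hn : 2 ≤ n) {y : ZMod n} (hy : y + 1 ≠ 0) : (y + 1).val = y.val + 1 := by
  have hf : Fact (1 < n) := ⟨by omega⟩
  have h1 : y = y + 1 - 1 := by ring
  have hpos : 1 ≤ (y + 1).val := Nat.one_le_iff_ne_zero.2 ((ZMod.val_ne_zero _).2 hy)
  have h2 : y.val = (y + 1).val - 1 := by
    conv_lhs => rw [h1]
    rw [ZMod.val_sub, ZMod.val_one]
    rwa [ZMod.val_one]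
  omega

/-- Exponential supermartingale in the increasing order of the sites. -/
lemma sum_exp_forward_le (he : 0 < e) (hα : ∀ x, α x ∈ Icc e (1 - e)) (hn : 2 ≤ n)
    (A : ZMod n → Config n → ℝ)
    (hA : ∀ y η η', (∀ z : ZMod n, z.val ≤ y.val → η z = η' z) → A y η = A y η')
    (hA0 : ∀ y η, y + 1 = 0 → A y η = 0) :
    ∑ η, bernWeight α η *
      Real.exp (∑ y, (A y η * charge α η (y + 1) - A y η ^ 2 / e ^ 2)) ≤ 1 := by
  have h := sum_exp_martingale_le he hα (fun x : ZMod n => (x.val : ℤ))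
    (fun x y hxy => ZMod.val_injective n (Int.ofNat_inj.1 hxy))
    -- The increment at rank x is the charge at x = y + 1, hence the shift. At x = 0 the predecessor
    -- is the last site, which has the highest rank; there A vanishes by `hA0`.
    (fun x => A (x - 1)) (fun x η η' hz => by
      by_cases hx : x = 0
      · rw [hA0 _ _ (by rw [hx]; ring), hA0 _ _ (by rw [hx]; ring)]
      · refine hA _ _ _ fun z hzv => hz z ?_
        have h1 : (x - 1 + 1).val = (x - 1).val + 1 :=
          val_add_one_of_ne hn (by rwa [sub_add_cancel])
        rw [sub_add_cancel] at h1
        have : z.val < x.val := by omega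
        exact_mod_cast this) Finset.univ
  refine le_trans (le_of_eq ?_) h
  refine Finset.sum_congr rfl fun η _ => ?_
  congr 2
  rw [← Equiv.sum_comp (Equiv.addRight (1 : ZMod n))
    (fun x => A (x - 1) η * charge α η x - A (x - 1) η ^ 2 / e ^ 2)]
  simp

/-- Exponential supermartingale in the decreasing order of the sites. -/
lemma sum_exp_reverse_le (he : 0 < e) (hα : ∀ x, α x ∈ Icc e (1 - e))
    (A : ZMod n → Config n → ℝ)
    (hA : ∀ y η η', (∀ z : ZMod n, y.val < z.val → η z = η' z) → A y η = A y η') :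
    ∑ η, bernWeight α η *
      Real.exp (∑ y, (A y η * charge α η y - A y η ^ 2 / e ^ 2)) ≤ 1 :=
  sum_exp_martingale_le he hα (fun x : ZMod n => -(x.val : ℤ))
    (fun x y hxy => ZMod.val_injective n (by exact_mod_cast neg_inj.1 hxy)) A
    (fun x η η' hz => hA x η η' fun z hzv => hz z (by
      have : (x.val : ℤ) < z.val := by exact_mod_cast hzv
      linarith)) Finset.univ

lemma bernWeight_nonneg_of_mem (he : 0 < e) (hα : ∀ x, α x ∈ Icc e (1 - e)) (η : Config n) :
    0 ≤ bernWeight α η :=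
  (bernWeight_pos (fun x => he.trans_le (hα x).1) (fun x => by linarith [(hα x).2]) η).le

/-- Exponential moments of an average of squares of linear functionals. -/
lemma sum_exp_average_sq_le (he : 0 < e) (hα : ∀ x, α x ∈ Icc e (1 - e)) {B : ℝ} (hB : 0 < B)
    {a : ZMod n → ZMod n → ℝ} (ha : ∀ y x, |a y x| ≤ B) :
    ∑ η, bernWeight α η * Real.exp (e ^ 2 / (8 * B ^ 2) *
      ((∑ y, (∑ x, a y x * charge α η x) ^ 2) / (n : ℝ) ^ 2)) ≤ 2 := by
  have hnpos : (0 : ℝ) < n := by exact_mod_cast Nat.pos_of_ne_zero (NeZero.ne n)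
  have h := sum_exp_average_le (κ := ZMod n) (bernWeight_nonneg_of_mem he hα)
    (f := fun y η => e ^ 2 / (8 * B ^ 2) * ((∑ x, a y x * charge α η x) ^ 2 / n)) (D := 2)
    (fun y => by
      have := sum_exp_linear_sq_le he hα hB (ha y)
      rwa [ZMod.card] at this)
  refine le_trans (le_of_eq ?_) h
  refine Finset.sum_congr rfl fun η _ => ?_
  congr 2
  rw [ZMod.card, ← Finset.mul_sum, ← Finset.sum_div]
  field_simp

lemma abs_spread_le (he : 0 < e) (hα : ∀ x, α x ∈ Icc e (1 - e)) (hn : 2 ≤ n) {b : ZMod n → ℝ}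
    {B : ℝ} (hb : ∀ x, |b x| ≤ B) (η : Config n) (y : ZMod n) :
    |spread α b η y| ≤ n * (B / e) := by
  have hB : 0 ≤ B := (abs_nonneg _).trans (hb 0)
  refine (Finset.abs_sum_le_sum_abs _ _).trans
    ((Finset.sum_le_card_nsmul _ _ (B / e) fun x _ => ?_).trans (by simp [ZMod.card]))
  rw [abs_mul, abs_mul]
  calc |spreadKernel (y - x)| * (|b x| * |charge α η x|) ≤ 1 * (B * (1 / e)) := by
        gcongr
        · exact abs_spreadKernel_le hn _
        · exact hb x
        · exact abs_charge_le he hα η x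
    _ = B / e := by ring

/-- The product of the two linear sums is split into squares, whose quotients by n are controlled by
`sum_exp_linear_sq_le`. The diagonal sum has n bounded terms, and 1 / (n − 1) ≤ 2 / n. -/
lemma abs_meanField_le (he : 0 < e) (hα : ∀ x, α x ∈ Icc e (1 - e)) (hn : 2 ≤ n)
    {b : ZMod n → ℝ} {B : ℝ} (hb : ∀ x, |b x| ≤ B) (η : Config n) :
    |meanField α b η| ≤ (∑ x, b x * charge α η x) ^ 2 / n + (∑ x, charge α η x) ^ 2 / n +
      2 * B / e ^ 2 := by
  have hn' : (2 : ℝ) ≤ n := by exact_mod_cast hn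
  have hnpos : (0 : ℝ) < n := by linarith
  have hB : 0 ≤ B := (abs_nonneg _).trans (hb 0)
  set X := ∑ x, b x * charge α η x
  set Y := ∑ x, charge α η x
  have h1 : |∑ x, b x * charge α η x ^ 2| ≤ n * (B / e ^ 2) := by
    refine (Finset.abs_sum_le_sum_abs _ _).trans
      ((Finset.sum_le_card_nsmul _ _ (B / e ^ 2) fun x _ => ?_).trans (by simp [ZMod.card]))
    rw [abs_mul, abs_pow]
    calc |b x| * |charge α η x| ^ 2 ≤ B * (1 / e) ^ 2 := by
          gcongr
          · exact hb x
          · exact abs_charge_le he hα η x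
      _ = B / e ^ 2 := by rw [one_div_pow]; ring
  have h2 : |X * Y| ≤ X ^ 2 / 2 + Y ^ 2 / 2 := by
    rw [abs_le]; constructor <;> nlinarith [sq_nonneg (X + Y), sq_nonneg (X - Y)]
  have h3 : |X * Y - ∑ x, b x * charge α η x ^ 2| ≤
      X ^ 2 / 2 + Y ^ 2 / 2 + n * (B / e ^ 2) := (abs_sub _ _).trans (add_le_add h2 h1)
  have h4 : 1 / ((n : ℝ) - 1) ≤ 2 / n := by
    rw [div_le_div_iff₀ (by linarith) hnpos]; linarith
  unfold meanField
  rw [abs_mul, abs_of_nonneg (by rw [one_div_nonneg]; linarith)]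
  calc _ ≤ 2 / n * (X ^ 2 / 2 + Y ^ 2 / 2 + n * (B / e ^ 2)) :=
        mul_le_mul h4 h3 (abs_nonneg _) (by positivity)
    _ = _ := by field_simp

/-- The part of `spread` at `y` coming from the sites before `y`. -/
def spreadBefore (α b : ZMod n → ℝ) (η : Config n) (y : ZMod n) : ℝ :=
  ∑ x, (if x.val < y.val then spreadKernel (y - x) * b x else 0) * charge α η x

/-- The part of `spread` at `y` coming from the sites after `y + 1`. -/
def spreadAfter (α b : ZMod n → ℝ) (η : Config n) (y : ZMod n) : ℝ :=
  ∑ x, (if y.val + 1 < x.val then spreadKernel (y - x) * b x else 0) * charge α η x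

/-- The sites y and y + 1, missing on the right, have weight zero in the kernel. The last bond is
excluded because its right end is the site 0, which comes first in the linear order. -/
lemma spread_eq (hn : 2 ≤ n) (b : ZMod n → ℝ) (η : Config n) {y : ZMod n} (hy : y + 1 ≠ 0) :
    spread α b η y = spreadBefore α b η y + spreadAfter α b η y := by
  unfold spread spreadBefore spreadAfter
  rw [← Finset.sum_add_distrib]
  refine Finset.sum_congr rfl fun x _ => ?_
  rcases lt_trichotomy x.val y.val with h | h | h
  · rw [if_pos h, if_neg (by omega)]; ring
  · rw [ZMod.val_injective n h]; simp [spreadKernel]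
  · rw [if_neg (by omega)]
    rcases Nat.lt_or_ge (y.val + 1) x.val with h' | h'
    · rw [if_pos h']; ring
    · have hx : x.val = (y + 1).val := by rw [val_add_one_of_ne hn hy]; omega
      rw [ZMod.val_injective n hx, show y - (y + 1) = -1 by ring, spreadKernel_neg_one hn]
      simp

/-- Two pieces of the cubic term which are martingales, and a bounded one. -/
lemma cubic_eq (hn : 2 ≤ n) (b : ZMod n → ℝ) (η : Config n) :
    cubic α b η = ∑ y, (if y + 1 = 0 then 0 else
        (α (y + 1) - α y) * spreadBefore α b η y * charge α η y) * charge α η (y + 1) +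
      ∑ y, (if y + 1 = 0 then 0 else
        (α (y + 1) - α y) * spreadAfter α b η y * charge α η (y + 1)) * charge α η y +
      ∑ y, (if y + 1 = 0 then
        (α (y + 1) - α y) * spread α b η y * (charge α η y * charge α η (y + 1)) else 0) := by
  unfold cubic
  rw [← Finset.sum_add_distrib, ← Finset.sum_add_distrib]
  refine Finset.sum_congr rfl fun y _ => ?_
  split_ifs with h
  · ring
  · rw [spread_eq hn b η h]; ring

lemma spreadBefore_congr (b : ZMod n → ℝ) {y : ZMod n} {η η' : Config n}
    (h : ∀ z : ZMod n, z.val ≤ y.val → η z = η' z) : spreadBefore α b η y = spreadBefore α b η' y := by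
  unfold spreadBefore
  refine Finset.sum_congr rfl fun x _ => ?_
  split_ifs with hx
  · unfold charge; rw [h x hx.le]
  · simp

lemma spreadAfter_congr (b : ZMod n → ℝ) {y : ZMod n} {η η' : Config n}
    (h : ∀ z : ZMod n, y.val < z.val → η z = η' z) : spreadAfter α b η y = spreadAfter α b η' y := by
  unfold spreadAfter
  refine Finset.sum_congr rfl fun x _ => ?_
  split_ifs with hx
  · unfold charge; rw [h x (by omega)]
  · simp

/-- Exponential moment of a sum of martingale increments with quadratic variation controlled by an
average of squares. -/
lemma sum_exp_abs_increments_le (he : 0 < e) (hα : ∀ x, α x ∈ Icc e (1 - e)) (hn : 2 ≤ n)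
    {κ B : ℝ} (hκ : 0 < κ) (hB : 0 < B) {a : ZMod n → ZMod n → ℝ} (ha : ∀ y x, |a y x| ≤ B)
    {A : ZMod n → Config n → ℝ} {c : Config n → ZMod n → ℝ}
    (hAle : ∀ y η, |A y η| ≤ κ / n * (1 / e) * |∑ x, a y x * charge α η x|)
    (hmart : ∀ s : ℝ, ∑ η, bernWeight α η *
      Real.exp (∑ y, ((s * A y η) * c η y - (s * A y η) ^ 2 / e ^ 2)) ≤ 1) :
    ∑ η, bernWeight α η * Real.exp (e ^ 3 / (8 * κ * B) * |∑ y, A y η * c η y|) ≤ 3 := by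
  have hnpos : (0 : ℝ) < n := by exact_mod_cast (by omega : 0 < n)
  set t := e ^ 3 / (8 * κ * B)
  have ht : 0 < t := by positivity
  have hw := bernWeight_nonneg_of_mem he hα
  have key := sum_exp_abs_le hw (X := fun η => t * ∑ y, A y η * c η y)
    (Q := fun η => ∑ y, (2 * t * A y η) ^ 2 / e ^ 2) ?_ ?_ ?_
  · refine le_trans (le_of_eq (Finset.sum_congr rfl fun η _ => ?_)) key
    rw [abs_mul, abs_of_pos ht]
  · refine le_trans (le_of_eq (Finset.sum_congr rfl fun η _ => ?_)) (hmart (2 * t))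
    congr 2
    rw [Finset.sum_sub_distrib, Finset.mul_sum, Finset.mul_sum]
    congr 1
    exact Finset.sum_congr rfl fun y _ => by ring
  · refine le_trans (le_of_eq (Finset.sum_congr rfl fun η _ => ?_)) (hmart (-(2 * t)))
    congr 2
    rw [Finset.sum_sub_distrib, Finset.mul_sum, Finset.mul_sum, ← Finset.sum_neg_distrib]
    congr 1
    · exact Finset.sum_congr rfl fun y _ => by ring
    · exact Finset.sum_congr rfl fun y _ => by ring
  -- The quadratic variation is an average of squares of linear functionals. The constant t is such
  -- that 4 t² κ² / e⁴ = e² / (16 B²), below the level allowed by `sum_exp_average_sq_le`.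
  · refine le_trans (sum_exp_mono hw fun η => ?_) (sum_exp_average_sq_le he hα hB ha)
    rw [Finset.sum_div, Finset.mul_sum]
    refine Finset.sum_le_sum fun y _ => ?_
    have h1 : A y η ^ 2 ≤ (κ / n * (1 / e)) ^ 2 * (∑ x, a y x * charge α η x) ^ 2 := by
      have := pow_le_pow_left₀ (abs_nonneg _) (hAle y η) 2
      rwa [mul_pow, sq_abs, sq_abs] at this
    calc (2 * t * A y η) ^ 2 / e ^ 2 = 4 * t ^ 2 / e ^ 2 * A y η ^ 2 := by ring
      _ ≤ 4 * t ^ 2 / e ^ 2 * ((κ / n * (1 / e)) ^ 2 * (∑ x, a y x * charge α η x) ^ 2) := by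
          gcongr
      _ = e ^ 2 / (16 * B ^ 2) * ((∑ x, a y x * charge α η x) ^ 2 / (n : ℝ) ^ 2) := by
          simp only [t]; field_simp; ring
      _ ≤ _ := by
          refine mul_le_mul_of_nonneg_right ?_ (by positivity)
          gcongr
          norm_num

end Moments

/-! ### Uniform exponential moments of the residual. -/

section ResidualMoments

variable {n : ℕ} [NeZero n] {α : ZMod n → ℝ} {e : ℝ}

/-- In increasing order of the sites, the charge at y + 1 is a martingale increment whose
coefficient involves only sites up to y. -/
lemma sum_exp_abs_cubicBefore_le (he : 0 < e) (hα : ∀ x, α x ∈ Icc e (1 - e)) (hn : 2 ≤ n)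
    {κ B : ℝ} (hκ : 0 < κ) (hB : 0 < B) {b : ZMod n → ℝ} (hb : ∀ x, |b x| ≤ B)
    (hd : ∀ x, |α (x + 1) - α x| ≤ κ / n) :
    ∑ η, bernWeight α η * Real.exp (e ^ 3 / (8 * κ * B) * |∑ y, (if y + 1 = 0 then 0 else
        (α (y + 1) - α y) * spreadBefore α b η y * charge α η y) * charge α η (y + 1)|) ≤ 3 := by
  refine sum_exp_abs_increments_le he hα hn hκ hB
    (a := fun y x => if x.val < y.val then spreadKernel (y - x) * b x else 0) (fun y x => ?_)
    (A := fun y η => if y + 1 = 0 then 0 else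
        (α (y + 1) - α y) * spreadBefore α b η y * charge α η y)
    (c := fun η y => charge α η (y + 1)) (fun y η => ?_) (fun s => ?_)
  · split_ifs
    · rw [abs_mul]
      calc _ ≤ 1 * B := mul_le_mul (abs_spreadKernel_le hn _) (hb x) (abs_nonneg _) zero_le_one
        _ = B := one_mul B
    · simpa using hB.le
  · split_ifs
    · rw [abs_zero]; positivity
    · rw [abs_mul, abs_mul]
      calc _ ≤ κ / n * |spreadBefore α b η y| * (1 / e) := by
            gcongr
            · exact hd y
            · exact abs_charge_le he hα η y
        _ = _ := by unfold spreadBefore; ring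
  · refine sum_exp_forward_le he hα hn _ (fun y η η' h => ?_) (fun y η h => ?_)
    · rw [spreadBefore_congr b h]
      simp only [charge, h y le_rfl]
    · simp [h]

/-- The mirror image: in decreasing order the charge at y is the increment, and its coefficient
involves only later sites. -/
lemma sum_exp_abs_cubicAfter_le (he : 0 < e) (hα : ∀ x, α x ∈ Icc e (1 - e)) (hn : 2 ≤ n)
    {κ B : ℝ} (hκ : 0 < κ) (hB : 0 < B) {b : ZMod n → ℝ} (hb : ∀ x, |b x| ≤ B)
    (hd : ∀ x, |α (x + 1) - α x| ≤ κ / n) :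
    ∑ η, bernWeight α η * Real.exp (e ^ 3 / (8 * κ * B) * |∑ y, (if y + 1 = 0 then 0 else
        (α (y + 1) - α y) * spreadAfter α b η y * charge α η (y + 1)) * charge α η y|) ≤ 3 := by
  refine sum_exp_abs_increments_le he hα hn hκ hB
    (a := fun y x => if y.val + 1 < x.val then spreadKernel (y - x) * b x else 0) (fun y x => ?_)
    (A := fun y η => if y + 1 = 0 then 0 else
        (α (y + 1) - α y) * spreadAfter α b η y * charge α η (y + 1))
    (c := fun η y => charge α η y) (fun y η => ?_) (fun s => ?_)
  · split_ifs
    · rw [abs_mul]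
      calc _ ≤ 1 * B := mul_le_mul (abs_spreadKernel_le hn _) (hb x) (abs_nonneg _) zero_le_one
        _ = B := one_mul B
    · simpa using hB.le
  · split_ifs
    · rw [abs_zero]; positivity
    · rw [abs_mul, abs_mul]
      calc _ ≤ κ / n * |spreadAfter α b η y| * (1 / e) := by
            gcongr
            · exact hd y
            · exact abs_charge_le he hα η (y + 1)
        _ = _ := by unfold spreadAfter; ring
  · refine sum_exp_reverse_le he hα _ (fun y η η' h => ?_)
    split_ifs with hy
    · rfl
    · rw [spreadAfter_congr b h]
      simp only [charge, h (y + 1) (by rw [val_add_one_of_ne hn hy]; omega)]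

/-- The bond from the last site to 0 fits neither order. It is a single term, and it is bounded
because the factor κ / n compensates the size n of `spread`. -/
lemma abs_cubic_le (he : 0 < e) (hα : ∀ x, α x ∈ Icc e (1 - e)) (hn : 2 ≤ n)
    {κ B : ℝ} {b : ZMod n → ℝ} (hb : ∀ x, |b x| ≤ B) (hd : ∀ x, |α (x + 1) - α x| ≤ κ / n)
    (η : Config n) :
    |cubic α b η| ≤ |∑ y, (if y + 1 = 0 then 0 else
        (α (y + 1) - α y) * spreadBefore α b η y * charge α η y) * charge α η (y + 1)| +
      |∑ y, (if y + 1 = 0 then 0 else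
        (α (y + 1) - α y) * spreadAfter α b η y * charge α η (y + 1)) * charge α η y| +
      κ * B / e ^ 3 := by
  have hnpos : (0 : ℝ) < n := by exact_mod_cast (by omega : 0 < n)
  rw [cubic_eq hn]
  refine (abs_add_le _ _).trans (add_le_add (abs_add_le _ _) ?_)
  have h0 : ∀ y : ZMod n, y + 1 = 0 ↔ y = -1 := fun y => eq_neg_iff_add_eq_zero.symm
  simp only [h0, Finset.sum_ite_eq', Finset.mem_univ, if_true]
  have hκ : 0 ≤ κ / n := (abs_nonneg _).trans (hd 0)
  have hB : 0 ≤ B := (abs_nonneg _).trans (hb 0)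
  rw [abs_mul, abs_mul, abs_mul]
  calc _ ≤ κ / n * (n * (B / e)) * (1 / e * (1 / e)) := by
        gcongr
        · exact hd _
        · exact abs_spread_le he hα hn hb η _
        · exact abs_charge_le he hα η _
        · exact abs_charge_le he hα η _
    _ = _ := by field_simp

/-- Gaussian moments of a quadratic form in neighbouring charges. -/
lemma sum_exp_neighbour_sq_le (he : 0 < e) (hα : ∀ x, α x ∈ Icc e (1 - e)) (hn : 2 ≤ n)
    {κ D : ℝ} (hκ : 0 < κ) (hD : 0 < D) (hd : ∀ x, |α (x + 1) - α x| ≤ κ / n)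
    {θ : ZMod n → ℝ} (hθ0 : ∀ y, y + 1 = 0 → θ y = 0) (hθ : (∑ x, θ x ^ 2) / (n : ℝ) ^ 2 ≤ D) :
    ∑ η, bernWeight α η * Real.exp (e ^ 4 / (8 * D * κ ^ 2) *
      (∑ y, θ y * (α (y + 1) - α y) * (charge α η y * charge α η (y + 1))) ^ 2) ≤ 2 := by
  have hnpos : (0 : ℝ) < n := by exact_mod_cast (by omega : 0 < n)
  have hw := bernWeight_nonneg_of_mem he hα
  have h := sum_exp_sq_le (k := bernWeight α)
    (Y := fun η => ∑ y, θ y * (α (y + 1) - α y) * (charge α η y * charge α η (y + 1)))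
    (σ := D * κ ^ 2 / e ^ 4) hw (by positivity) (fun γ => ?_)
  · refine le_trans (le_of_eq (Finset.sum_congr rfl fun η _ => ?_)) h
    congr 2
    field_simp
  · have hm := sum_exp_forward_le he hα hn
      (fun y η => γ * θ y * (α (y + 1) - α y) * charge α η y)
      (fun y η η' hz => by simp only [charge, hz y le_rfl]) (fun y η hy => by simp [hθ0 y hy])
    -- Here the compensator has a deterministic bound: the squared gradient of α supplies the factor
    -- n⁻² of `hθ`. The sum is therefore sub-Gaussian with a constant of order D.
    have hq : ∀ η : Config n, ∑ y, (γ * θ y * (α (y + 1) - α y) * charge α η y) ^ 2 / e ^ 2 ≤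
        D * κ ^ 2 / e ^ 4 * γ ^ 2 := by
      intro η
      calc _ ≤ ∑ y, γ ^ 2 * κ ^ 2 / e ^ 4 / (n : ℝ) ^ 2 * θ y ^ 2 := by
            refine Finset.sum_le_sum fun y _ => ?_
            have h1 : (α (y + 1) - α y) ^ 2 ≤ (κ / n) ^ 2 := by
              rw [← sq_abs]; exact pow_le_pow_left₀ (abs_nonneg _) (hd y) 2
            have h2 : charge α η y ^ 2 ≤ (1 / e) ^ 2 := by
              rw [← sq_abs]; exact pow_le_pow_left₀ (abs_nonneg _) (abs_charge_le he hα η y) 2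
            calc _ = γ ^ 2 * θ y ^ 2 * ((α (y + 1) - α y) ^ 2 * charge α η y ^ 2) / e ^ 2 := by
                  ring
              _ ≤ γ ^ 2 * θ y ^ 2 * ((κ / n) ^ 2 * (1 / e) ^ 2) / e ^ 2 := by gcongr
              _ = _ := by field_simp
        _ = γ ^ 2 * κ ^ 2 / e ^ 4 * ((∑ y, θ y ^ 2) / (n : ℝ) ^ 2) := by
            rw [← Finset.mul_sum]; ring
        _ ≤ γ ^ 2 * κ ^ 2 / e ^ 4 * D := by gcongr
        _ = _ := by ring
    have hle : ∀ η : Config n, Real.exp (γ * ∑ y, θ y * (α (y + 1) - α y) *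
        (charge α η y * charge α η (y + 1))) ≤ Real.exp (D * κ ^ 2 / e ^ 4 * γ ^ 2) *
        Real.exp (∑ y, (γ * θ y * (α (y + 1) - α y) * charge α η y * charge α η (y + 1) -
          (γ * θ y * (α (y + 1) - α y) * charge α η y) ^ 2 / e ^ 2)) := by
      intro η
      rw [← Real.exp_add, Finset.sum_sub_distrib]
      refine Real.exp_le_exp.2 ?_
      have : γ * ∑ y, θ y * (α (y + 1) - α y) * (charge α η y * charge α η (y + 1)) =
          ∑ y, γ * θ y * (α (y + 1) - α y) * charge α η y * charge α η (y + 1) := by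
        rw [Finset.mul_sum]; exact Finset.sum_congr rfl fun y _ => by ring
      linarith [hq η]
    calc _ ≤ ∑ η, bernWeight α η * (Real.exp (D * κ ^ 2 / e ^ 4 * γ ^ 2) *
        Real.exp (∑ y, (γ * θ y * (α (y + 1) - α y) * charge α η y * charge α η (y + 1) -
          (γ * θ y * (α (y + 1) - α y) * charge α η y) ^ 2 / e ^ 2))) :=
          Finset.sum_le_sum fun η _ => mul_le_mul_of_nonneg_left (hle η) (hw η)
      _ = Real.exp (D * κ ^ 2 / e ^ 4 * γ ^ 2) * ∑ η, bernWeight α η *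
        Real.exp (∑ y, (γ * θ y * (α (y + 1) - α y) * charge α η y * charge α η (y + 1) -
          (γ * θ y * (α (y + 1) - α y) * charge α η y) ^ 2 / e ^ 2)) := by
          rw [Finset.mul_sum]; exact Finset.sum_congr rfl fun η _ => by ring
      _ ≤ _ := mul_le_of_le_one_right (Real.exp_pos _).le hm

/-- Passing from plain to corrected gradients costs a quadratic form in neighbouring charges. The
other error is at most √ε, just what the division by ε tolerates. -/
lemma sq_sub_sum_bondGrad_le {ε : ℝ} (hε : 0 < ε) {θ : ZMod n → ℝ} {I : Config n → ℝ}
    {η : Config n} (hI : |I η - ∑ y, θ y * (charge α η (y + 1) - charge α η y)| ≤ √ε) :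
    (I η - ∑ y, θ y * bondGrad α η y) ^ 2 / ε ≤ 2 + 2 / ε *
      (∑ y, θ y * (α (y + 1) - α y) * (charge α η y * charge α η (y + 1))) ^ 2 := by
  set X := ∑ y, θ y * (α (y + 1) - α y) * (charge α η y * charge α η (y + 1))
  set Y := ∑ y, θ y * (charge α η (y + 1) - charge α η y)
  have h1 : ∑ y, θ y * bondGrad α η y = Y + X := by
    simp only [X, Y]
    rw [← Finset.sum_add_distrib]
    exact Finset.sum_congr rfl fun y _ => by unfold bondGrad; ring
  have h2 : (I η - Y) ^ 2 ≤ ε := by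
    have := pow_le_pow_left₀ (abs_nonneg _) hI 2
    rwa [sq_abs, Real.sq_sqrt hε.le] at this
  rw [h1, div_le_iff₀ hε]
  have : (2 + 2 / ε * X ^ 2) * ε = 2 * ε + 2 * X ^ 2 := by field_simp
  rw [this]
  nlinarith [sq_nonneg (I η - Y + X)]

/-- Exponential moments of the residual, uniformly in the size of the torus. -/
lemma exists_sum_exp_residual_le {e κ B D : ℝ} (he : 0 < e) (hκ : 0 < κ) (hB : 1 ≤ B)
    (hD : 0 < D) : ∃ c K : ℝ, 0 < c ∧ 0 ≤ K ∧ ∀ (n : ℕ) [NeZero n], 2 ≤ n →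
      ∀ (α b θ : ZMod n → ℝ) (I : Config n → ℝ) (ε : ℝ), 0 < ε →
      (∀ x, α x ∈ Icc e (1 - e)) → (∀ x, |α (x + 1) - α x| ≤ κ / n) → (∀ x, |b x| ≤ B) →
      (∀ y, y + 1 = 0 → θ y = 0) → (∑ x, θ x ^ 2) / (n : ℝ) ^ 2 ≤ D * ε →
      (∀ η, |I η - ∑ y, θ y * (charge α η (y + 1) - charge α η y)| ≤ √ε) →
      ∑ η, bernWeight α η * Real.exp (c * residual e ε α b θ I η) ≤ Real.exp K := by
  have hB0 : 0 < B := by linarith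
  set K1 := 2 * B / e ^ 2 + κ * B / e ^ 3 + 3 / (2 * e ^ 4) + 2
  -- Six unbounded pieces of the residual are averaged by Jensen's inequality, so each must allow
  -- the constant 6 c. In the last piece the factor 1 / ε meets a variance of order D ε, and c is
  -- independent of ε.
  set c := min (min (e ^ 2 / (8 * B ^ 2) / 6) (e ^ 3 / (8 * κ * B) / 6))
    (min (e ^ 2 / (8 * B ^ 2) * e ^ 4 / 9) (e ^ 4 / (96 * D * κ ^ 2)))
  have hc : 0 < c := by positivity
  have c1 : 6 * c ≤ e ^ 2 / (8 * B ^ 2) := by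
    have : c ≤ e ^ 2 / (8 * B ^ 2) / 6 := (min_le_left _ _).trans (min_le_left _ _)
    linarith
  have c2 : 6 * c ≤ e ^ 3 / (8 * κ * B) := by
    have : c ≤ e ^ 3 / (8 * κ * B) / 6 := (min_le_left _ _).trans (min_le_right _ _)
    linarith
  have c3 : 6 * c * (3 / (2 * e ^ 4)) ≤ e ^ 2 / (8 * B ^ 2) := by
    have : c ≤ e ^ 2 / (8 * B ^ 2) * e ^ 4 / 9 := (min_le_right _ _).trans (min_le_left _ _)
    calc _ ≤ 6 * (e ^ 2 / (8 * B ^ 2) * e ^ 4 / 9) * (3 / (2 * e ^ 4)) := by gcongr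
      _ = _ := by field_simp; norm_num
  have c4 : c ≤ e ^ 4 / (96 * D * κ ^ 2) := (min_le_right _ _).trans (min_le_right _ _)
  have hK1 : 0 < K1 := by positivity
  refine ⟨c, c * K1 + 2, hc, by positivity, ?_⟩
  intro n _ hn α b θ I ε hε hα hd hb hθ0 hθ hI
  have hnpos : (0 : ℝ) < n := by exact_mod_cast (by omega : 0 < n)
  have hw := bernWeight_nonneg_of_mem he hα
  set Zb : Config n → ℝ := fun η => ∑ y, (if y + 1 = 0 then 0 else
        (α (y + 1) - α y) * spreadBefore α b η y * charge α η y) * charge α η (y + 1)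
  set Za : Config n → ℝ := fun η => ∑ y, (if y + 1 = 0 then 0 else
        (α (y + 1) - α y) * spreadAfter α b η y * charge α η (y + 1)) * charge α η y
  set X : Config n → ℝ := fun η =>
    ∑ y, θ y * (α (y + 1) - α y) * (charge α η y * charge α η (y + 1))
  let f : Fin 6 → Config n → ℝ := ![
    fun η => 6 * c * ((∑ x, b x * charge α η x) ^ 2 / n),
    fun η => 6 * c * ((∑ x, charge α η x) ^ 2 / n),
    fun η => 6 * c * |Zb η|,
    fun η => 6 * c * |Za η|,
    fun η => 6 * c * (3 / (2 * e ^ 4) * ((∑ y, spread α b η y ^ 2) / (n : ℝ) ^ 2)),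
    fun η => 6 * c * (2 / ε * X η ^ 2)]
  have hlin : ∀ a : ZMod n → ℝ, (∀ x, |a x| ≤ B) → ∑ η, bernWeight α η *
      Real.exp (6 * c * ((∑ x, a x * charge α η x) ^ 2 / n)) ≤ 3 := by
    intro a ha
    have := sum_exp_linear_sq_le he hα hB0 ha
    rw [ZMod.card] at this
    refine (sum_exp_mono hw fun η => ?_).trans (this.trans (by norm_num))
    exact mul_le_mul_of_nonneg_right c1 (by positivity)
  have hf : ∀ k, ∑ η, bernWeight α η * Real.exp (f k η) ≤ 3 := by
    intro k
    fin_cases k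
    · exact hlin b hb
    -- B ≥ 1 is needed here, the total charge having coefficients 1.
    · simpa [f] using hlin (fun _ => 1) (fun _ => by simpa using hB)
    · refine (sum_exp_mono hw fun η => ?_).trans
        (sum_exp_abs_cubicBefore_le he hα hn hκ hB0 hb hd)
      exact mul_le_mul_of_nonneg_right c2 (abs_nonneg _)
    · refine (sum_exp_mono hw fun η => ?_).trans
        (sum_exp_abs_cubicAfter_le he hα hn hκ hB0 hb hd)
      exact mul_le_mul_of_nonneg_right c2 (abs_nonneg _)
    · refine (sum_exp_mono hw fun η => ?_).trans ((sum_exp_average_sq_le he hα hB0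
        (a := fun y x => spreadKernel (y - x) * b x) (fun y x => ?_)).trans (by norm_num))
      · show 6 * c * (3 / (2 * e ^ 4) * ((∑ y, spread α b η y ^ 2) / (n : ℝ) ^ 2)) ≤ _
        rw [← mul_assoc]
        refine mul_le_mul c3 (le_of_eq ?_) (by positivity) (by positivity)
        congr 1
        refine Finset.sum_congr rfl fun y _ => ?_
        congr 1
        exact Finset.sum_congr rfl fun x _ => by ring
      · rw [abs_mul]
        calc _ ≤ 1 * B := mul_le_mul (abs_spreadKernel_le hn _) (hb x) (abs_nonneg _) zero_le_one
          _ = B := one_mul B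
    · refine (sum_exp_mono hw fun η => ?_).trans ((sum_exp_neighbour_sq_le he hα hn hκ
        (by positivity : 0 < D * ε) hd hθ0 hθ).trans (by norm_num))
      show 6 * c * (2 / ε * X η ^ 2) ≤ _
      rw [← mul_assoc]
      refine mul_le_mul_of_nonneg_right ?_ (sq_nonneg _)
      calc _ ≤ 6 * (e ^ 4 / (96 * D * κ ^ 2)) * (2 / ε) := by gcongr
        _ = _ := by field_simp; norm_num
  have havg := sum_exp_average_le hw hf
  have hpt : ∀ η, c * residual e ε α b θ I η ≤
      c * K1 + (∑ k, f k η) / Fintype.card (Fin 6) := by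
    intro η
    have h1 := abs_meanField_le he hα hn hb η
    have h2 := abs_cubic_le he hα hn hb hd η
    have h3 := sq_sub_sum_bondGrad_le hε (hI η)
    have hsum : (∑ k, f k η) / Fintype.card (Fin 6) = c * ((∑ x, b x * charge α η x) ^ 2 / n +
        (∑ x, charge α η x) ^ 2 / n + |Zb η| + |Za η| +
        3 / (2 * e ^ 4) * ((∑ y, spread α b η y ^ 2) / (n : ℝ) ^ 2) + 2 / ε * X η ^ 2) := by
      simp only [Fin.sum_univ_six, Fintype.card_fin]
      simp [f]
      ring
    rw [hsum, ← mul_add]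
    refine mul_le_mul_of_nonneg_left ?_ hc.le
    unfold residual
    rw [mul_add (3 / (2 * e ^ 4))]
    simp only [K1]
    linarith
  have hexp : (3 : ℝ) ≤ Real.exp 2 := by
    have := Real.add_one_le_exp (2 : ℝ)
    linarith
  calc _ ≤ ∑ η, bernWeight α η * Real.exp (c * K1 + (∑ k, f k η) / Fintype.card (Fin 6)) :=
        sum_exp_mono hw hpt
    _ = Real.exp (c * K1) *
        ∑ η, bernWeight α η * Real.exp ((∑ k, f k η) / Fintype.card (Fin 6)) := by
        rw [Finset.mul_sum]
        exact Finset.sum_congr rfl fun η _ => by rw [Real.exp_add]; ring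
    _ ≤ Real.exp (c * K1) * Real.exp 2 :=
        mul_le_mul_of_nonneg_left (havg.trans hexp) (Real.exp_pos _).le
    _ = _ := (Real.exp_add _ _).symm

end ResidualMoments

/-- A bound on the slopes of all discretizations is a bound on the derivative. -/
lemma abs_deriv_le_of_slope_le {g : ℝ → ℝ} (hg : ContDiff ℝ 1 g) {κ : ℝ}
    (h : ∀ n : ℕ, 0 < n → ∀ x : ℤ, n * |g (((x : ℝ) + 1) / n) - g ((x : ℝ) / n)| ≤ κ) (u : ℝ) :
    |deriv g u| ≤ κ := by
  -- In the cell of length 1 / (k + 1) containing u, the mean value theorem gives a point ξ where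
  -- the derivative equals the slope; ξ tends to u and the derivative is continuous.
  have hex : ∀ k : ℕ, ∃ ξ, |ξ - u| ≤ 1 / ((k : ℝ) + 1) ∧ |deriv g ξ| ≤ κ := by
    intro k
    have hn : (0 : ℝ) < (k : ℝ) + 1 := by positivity
    set x : ℤ := ⌊u * ((k : ℝ) + 1)⌋
    have hx1 : (x : ℝ) ≤ u * ((k : ℝ) + 1) := Int.floor_le _
    have hx2 : u * ((k : ℝ) + 1) < x + 1 := Int.lt_floor_add_one _
    have hab : (x : ℝ) / ((k : ℝ) + 1) < ((x : ℝ) + 1) / ((k : ℝ) + 1) := by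
      gcongr; linarith
    obtain ⟨ξ, hξ, hd⟩ := exists_deriv_eq_slope g hab hg.continuous.continuousOn
      (hg.differentiable one_ne_zero).differentiableOn
    have h1 : (x : ℝ) / ((k : ℝ) + 1) ≤ u := by rw [div_le_iff₀ hn]; exact hx1
    have h2 : u ≤ ((x : ℝ) + 1) / ((k : ℝ) + 1) := by rw [le_div_iff₀ hn]; exact hx2.le
    have h3 : ((x : ℝ) + 1) / ((k : ℝ) + 1) - (x : ℝ) / ((k : ℝ) + 1) = 1 / ((k : ℝ) + 1) := by
      ring
    refine ⟨ξ, ?_, ?_⟩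
    · rw [abs_le]; constructor <;> linarith [hξ.1, hξ.2]
    · have := h (k + 1) (Nat.succ_pos k) x
      push_cast at this
      rw [hd, h3, abs_div, abs_of_pos (by positivity : 0 < 1 / ((k : ℝ) + 1)), div_div_eq_mul_div,
        div_one, mul_comm]
      exact this
  choose ξ hξ1 hξ2 using hex
  have hlim : Tendsto ξ atTop (𝓝 u) := by
    rw [tendsto_iff_dist_tendsto_zero]
    exact squeeze_zero (fun _ => dist_nonneg) (fun k => by rw [Real.dist_eq]; exact hξ1 k)
      tendsto_one_div_add_atTop_nhds_zero_nat
  have hc : Continuous fun v => |deriv g v| := (hg.continuous_deriv le_rfl).abs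
  exact le_of_tendsto' ((hc.tendsto u).comp hlim) hξ2

lemma abs_sub_le_of_abs_deriv_le {g : ℝ → ℝ} {s : Set ℝ} (hs : Convex ℝ s)
    (hg : Differentiable ℝ g) {κ : ℝ} (h : ∀ u ∈ s, |deriv g u| ≤ κ) {u v : ℝ} (hu : u ∈ s)
    (hv : v ∈ s) : |g v - g u| ≤ κ * |v - u| :=
  hs.norm_image_sub_le_of_norm_deriv_le (fun x _ => hg x) h hu hv

lemma average_mem_Icc {n : ℕ} (hn : 0 < n) {g : ℝ → ℝ} (hg : Continuous g) {a l h : ℝ}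
    (hgm : ∀ u ∈ Icc a (a + 1 / n), g u ∈ Icc l h) :
    (n : ℝ) * ∫ u in a..a + 1 / n, g u ∈ Icc l h := by
  have hnpos : (0 : ℝ) < n := by exact_mod_cast hn
  have hab : a ≤ a + 1 / n := by simp
  have hc : ∀ c : ℝ, (n : ℝ) * ∫ _ in a..a + 1 / n, c = c := by
    intro c; rw [intervalIntegral.integral_const, smul_eq_mul]; field_simp; ring
  constructor
  · rw [← hc l]
    exact mul_le_mul_of_nonneg_left (intervalIntegral.integral_mono_on hab
      (by simp) (hg.intervalIntegrable _ _) fun u hu => (hgm u hu).1) hnpos.le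
  · rw [← hc h]
    exact mul_le_mul_of_nonneg_left (intervalIntegral.integral_mono_on hab
      (hg.intervalIntegrable _ _) (by simp) fun u hu => (hgm u hu).2) hnpos.le

lemma abs_average_sub_le {n : ℕ} (hn : 0 < n) {g : ℝ → ℝ} (hg : Continuous g) {a c d : ℝ}
    (hgm : ∀ u ∈ Icc a (a + 1 / n), |g u - c| ≤ d) :
    |(n : ℝ) * (∫ u in a..a + 1 / n, g u) - c| ≤ d := by
  have := average_mem_Icc hn hg (l := c - d) (h := c + d) fun u hu => by
    have := abs_le.1 (hgm u hu); constructor <;> linarith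
  rw [abs_le]; constructor <;> linarith [this.1, this.2]

lemma pos_mem_Ico {n : ℕ} [NeZero n] (x : ZMod n) : pos x ∈ Ico (0 : ℝ) 1 := by
  have hnpos : (0 : ℝ) < n := by exact_mod_cast Nat.pos_of_ne_zero (NeZero.ne n)
  have : ((x.val : ℕ) : ℝ) < n := by exact_mod_cast ZMod.val_lt x
  exact ⟨by unfold pos; positivity, by unfold pos; rwa [div_lt_one hnpos]⟩

/-- Evaluation of a periodic function at neighbouring points of the discrete torus. -/
lemma eval_pos_add_one {n : ℕ} [NeZero n] (hn : 2 ≤ n) {g : ℝ → ℝ} (hg : Function.Periodic g 1)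
    (x : ZMod n) (v : ℝ) : g (pos (x + 1) + v) = g (pos x + 1 / n + v) := by
  have hnpos : (0 : ℝ) < n := by exact_mod_cast Nat.pos_of_ne_zero (NeZero.ne n)
  -- At the last site x + 1 wraps around to 0 while pos x + 1 / n equals 1; periodicity identifies
  -- the two.
  by_cases hx : x + 1 = 0
  · obtain ⟨k, rfl⟩ : ∃ k, n = k + 1 := ⟨n - 1, by omega⟩
    have hx' : x = -1 := eq_neg_of_add_eq_zero_left hx
    have h1 : pos x + 1 / ((k + 1 : ℕ) : ℝ) = 1 := by
      rw [hx', pos, ZMod.val_neg_one, ← add_div]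
      push_cast
      exact div_self (by positivity)
    rw [hx, h1, show pos (0 : ZMod (k + 1)) = 0 by simp [pos], zero_add, add_comm, hg]
  · unfold pos
    rw [val_add_one_of_ne hn hx]
    push_cast
    rw [add_div]

/-! ### The hydrodynamic profile, its flux and its cell averages. -/

section Hydrodynamics

variable {T : ℝ} {F ρ₀ : ℝ → ℝ} {ρ : ℝ → ℝ → ℝ}

/-- The macroscopic flux `∂_u ρ - 2 ρ (1 - ρ) F`. -/
def flux (F : ℝ → ℝ) (ρ : ℝ → ℝ → ℝ) (t u : ℝ) : ℝ :=
  deriv (ρ t) u - 2 * (ρ t u * (1 - ρ t u) * F u)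

/-- The mean of the profile `ρ t` over the cell `[x/n, (x+1)/n]`. -/
def cellAverage (n : ℕ) (ρ : ℝ → ℝ → ℝ) (t : ℝ) (x : ZMod n) : ℝ :=
  n * ∫ u in pos x..pos x + 1 / n, ρ t u

lemma deriv_profile_mul (hF : ContDiff ℝ 1 F) {g : ℝ → ℝ} (hg : Differentiable ℝ g) (u : ℝ) :
    HasDerivAt (fun v => g v * (1 - g v) * F v)
      ((deriv g u * (1 - g u) + g u * (-deriv g u)) * F u + g u * (1 - g u) * deriv F u) u := by
  have h1 := (hg u).hasDerivAt
  have h2 := ((hF.differentiable one_ne_zero) u).hasDerivAt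
  exact (h1.fun_mul (h1.const_sub 1)).fun_mul h2

/-- The equation is a conservation law: its right side is the space derivative of `flux`. -/
lemma IsHydrodynamicSolution.hasDerivAt_flux (hρ : IsHydrodynamicSolution T F ρ₀ ρ)
    (hF : ContDiff ℝ 1 F) {t : ℝ} (ht : t ∈ Icc 0 T) (u : ℝ) :
    HasDerivAt (flux F ρ t)
      (deriv (deriv (ρ t)) u - 2 * deriv (fun v => ρ t v * (1 - ρ t v) * F v) u) u := by
  have hc := hρ.contDiff t ht
  have hd : Differentiable ℝ (deriv (ρ t)) := by
    have : ContDiff ℝ (1 + 1) (ρ t) := by convert! hc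
    exact ((contDiff_succ_iff_deriv.1 this).2.2).differentiable one_ne_zero
  have h1 := deriv_profile_mul hF (hc.differentiable two_ne_zero) u
  rw [h1.deriv]
  exact (hd u).hasDerivAt.sub (h1.const_mul 2)

lemma IsHydrodynamicSolution.continuousOn_timeDeriv (hρ : IsHydrodynamicSolution T F ρ₀ ρ)
    (hF : ContDiff ℝ 1 F) :
    ContinuousOn (fun p : ℝ × ℝ => deriv (deriv (ρ p.1)) p.2 -
      2 * deriv (fun v => ρ p.1 v * (1 - ρ p.1 v) * F v) p.2) (Icc 0 T ×ˢ univ) := by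
  have h1 := hρ.continuousOn
  have h2 := hρ.continuousOn_deriv
  have h3 := hρ.continuousOn_deriv_deriv
  have h4 : Continuous fun p : ℝ × ℝ => F p.2 := hF.continuous.comp continuous_snd
  have h5 : Continuous fun p : ℝ × ℝ => deriv F p.2 :=
    (hF.continuous_deriv le_rfl).comp continuous_snd
  have h6 : ContinuousOn (fun p : ℝ × ℝ => deriv (deriv (ρ p.1)) p.2 -
      2 * ((deriv (ρ p.1) p.2 * (1 - ρ p.1 p.2) + ρ p.1 p.2 * (-deriv (ρ p.1) p.2)) * F p.2 +
        ρ p.1 p.2 * (1 - ρ p.1 p.2) * deriv F p.2)) (Icc 0 T ×ˢ univ) := by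
    have hs := continuousOn_const (c := (1 : ℝ)).sub h1
    exact h3.sub (continuousOn_const.mul ((((h2.mul hs).add (h1.mul h2.neg)).mul
      h4.continuousOn).add ((h1.mul hs).mul h5.continuousOn)))
  refine h6.congr fun p hp => ?_
  rw [(deriv_profile_mul hF ((hρ.contDiff p.1 hp.1).differentiable two_ne_zero) p.2).deriv]

/-- The conservation law in integral form, by differentiation under the integral and the fundamental
theorem of calculus. -/
lemma IsHydrodynamicSolution.hasDerivAt_integral (hρ : IsHydrodynamicSolution T F ρ₀ ρ)
    (hF : ContDiff ℝ 1 F) {t : ℝ} (ht : t ∈ Ioo 0 T) (a b : ℝ) :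
    HasDerivAt (fun r => ∫ u in a..b, ρ r u) (flux F ρ t b - flux F ρ t a) t := by
  set D : ℝ → ℝ → ℝ := fun r u => deriv (deriv (ρ r)) u -
    2 * deriv (fun v => ρ r v * (1 - ρ r v) * F v) u
  have hD : ContinuousOn (fun p : ℝ × ℝ => D p.1 p.2) (Icc 0 T ×ˢ univ) :=
    hρ.continuousOn_timeDeriv hF
  have htc : t ∈ Icc 0 T := Ioo_subset_Icc_self ht
  have hDt : Continuous (D t) := by
    rw [← continuousOn_univ]
    exact hD.comp (f := fun u => (t, u)) (by fun_prop) fun u _ => ⟨htc, mem_univ _⟩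
  obtain ⟨C, hC⟩ := ((isCompact_Icc (a := (0 : ℝ)) (b := T)).prod
    (isCompact_uIcc (a := a) (b := b))).exists_bound_of_continuousOn
    (hD.mono (prod_mono le_rfl (subset_univ _)))
  have hint : ∀ r ∈ Icc 0 T, Continuous (ρ r) := fun r hr => (hρ.contDiff r hr).continuous
  have h := (intervalIntegral.hasDerivAt_integral_of_dominated_loc_of_deriv_le (μ := volume)
    (F := ρ) (F' := D) (x₀ := t) (a := a) (b := b) (s := Ioo 0 T) (bound := fun _ => C)
    (Ioo_mem_nhds ht.1 ht.2)
    (by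
      filter_upwards [Ioo_mem_nhds ht.1 ht.2] with r hr
      exact (hint r (Ioo_subset_Icc_self hr)).aestronglyMeasurable)
    ((hint t htc).intervalIntegrable _ _) hDt.aestronglyMeasurable
    (Eventually.of_forall fun u hu r hr =>
      hC (r, u) ⟨Ioo_subset_Icc_self hr, uIoc_subset_uIcc hu⟩) (by simp)
    (Eventually.of_forall fun u _ r hr =>
      (hρ.equation r (Ioo_subset_Icc_self hr) u).hasDerivAt (Icc_mem_nhds hr.1 hr.2))).2
  rwa [intervalIntegral.integral_eq_sub_of_hasDerivAt
    (fun u _ => hρ.hasDerivAt_flux hF htc u) (hDt.intervalIntegrable _ _)] at h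

lemma IsHydrodynamicSolution.continuousOn_time (hρ : IsHydrodynamicSolution T F ρ₀ ρ) (u : ℝ) :
    ContinuousOn (fun r => ρ r u) (Icc 0 T) :=
  hρ.continuousOn.comp (f := fun r => (r, u)) (by fun_prop) fun _ hr => ⟨hr, mem_univ _⟩

lemma IsHydrodynamicSolution.continuousOn_flux (hρ : IsHydrodynamicSolution T F ρ₀ ρ) (u : ℝ) :
    ContinuousOn (fun r => flux F ρ r u) (Icc 0 T) := by
  have h1 := hρ.continuousOn_time u
  have h2 : ContinuousOn (fun r => deriv (ρ r) u) (Icc 0 T) :=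
    hρ.continuousOn_deriv.comp (f := fun r => (r, u)) (by fun_prop) fun _ hr => ⟨hr, mem_univ _⟩
  unfold flux
  fun_prop

lemma IsHydrodynamicSolution.continuousOn_integral (hρ : IsHydrodynamicSolution T F ρ₀ ρ)
    (a b : ℝ) : ContinuousOn (fun r => ∫ u in a..b, ρ r u) (Icc 0 T) := by
  obtain ⟨C, hC⟩ := ((isCompact_Icc (a := (0 : ℝ)) (b := T)).prod
    (isCompact_uIcc (a := a) (b := b))).exists_bound_of_continuousOn
    (hρ.continuousOn.mono (prod_mono le_rfl (subset_univ _)))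
  intro t ht
  refine intervalIntegral.continuousWithinAt_of_dominated_interval (bound := fun _ => C) ?_ ?_
    (by simp) (Eventually.of_forall fun u _ => hρ.continuousOn_time u t ht)
  · filter_upwards [self_mem_nhdsWithin] with r hr
    exact (hρ.contDiff r hr).continuous.aestronglyMeasurable
  · filter_upwards [self_mem_nhdsWithin] with r hr
    exact Eventually.of_forall fun u hu => hC (r, u) ⟨hr, uIoc_subset_uIcc hu⟩

lemma IsHydrodynamicSolution.continuousOn_cellAverage (hρ : IsHydrodynamicSolution T F ρ₀ ρ)
    {n : ℕ} (x : ZMod n) : ContinuousOn (fun r => cellAverage n ρ r x) (Icc 0 T) :=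
  (hρ.continuousOn_integral _ _).const_mul _

lemma IsHydrodynamicSolution.periodic_deriv (hρ : IsHydrodynamicSolution T F ρ₀ ρ) {t : ℝ}
    (ht : t ∈ Icc 0 T) : Function.Periodic (deriv (ρ t)) 1 := by
  intro u
  have : deriv (fun v => ρ t (v + 1)) u = deriv (ρ t) (u + 1) := deriv_comp_add_const _ _ _
  rw [← this]
  congr 1
  funext v
  exact hρ.periodic t ht v

lemma IsHydrodynamicSolution.periodic_flux (hρ : IsHydrodynamicSolution T F ρ₀ ρ)
    (hF : Function.Periodic F 1) {t : ℝ} (ht : t ∈ Icc 0 T) :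
    Function.Periodic (flux F ρ t) 1 := by
  intro u
  unfold flux
  rw [hρ.periodic_deriv ht, hρ.periodic t ht, hF]

variable {n : ℕ} [NeZero n]

/-- The reason for using cell averages rather than point values: their time derivative is exactly a
discrete divergence, so the entropy production can be summed by parts without error. -/
lemma IsHydrodynamicSolution.hasDerivAt_cellAverage (hρ : IsHydrodynamicSolution T F ρ₀ ρ)
    (hF : ContDiff ℝ 1 F) (hF_per : Function.Periodic F 1) (hn : 2 ≤ n) {t : ℝ}
    (ht : t ∈ Ioo 0 T) (x : ZMod n) :
    HasDerivAt (fun r => cellAverage n ρ r x)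
      (n * (flux F ρ t (pos (x + 1)) - flux F ρ t (pos x))) t := by
  have h := eval_pos_add_one hn (hρ.periodic_flux hF_per (Ioo_subset_Icc_self ht)) x 0
  rw [add_zero, add_zero] at h
  rw [h]
  exact (hρ.hasDerivAt_integral hF ht _ _).const_mul _

/-- Over a common cell, the difference of two neighbouring averages can be taken under the integral.
-/
lemma IsHydrodynamicSolution.cellAverage_add_one (hρ : IsHydrodynamicSolution T F ρ₀ ρ)
    (hn : 2 ≤ n) {t : ℝ} (ht : t ∈ Icc 0 T) (x : ZMod n) :
    cellAverage n ρ t (x + 1) = n * ∫ u in pos x..pos x + 1 / n, ρ t (u + 1 / n) := by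
  have h1 : ∀ y : ZMod n, ∫ u in pos y..pos y + 1 / n, ρ t u =
      ∫ v in (0 : ℝ)..1 / n, ρ t (pos y + v) := by
    intro y
    rw [intervalIntegral.integral_comp_add_left]; simp
  unfold cellAverage
  rw [h1 (x + 1)]
  have h2 : ∫ u in pos x..pos x + 1 / n, ρ t (u + 1 / n) =
      ∫ v in (0 : ℝ)..1 / n, ρ t (pos x + 1 / n + v) := by
    rw [intervalIntegral.integral_comp_add_right (fun u => ρ t u),
      intervalIntegral.integral_comp_add_left (fun u => ρ t u)]; simp
  rw [h2]
  congr 2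
  funext v
  exact eval_pos_add_one hn (hρ.periodic t ht) x v

lemma IsHydrodynamicSolution.cellAverage_mem (hρ : IsHydrodynamicSolution T F ρ₀ ρ) {t l h : ℝ}
    (ht : t ∈ Icc 0 T) (hb : ∀ u, ρ t u ∈ Icc l h) (x : ZMod n) :
    cellAverage n ρ t x ∈ Icc l h :=
  average_mem_Icc (Nat.pos_of_ne_zero (NeZero.ne n)) (hρ.contDiff t ht).continuous fun u _ => hb u

lemma IsHydrodynamicSolution.abs_cellAverage_sub_le (hρ : IsHydrodynamicSolution T F ρ₀ ρ)
    {t κ : ℝ} (ht : t ∈ Icc 0 T) (hκ : ∀ u, |deriv (ρ t) u| ≤ κ) (x : ZMod n) :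
    |cellAverage n ρ t x - ρ t (pos x)| ≤ κ / n := by
  have hκ0 : 0 ≤ κ := (abs_nonneg _).trans (hκ 0)
  refine abs_average_sub_le (Nat.pos_of_ne_zero (NeZero.ne n)) (hρ.contDiff t ht).continuous
    fun u hu => ?_
  refine (abs_sub_le_of_abs_deriv_le convex_univ
    ((hρ.contDiff t ht).differentiable two_ne_zero) (fun u _ => hκ u) (mem_univ (pos x))
    (mem_univ u)).trans ?_
  rw [div_eq_mul_one_div κ]
  refine mul_le_mul_of_nonneg_left ?_ hκ0
  rw [abs_le]; constructor <;> linarith [hu.1, hu.2]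

lemma IsHydrodynamicSolution.abs_cellAverage_add_one_sub_le
    (hρ : IsHydrodynamicSolution T F ρ₀ ρ) (hn : 2 ≤ n) {t κ : ℝ} (ht : t ∈ Icc 0 T)
    (hκ : ∀ u, |deriv (ρ t) u| ≤ κ) (x : ZMod n) :
    |cellAverage n ρ t (x + 1) - cellAverage n ρ t x| ≤ κ / n := by
  have hκ0 : 0 ≤ κ := (abs_nonneg _).trans (hκ 0)
  have hc := (hρ.contDiff t ht).continuous
  have hc' : Continuous fun u => ρ t (u + 1 / n) := by fun_prop
  rw [hρ.cellAverage_add_one hn ht, cellAverage, ← mul_sub,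
    ← intervalIntegral.integral_sub (hc'.intervalIntegrable _ _) (hc.intervalIntegrable _ _)]
  have := abs_average_sub_le (n := n) (a := pos x) (c := 0) (d := κ / n)
    (Nat.pos_of_ne_zero (NeZero.ne n)) (hc'.sub hc) fun u _ => by
      rw [sub_zero]
      refine (abs_sub_le_of_abs_deriv_le convex_univ
        ((hρ.contDiff t ht).differentiable two_ne_zero) (fun u _ => hκ u) (mem_univ u)
        (mem_univ (u + 1 / (n : ℝ)))).trans (le_of_eq ?_)
      rw [add_sub_cancel_left, abs_of_nonneg (by positivity), div_eq_mul_one_div κ]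
  rwa [sub_zero] at this

/-- The discrete gradient of the cell averages approximates the gradient of the profile. -/
lemma IsHydrodynamicSolution.abs_gradient_cellAverage_sub_le
    (hρ : IsHydrodynamicSolution T F ρ₀ ρ) (hn : 2 ≤ n) {t D : ℝ} (ht : t ∈ Icc 0 T)
    (hD : ∀ u ∈ Icc (0 : ℝ) 2, |deriv (deriv (ρ t)) u| ≤ D) (x : ZMod n) :
    |n * (cellAverage n ρ t (x + 1) - cellAverage n ρ t x) - deriv (ρ t) (pos x + 1 / n)| ≤
      D / n := by
  have hn' : (2 : ℝ) ≤ n := by exact_mod_cast hn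
  have hnpos : (0 : ℝ) < n := by linarith
  have hninv : (1 : ℝ) / n ≤ 1 / 2 := one_div_le_one_div_of_le two_pos hn'
  have hninv0 : (0 : ℝ) < 1 / n := by positivity
  have hp := pos_mem_Ico x
  have hD0 : 0 ≤ D := (abs_nonneg _).trans (hD 0 (by simp))
  have hC := hρ.contDiff t ht
  have hc := hC.continuous
  have hc' : Continuous fun u => ρ t (u + 1 / n) := by fun_prop
  have hd : Differentiable ℝ (deriv (ρ t)) := by
    have : ContDiff ℝ (1 + 1) (ρ t) := by convert! hC
    exact ((contDiff_succ_iff_deriv.1 this).2.2).differentiable one_ne_zero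
  have heq : n * (cellAverage n ρ t (x + 1) - cellAverage n ρ t x) =
      n * ∫ u in pos x..pos x + 1 / n, n * (ρ t (u + 1 / n) - ρ t u) := by
    rw [hρ.cellAverage_add_one hn ht, cellAverage, ← mul_sub,
      ← intervalIntegral.integral_sub (hc'.intervalIntegrable _ _) (hc.intervalIntegrable _ _),
      intervalIntegral.integral_const_mul]
  rw [heq]
  refine abs_average_sub_le (by omega) (by fun_prop) fun u hu => ?_
  obtain ⟨ξ, hξ, hs⟩ := exists_deriv_eq_slope (ρ t) (by linarith : u < u + 1 / n) hc.continuousOn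
    (hC.differentiable two_ne_zero).differentiableOn
  have : (n : ℝ) * (ρ t (u + 1 / n) - ρ t u) = deriv (ρ t) ξ := by
    rw [hs, add_sub_cancel_left]; field_simp
  rw [this]
  refine (abs_sub_le_of_abs_deriv_le (convex_Icc 0 2) hd hD (u := pos x + 1 / n) (v := ξ)
    ⟨by linarith [hp.1], by linarith [hp.2]⟩
    ⟨by linarith [hp.1, hξ.1, hu.1], by linarith [hp.2, hξ.2, hu.2]⟩).trans ?_
  rw [div_eq_mul_one_div D]
  refine mul_le_mul_of_nonneg_left ?_ hD0
  rw [abs_le]; constructor <;> linarith [hξ.1, hξ.2, hu.1, hu.2]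

end Hydrodynamics

/-- The symmetric part of the current gives the discrete gradient of α, the asymmetric part gives 2
r (1 − r) f. Replacing the gradient by d, α by r and f x by f (x + 1) costs O(1/n) each. -/
lemma abs_bondCurrent_error_le {n : ℕ} [NeZero n] {f α : ZMod n → ℝ} {x : ZMod n}
    {r d κ D L B : ℝ} (hα : ∀ y, α y ∈ Icc (0 : ℝ) 1) (hr : r ∈ Icc (0 : ℝ) 1)
    (h0 : |α x - r| ≤ 2 * κ / n) (h1 : |α (x + 1) - r| ≤ κ / n)
    (hd : |n * (α (x + 1) - α x) - d| ≤ D / n) (hf : |f x - f (x + 1)| ≤ L / n)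
    (hB : |f (x + 1)| ≤ B) :
    |-(n * bondCurrent f α x) - (d - 2 * (r * (1 - r) * f (x + 1)))| ≤
      (D + L + 6 * κ * B) / n := by
  have hnpos : (0 : ℝ) < n := by exact_mod_cast Nat.pos_of_ne_zero (NeZero.ne n)
  set a := α x
  set b := α (x + 1)
  have ha : a ∈ Icc (0 : ℝ) 1 := hα x
  have hb : b ∈ Icc (0 : ℝ) 1 := hα (x + 1)
  have hκ : 0 ≤ κ / n := (abs_nonneg _).trans h1
  have hB0 : 0 ≤ B := (abs_nonneg _).trans hB
  have e1 : -(n * bondCurrent f α x) - (d - 2 * (r * (1 - r) * f (x + 1))) =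
      (n * (b - a) - d) + -((f x - f (x + 1)) * (a * (1 - b))) +
        -(f (x + 1) * ((a - r) * (1 - b) + -(r * (b - r)) +
          ((b - r) * (1 - a) + -(r * (a - r))))) := by
    unfold bondCurrent
    field_simp
    ring
  have b1 : |a * (1 - b)| ≤ 1 := by
    rw [abs_le]; constructor <;> nlinarith [ha.1, ha.2, hb.1, hb.2]
  have hm : ∀ s t c : ℝ, |s| ≤ c → |t| ≤ 1 → |s * t| ≤ c := by
    intro s t c hs ht
    rw [abs_mul]
    calc _ ≤ c * 1 := mul_le_mul hs ht (abs_nonneg _) ((abs_nonneg _).trans hs)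
      _ = c := mul_one c
  have hunit : ∀ s ∈ Icc (0 : ℝ) 1, |s| ≤ 1 ∧ |1 - s| ≤ 1 := by
    intro s hs
    refine ⟨abs_le.2 ⟨by linarith [hs.1], hs.2⟩, abs_le.2 ⟨by linarith [hs.2], by linarith [hs.1]⟩⟩
  have b2 : |(a - r) * (1 - b) + -(r * (b - r)) + ((b - r) * (1 - a) + -(r * (a - r)))| ≤
      6 * κ / n := by
    have q1 := hm _ _ _ h0 (hunit b hb).2
    have q2 := hm _ _ _ h1 (hunit r hr).1
    have q3 := hm _ _ _ h1 (hunit a ha).2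
    have q4 := hm _ _ _ h0 (hunit r hr).1
    rw [mul_comm] at q2 q4
    have p := abs_add_le ((a - r) * (1 - b) + -(r * (b - r))) ((b - r) * (1 - a) + -(r * (a - r)))
    have p1 := abs_add_le ((a - r) * (1 - b)) (-(r * (b - r)))
    have p2 := abs_add_le ((b - r) * (1 - a)) (-(r * (a - r)))
    rw [abs_neg] at p1 p2
    have s1 : 2 * κ / n = 2 * (κ / n) := by ring
    have s2 : 6 * κ / n = 6 * (κ / n) := by ring
    linarith
  have b3 : |f (x + 1) * ((a - r) * (1 - b) + -(r * (b - r)) +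
      ((b - r) * (1 - a) + -(r * (a - r))))| ≤ B * (6 * κ / n) := by
    rw [abs_mul]; gcongr
  rw [e1]
  have p := abs_add_le ((n * (b - a) - d) + -((f x - f (x + 1)) * (a * (1 - b))))
    (-(f (x + 1) * ((a - r) * (1 - b) + -(r * (b - r)) + ((b - r) * (1 - a) + -(r * (a - r))))))
  have p1 := abs_add_le (n * (b - a) - d) (-((f x - f (x + 1)) * (a * (1 - b))))
  rw [abs_neg] at p p1
  have p2 := hm _ _ _ hf b1
  have s : (D + L + 6 * κ * B) / n = D / n + L / n + B * (6 * κ / n) := by ring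
  linarith

section Hydrodynamics

variable {T : ℝ} {F ρ₀ : ℝ → ℝ} {ρ : ℝ → ℝ → ℝ} {n : ℕ} [NeZero n]

/-- There are n errors of size O(1/n), so their squares add up to O(1/n); the bound 1 is merely
convenient. -/
lemma IsHydrodynamicSolution.sum_sq_current_error_le (hρ : IsHydrodynamicSolution T F ρ₀ ρ)
    (hF : ContDiff ℝ 1 F) (hF_per : Function.Periodic F 1) (hn : 2 ≤ n) {t κ D L B : ℝ}
    (ht : t ∈ Icc 0 T) (hb : ∀ u, ρ t u ∈ Icc (0 : ℝ) 1) (hκ : ∀ u, |deriv (ρ t) u| ≤ κ)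
    (hD : ∀ u ∈ Icc (0 : ℝ) 2, |deriv (deriv (ρ t)) u| ≤ D)
    (hL : ∀ u ∈ Icc (0 : ℝ) 2, |deriv F u| ≤ L) (hB : ∀ u ∈ Icc (0 : ℝ) 2, |F u| ≤ B)
    (hlarge : (D + L + 6 * κ * B) ^ 2 ≤ n) :
    ∑ x, (-(n * bondCurrent (fun x => F (pos x)) (cellAverage n ρ t) x) -
      flux F ρ t (pos (x + 1))) ^ 2 ≤ 1 := by
  have hn' : (2 : ℝ) ≤ n := by exact_mod_cast hn
  have hnpos : (0 : ℝ) < n := by linarith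
  have hninv : (1 : ℝ) / n ≤ 1 / 2 := one_div_le_one_div_of_le two_pos hn'
  have hninv0 : (0 : ℝ) < 1 / n := by positivity
  have hκ0 : 0 ≤ κ := (abs_nonneg _).trans (hκ 0)
  have hL0 : 0 ≤ L := (abs_nonneg _).trans (hL 0 (by simp))
  have key : ∀ x : ZMod n, |-(n * bondCurrent (fun x => F (pos x)) (cellAverage n ρ t) x) -
      flux F ρ t (pos (x + 1))| ≤ (D + L + 6 * κ * B) / n := by
    intro x
    have hp := pos_mem_Ico x
    have hp1 := pos_mem_Ico (x + 1)
    have ev : ∀ g : ℝ → ℝ, Function.Periodic g 1 → g (pos (x + 1)) = g (pos x + 1 / n) := by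
      intro g hg
      have := eval_pos_add_one hn hg x 0
      rwa [add_zero, add_zero] at this
    have hd := hρ.abs_gradient_cellAverage_sub_le hn ht hD x
    rw [← ev _ (hρ.periodic_deriv ht)] at hd
    refine abs_bondCurrent_error_le (f := fun x => F (pos x))
      (fun y => hρ.cellAverage_mem ht hb y) (hb (pos (x + 1)))
      ?_ (hρ.abs_cellAverage_sub_le ht hκ (x + 1)) hd ?_ (hB _ ⟨hp1.1, by linarith [hp1.2]⟩)
    · have h1 := hρ.abs_cellAverage_sub_le ht hκ x
      have h2 := abs_sub_le_of_abs_deriv_le convex_univ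
        ((hρ.contDiff t ht).differentiable two_ne_zero) (fun u _ => hκ u)
        (mem_univ (pos x + 1 / (n : ℝ))) (mem_univ (pos x))
      rw [ev _ (hρ.periodic t ht)]
      have h3 : |pos x - (pos x + 1 / (n : ℝ))| = 1 / n := by
        rw [sub_add_cancel_left, abs_neg, abs_of_pos hninv0]
      rw [h3] at h2
      have := abs_sub_le (cellAverage n ρ t x) (ρ t (pos x)) (ρ t (pos x + 1 / n))
      calc _ ≤ κ / n + κ * (1 / n) := this.trans (add_le_add h1 h2)
        _ = _ := by ring
    · rw [ev _ hF_per]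
      have h2 := abs_sub_le_of_abs_deriv_le (convex_Icc 0 2) (hF.differentiable one_ne_zero) hL
        (u := pos x + 1 / (n : ℝ)) (v := pos x) ⟨by linarith [hp.1], by linarith [hp.2]⟩
        ⟨hp.1, by linarith [hp.2]⟩
      have h3 : |pos x - (pos x + 1 / (n : ℝ))| = 1 / n := by
        rw [sub_add_cancel_left, abs_neg, abs_of_pos hninv0]
      rw [h3] at h2
      calc _ ≤ L * (1 / n) := h2
        _ = _ := by ring
  calc _ ≤ ∑ _ : ZMod n, ((D + L + 6 * κ * B) / n) ^ 2 := by
        refine Finset.sum_le_sum fun x _ => ?_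
        rw [← sq_abs]
        exact pow_le_pow_left₀ (abs_nonneg _) (key x) 2
    _ = (D + L + 6 * κ * B) ^ 2 / n := by
        rw [Finset.sum_const, Finset.card_univ, ZMod.card, nsmul_eq_mul]
        field_simp
    _ ≤ 1 := by rw [div_le_one hnpos]; exact hlarge

end Hydrodynamics

/-! ### Product weights with time-dependent parameters. -/

section Weights

variable {ι : Type*} [Fintype ι]

/-- The logarithmic derivative of the factor at x is α' x times the charge, which is why charges are
the natural variables. -/
lemma hasDerivAt_bernWeight [DecidableEq ι] {α : ℝ → ι → ℝ} {α' : ι → ℝ} {t : ℝ}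
    (h : ∀ x, HasDerivAt (fun r => α r x) (α' x) t) (h0 : ∀ x, 0 < α t x) (h1 : ∀ x, α t x < 1)
    (η : ι → Bool) :
    HasDerivAt (fun r => bernWeight (α r) η)
      (bernWeight (α t) η * ∑ x, α' x * charge (α t) η x) t := by
  have hx : ∀ x ∈ (Finset.univ : Finset ι), HasDerivAt
      (fun r => if η x then α r x else 1 - α r x) (if η x then α' x else -α' x) t := by
    intro x _
    split_ifs
    · exact h x
    · exact (h x).const_sub 1
  have := HasDerivAt.fun_finsetProd hx
  unfold bernWeight
  convert! this using 1
  rw [Finset.mul_sum]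
  refine Finset.sum_congr rfl fun x _ => ?_
  rw [← Finset.mul_prod_erase _ _ (Finset.mem_univ x), smul_eq_mul]
  have h0x := (h0 x).ne'
  have h1x : 1 - α t x ≠ 0 := (sub_pos.2 (h1 x)).ne'
  unfold charge
  split_ifs <;> field_simp

lemma continuousOn_bernWeight {α : ℝ → ι → ℝ} {s : Set ℝ}
    (h : ∀ x, ContinuousOn (fun r => α r x) s) (η : ι → Bool) :
    ContinuousOn (fun r => bernWeight (α r) η) s := by
  unfold bernWeight
  refine continuousOn_finsetProd _ fun x _ => ?_
  split_ifs
  · exact h x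
  · exact continuousOn_const.sub (h x)

omit [Fintype ι] in
lemma continuousOn_charge {α : ℝ → ι → ℝ} {s : Set ℝ} (h : ∀ x, ContinuousOn (fun r => α r x) s)
    (h0 : ∀ r ∈ s, ∀ x, 0 < α r x) (h1 : ∀ r ∈ s, ∀ x, α r x < 1) (η : ι → Bool) (x : ι) :
    ContinuousOn (fun r => charge (α r) η x) s := by
  unfold charge
  split_ifs
  · exact continuousOn_const.div (h x) fun r hr => (h0 r hr x).ne'
  · exact (continuousOn_const.div (continuousOn_const.sub (h x))
      fun r hr => (sub_pos.2 (h1 r hr x)).ne').neg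

lemma log_bernWeight {α : ι → ℝ} (h0 : ∀ x, 0 < α x) (h1 : ∀ x, α x < 1) (η : ι → Bool) :
    Real.log (bernWeight α η) = ∑ x, Real.log (if η x then α x else 1 - α x) := by
  refine Real.log_prod fun x _ => ?_
  split_ifs
  · exact (h0 x).ne'
  · exact (sub_pos.2 (h1 x)).ne'

/-- Each site contributes at most (a − b) / b. With d of order 1/n the total is bounded, so
exchanging ρ₀ for its cell averages costs O(1) in entropy. -/
lemma log_bernWeight_sub_le {α β : ι → ℝ} {e d : ℝ} (he : 0 < e)
    (hα : ∀ x, α x ∈ Icc e (1 - e)) (hβ : ∀ x, β x ∈ Icc e (1 - e))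
    (hd : ∀ x, |α x - β x| ≤ d) (η : ι → Bool) :
    Real.log (bernWeight α η) - Real.log (bernWeight β η) ≤ Fintype.card ι * (d / e) := by
  rw [log_bernWeight (fun x => he.trans_le (hα x).1) (fun x => by linarith [(hα x).2]),
    log_bernWeight (fun x => he.trans_le (hβ x).1) (fun x => by linarith [(hβ x).2]),
    ← Finset.sum_sub_distrib]
  have key : ∀ a b : ℝ, e ≤ a → e ≤ b → a - b ≤ d → 0 ≤ d →
      Real.log a - Real.log b ≤ d / e := by
    intro a b ha hb hab hd0
    have ha0 := he.trans_le ha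
    have hb0 := he.trans_le hb
    rw [← Real.log_div ha0.ne' hb0.ne']
    calc _ ≤ a / b - 1 := Real.log_le_sub_one_of_pos (by positivity)
      _ = (a - b) / b := by field_simp
      _ ≤ d / b := by gcongr
      _ ≤ d / e := by gcongr
  refine (Finset.sum_le_card_nsmul _ _ (d / e) fun x _ => ?_).trans (by simp)
  have hd0 : 0 ≤ d := (abs_nonneg _).trans (hd x)
  have h2 := abs_le.1 (hd x)
  split_ifs
  · exact key _ _ (hα x).1 (hβ x).1 h2.2 hd0
  · exact key _ _ (by linarith [(hα x).2]) (by linarith [(hβ x).2]) (by linarith [h2.1]) hd0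

end Weights

/-! ### Entropy of the initial law. -/

section Entropy

/-- Points of μ-mass zero contribute nothing to either side; at the others, absolute continuity
makes the density the quotient of the point masses. -/
lemma relEntropy_eq_toReal_klDiv {S : Type*} [Fintype S] [MeasurableSpace S]
    [MeasurableSingletonClass S] {μ ν : Measure S} [IsProbabilityMeasure μ]
    [IsProbabilityMeasure ν] (h : μ ≪ ν) :
    relEntropy (fun i => μ.real {i}) (fun i => ν.real {i}) =
      (InformationTheory.klDiv μ ν).toReal := by
  rw [InformationTheory.toReal_klDiv_of_measure_eq h (by simp), integral_fintype .of_finite]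
  unfold relEntropy
  refine Finset.sum_congr rfl fun i _ => ?_
  simp only [smul_eq_mul]
  rcases eq_or_ne (μ.real {i}) 0 with h0 | h0
  · rw [h0]; simp
  congr 1
  have hμ : μ {i} = μ.rnDeriv ν i * ν {i} := by
    conv_lhs => rw [← Measure.withDensity_rnDeriv_eq μ ν h]
    rw [withDensity_apply _ (measurableSet_singleton i), lintegral_singleton]
  have hμr : μ.real {i} = (μ.rnDeriv ν i).toReal * ν.real {i} := by
    rw [Measure.real, hμ, ENNReal.toReal_mul]; rfl
  have hr : (μ.rnDeriv ν i).toReal ≠ 0 := fun hz => h0 (by rw [hμr, hz, zero_mul])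
  have hv : ν.real {i} ≠ 0 := fun hz => h0 (by rw [hμr, hz, mul_zero])
  rw [llr, hμr, Real.log_mul hr hv]
  ring

variable {n : ℕ} [NeZero n] {g : ℝ → ℝ}

lemma isProbabilityMeasure_productMeasure (hg : ∀ u, g u ∈ Icc (0 : ℝ) 1) :
    IsProbabilityMeasure (productMeasure n g) := by
  have : ∀ x : ZMod n, IsProbabilityMeasure (ENNReal.ofReal (g (pos x)) • Measure.dirac true +
      ENNReal.ofReal (1 - g (pos x)) • Measure.dirac false) := by
    intro x
    refine ⟨?_⟩
    have h := hg (pos x)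
    simp only [Measure.add_apply, Measure.smul_apply, measure_univ, smul_eq_mul, mul_one]
    rw [← ENNReal.ofReal_add h.1 (by linarith [h.2])]
    simp
  unfold productMeasure
  infer_instance

lemma productMeasure_real_singleton (hg : ∀ u, g u ∈ Icc (0 : ℝ) 1) (η : Config n) :
    (productMeasure n g).real {η} = bernWeight (fun x => g (pos x)) η := by
  have : ∀ x : ZMod n, IsFiniteMeasure (ENNReal.ofReal (g (pos x)) • Measure.dirac true +
      ENNReal.ofReal (1 - g (pos x)) • Measure.dirac false) := by
    intro x
    refine ⟨?_⟩
    simp only [Measure.add_apply, Measure.smul_apply, measure_univ, smul_eq_mul, mul_one]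
    exact ENNReal.add_lt_top.2 ⟨ENNReal.ofReal_lt_top, ENNReal.ofReal_lt_top⟩
  unfold productMeasure
  rw [Measure.real, Measure.pi_singleton, ENNReal.toReal_prod]
  unfold bernWeight
  refine Finset.prod_congr rfl fun x _ => ?_
  have h := hg (pos x)
  cases hx : η x
  · simp [h.2]
  · simp [h.1]

/-- Comparison of the entropies relative to two close product measures. -/
lemma relEntropy_bernWeight_le {μ : Measure (Config n)} [IsProbabilityMeasure μ] {e d K : ℝ}
    (he : 0 < e) (hK : 0 ≤ K) (hg : ∀ u, g u ∈ Icc e (1 - e)) {α : ZMod n → ℝ}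
    (hα : ∀ x, α x ∈ Icc e (1 - e)) (hd : ∀ x, |α x - g (pos x)| ≤ d / n)
    (h : InformationTheory.klDiv μ (productMeasure n g) ≤ ENNReal.ofReal K) :
    relEntropy (fun η => μ.real {η}) (bernWeight α) ≤ K + d / e := by
  have hnpos : (0 : ℝ) < n := by exact_mod_cast Nat.pos_of_ne_zero (NeZero.ne n)
  have hg' : ∀ u, g u ∈ Icc (0 : ℝ) 1 := fun u =>
    ⟨he.le.trans (hg u).1, (hg u).2.trans (by linarith)⟩
  have := isProbabilityMeasure_productMeasure (n := n) hg'
  have hne : InformationTheory.klDiv μ (productMeasure n g) ≠ ⊤ :=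
    (h.trans_lt ENNReal.ofReal_lt_top).ne
  have hac := (InformationTheory.klDiv_ne_top_iff.1 hne).1
  have h1 := relEntropy_eq_toReal_klDiv hac
  have h2 : (InformationTheory.klDiv μ (productMeasure n g)).toReal ≤ K := by
    have := ENNReal.toReal_mono ENNReal.ofReal_ne_top h
    rwa [ENNReal.toReal_ofReal hK] at this
  have hsum : ∑ η : Config n, μ.real {η} = 1 := by
    have := measureReal_biUnion_finset (μ := μ) (s := (Finset.univ : Finset (Config n)))
      (f := fun η => {η}) (fun a _ b _ hab => by simpa using hab)
      (fun a _ => measurableSet_singleton a)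
    rw [← this]
    have hu : (⋃ η ∈ (Finset.univ : Finset (Config n)), ({η} : Set (Config n))) = univ := by
      ext; simp
    rw [hu, probReal_univ]
  have h3 : ∀ η, Real.log (bernWeight (fun x => g (pos x)) η) - Real.log (bernWeight α η) ≤
      d / e := by
    intro η
    have := log_bernWeight_sub_le (d := d / n) he (fun x : ZMod n => hg (pos x)) hα
      (fun x => by rw [abs_sub_comm]; exact hd x) η
    rw [ZMod.card] at this
    refine this.trans (le_of_eq ?_)
    field_simp
  calc relEntropy (fun η => μ.real {η}) (bernWeight α)
      = relEntropy (fun η => μ.real {η}) (fun η => (productMeasure n g).real {η}) +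
        ∑ η, μ.real {η} * (Real.log (bernWeight (fun x => g (pos x)) η) -
          Real.log (bernWeight α η)) := by
        unfold relEntropy
        rw [← Finset.sum_add_distrib]
        refine Finset.sum_congr rfl fun η _ => ?_
        simp only [productMeasure_real_singleton hg']
        ring
    _ ≤ K + ∑ η, μ.real {η} * (d / e) := by
        refine add_le_add (h1.le.trans h2) (Finset.sum_le_sum fun η _ => ?_)
        exact mul_le_mul_of_nonneg_left (h3 η) measureReal_nonneg
    _ = K + d / e := by rw [← Finset.sum_mul, hsum, one_mul]

end Entropy

/-! ### Discretized test functions and summation by parts. -/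

section TestFunction

variable {n : ℕ} [NeZero n]

lemma sum_zmod_eq_sum_range (h : ℕ → ℝ) : ∑ x : ZMod n, h x.val = ∑ k ∈ Finset.range n, h k := by
  obtain ⟨k, rfl⟩ : ∃ k, n = k + 1 := ⟨n - 1, by have := NeZero.pos n; omega⟩
  exact Fin.sum_univ_eq_sum_range h (k + 1)

/-- Error of a Riemann sum of a Lipschitz function. -/
lemma abs_riemannSum_sub_integral_le {g : ℝ → ℝ} (hg : Continuous g) {L : ℝ} (hL : 0 ≤ L)
    (hlip : ∀ u ∈ Icc (0 : ℝ) 2, ∀ v ∈ Icc (0 : ℝ) 2, |g v - g u| ≤ L * |v - u|) :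
    |1 / (n : ℝ) * (∑ x : ZMod n, g (pos x)) - ∫ u in (0 : ℝ)..1, g u| ≤ L / n := by
  have hnat : 0 < n := NeZero.pos n
  have hnpos : (0 : ℝ) < n := by exact_mod_cast hnat
  have hn1 : (1 : ℝ) / n ≤ 1 := by
    rw [div_le_one hnpos]; exact_mod_cast hnat
  have hint : ∫ u in (0 : ℝ)..1, g u = ∑ x : ZMod n, ∫ u in pos x..pos x + 1 / n, g u := by
    have h := intervalIntegral.sum_integral_adjacent_intervals (f := g) (μ := volume)
      (a := fun k : ℕ => (k : ℝ) / n) (n := n) fun k _ => hg.intervalIntegrable _ _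
    simp only [Nat.cast_zero, zero_div, div_self hnpos.ne'] at h
    rw [← h, ← sum_zmod_eq_sum_range (fun k => ∫ u in ((k : ℝ) / n)..(((k + 1 : ℕ) : ℝ) / n), g u)]
    refine Finset.sum_congr rfl fun x _ => ?_
    unfold pos
    push_cast
    rw [add_div]
  rw [hint, Finset.mul_sum, ← Finset.sum_sub_distrib]
  refine (Finset.abs_sum_le_sum_abs _ _).trans ((Finset.sum_le_card_nsmul _ _
    (1 / n * (L / n)) fun x _ => ?_).trans (le_of_eq ?_))
  · have hp := pos_mem_Ico x
    have h1 := abs_average_sub_le hnat hg (a := pos x) (c := g (pos x)) (d := L / n) fun u hu => by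
      refine (hlip _ ⟨hp.1, by linarith [hp.2]⟩ u
        ⟨by linarith [hp.1, hu.1], by linarith [hp.2, hu.2]⟩).trans ?_
      rw [div_eq_mul_one_div L]
      refine mul_le_mul_of_nonneg_left ?_ hL
      rw [abs_le]; constructor <;> linarith [hu.1, hu.2]
    have h2 : 1 / (n : ℝ) * g (pos x) - ∫ u in pos x..pos x + 1 / n, g u =
        -(1 / n * (n * (∫ u in pos x..pos x + 1 / n, g u) - g (pos x))) := by
      field_simp; ring
    rw [h2, abs_neg, abs_mul, abs_of_pos (by positivity : (0 : ℝ) < 1 / n)]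
    gcongr
  · rw [Finset.card_univ, ZMod.card, nsmul_eq_mul]
    field_simp

/-- The partial sums from the right of the discretization of `g`. -/
def tail (n : ℕ) [NeZero n] (g : ℝ → ℝ) (y : ZMod n) : ℝ :=
  1 / n * ∑ z : ZMod n, if y.val < z.val then g (pos z) else 0

lemma tail_last (hn : 2 ≤ n) (g : ℝ → ℝ) {y : ZMod n} (hy : y + 1 = 0) : tail n g y = 0 := by
  obtain ⟨k, rfl⟩ : ∃ k, n = k + 1 := ⟨n - 1, by omega⟩
  unfold tail
  rw [Finset.sum_eq_zero, mul_zero]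
  intro z _
  rw [if_neg]
  rw [eq_neg_of_add_eq_zero_left hy, ZMod.val_neg_one]
  have := ZMod.val_lt z
  omega

lemma tail_nonneg {g : ℝ → ℝ} (hg : ∀ u, 0 ≤ g u) (y : ZMod n) : 0 ≤ tail n g y := by
  unfold tail
  refine mul_nonneg (by positivity) (Finset.sum_nonneg fun z _ => ?_)
  split_ifs
  · exact hg _
  · exact le_rfl

lemma tail_le {g : ℝ → ℝ} (hg : ∀ u, 0 ≤ g u) (y : ZMod n) :
    tail n g y ≤ 1 / n * ∑ x : ZMod n, g (pos x) := by
  unfold tail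
  refine mul_le_mul_of_nonneg_left (Finset.sum_le_sum fun z _ => ?_) (by positivity)
  split_ifs
  · exact le_rfl
  · exact hg _

lemma tail_eq_zero {g : ℝ → ℝ} {ε : ℝ} (hg : ∀ u, ε ≤ u → g u = 0) {y : ZMod n}
    (hy : ε ≤ pos y) : tail n g y = 0 := by
  have hnpos : (0 : ℝ) < n := by exact_mod_cast NeZero.pos n
  unfold tail
  rw [Finset.sum_eq_zero, mul_zero]
  intro z _
  split_ifs with h
  · refine hg _ (hy.trans ?_)
    unfold pos
    have : (y.val : ℝ) ≤ z.val := by exact_mod_cast h.le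
    gcongr
  · rfl

/-- The tails transport the total mass from the site 0 to the discretization of g along the bonds.
The torus may be cut at 0 because g 0 = 0 and the tail vanishes on the last bond. -/
lemma tail_sub_one_sub (hn : 2 ≤ n) {g : ℝ → ℝ} (hg0 : g 0 = 0) (x : ZMod n) :
    tail n g (x - 1) - tail n g x =
      1 / n * g (pos x) - if x = 0 then 1 / n * ∑ z : ZMod n, g (pos z) else 0 := by
  have hp0 : pos (0 : ZMod n) = 0 := by simp [pos]
  by_cases hx : x = 0
  · subst hx
    rw [tail_last hn g (by ring), if_pos rfl, hp0, hg0]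
    unfold tail
    rw [mul_zero, zero_sub, zero_sub]
    congr 2
    refine Finset.sum_congr rfl fun z _ => ?_
    split_ifs with h
    · rfl
    · have : z = 0 := by
        rw [ZMod.val_zero, not_lt, Nat.le_zero] at h
        exact (ZMod.val_eq_zero z).1 h
      rw [this, hp0, hg0]
  · rw [if_neg hx, sub_zero]
    unfold tail
    rw [← mul_sub, ← Finset.sum_sub_distrib]
    congr 1
    have hv : x.val = (x - 1).val + 1 := by
      have := val_add_one_of_ne hn (y := x - 1) (by rwa [sub_add_cancel])
      rwa [sub_add_cancel] at this
    rw [Finset.sum_eq_single x]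
    · rw [if_pos (by omega), if_neg (lt_irrefl _), sub_zero]
    · intro z _ hz
      have hne : z.val ≠ x.val := fun h => hz (ZMod.val_injective n h)
      by_cases h : x.val < z.val
      · rw [if_pos h, if_pos (by omega), sub_self]
      · rw [if_neg h, if_neg (by omega), sub_self]
    · simp

/-- Summation by parts. -/
lemma sum_tail_mul_eq (hn : 2 ≤ n) {g : ℝ → ℝ} (hg0 : g 0 = 0) (c : ZMod n → ℝ) :
    ∑ y, tail n g y * (c (y + 1) - c y) =
      1 / n * ∑ x, g (pos x) * c x - (1 / n * ∑ x : ZMod n, g (pos x)) * c 0 := by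
  have h1 : ∑ y, tail n g y * (c (y + 1) - c y) =
      ∑ x, (tail n g (x - 1) - tail n g x) * c x := by
    simp only [mul_sub, sub_mul, Finset.sum_sub_distrib]
    congr 1
    rw [← Equiv.sum_comp (Equiv.addRight (1 : ZMod n)) (fun x => tail n g (x - 1) * c x)]
    simp
  rw [h1]
  simp only [tail_sub_one_sub hn hg0, sub_mul, Finset.sum_sub_distrib, ite_mul, zero_mul,
    Finset.sum_ite_eq', Finset.mem_univ, if_true]
  congr 1
  rw [Finset.mul_sum]
  exact Finset.sum_congr rfl fun x _ => by ring

/-- The factor ε originates here: only the sites below ε, at most ⌈εn⌉ ≤ 2εn of them, have a nonzero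
tail, and no tail exceeds the total mass S. -/
lemma sum_tail_sq_le {g : ℝ → ℝ} (hg : ∀ u, 0 ≤ g u) {ε S : ℝ} (hε : 0 < ε)
    (hgε : ∀ u, ε ≤ u → g u = 0) (hS : 1 / n * ∑ x : ZMod n, g (pos x) ≤ S) (hn : 1 ≤ ε * n) :
    ∑ y : ZMod n, tail n g y ^ 2 ≤ 2 * S ^ 2 * (ε * n) := by
  have hnpos : (0 : ℝ) < n := by exact_mod_cast NeZero.pos n
  have hcard : ((Finset.univ.filter fun y : ZMod n => pos y < ε).card : ℝ) ≤ 2 * (ε * n) := by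
    have h1 : (Finset.univ.filter fun y : ZMod n => pos y < ε).card ≤
        (Finset.range ⌈ε * n⌉₊).card := by
      refine Finset.card_le_card_of_injOn ZMod.val (fun y hy => ?_)
        (ZMod.val_injective n).injOn
      have hy' : pos y < ε := by simpa using hy
      unfold pos at hy'
      rw [div_lt_iff₀ hnpos] at hy'
      simpa using Nat.lt_ceil.2 hy'
    rw [Finset.card_range] at h1
    have h2 : ((Finset.univ.filter fun y : ZMod n => pos y < ε).card : ℝ) ≤ ⌈ε * n⌉₊ := by
      exact_mod_cast h1
    have h3 := Nat.ceil_lt_add_one (by positivity : 0 ≤ ε * n)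
    linarith
  calc ∑ y : ZMod n, tail n g y ^ 2
      ≤ ∑ y : ZMod n, if pos y < ε then S ^ 2 else 0 := by
        refine Finset.sum_le_sum fun y _ => ?_
        split_ifs with h
        · exact pow_le_pow_left₀ (tail_nonneg hg y) ((tail_le hg y).trans hS) 2
        · rw [tail_eq_zero hgε (not_lt.1 h)]; simp
    _ = (Finset.univ.filter fun y : ZMod n => pos y < ε).card * S ^ 2 := by
        rw [← Finset.sum_filter, Finset.sum_const, nsmul_eq_mul]
    _ ≤ 2 * (ε * n) * S ^ 2 := by gcongr
    _ = _ := by ring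

end TestFunction

/-! ### Riemann sums of the mollifier. -/

section Mollifier

variable {φ : ℝ → ℝ} {ε : ℝ}

lemma rescale_eq_zero (hφ : Function.support φ ⊆ Ioo 0 1) (hε : 0 < ε) {u : ℝ}
    (hu : u ∉ Ioo 0 ε) : rescale φ ε u = 0 := by
  unfold rescale
  have : φ (u / ε) = 0 := by
    by_contra h
    have h1 := hφ (Function.mem_support.2 h)
    exact hu ⟨by simpa [hε] using (div_pos_iff_of_pos_right hε).1 h1.1,
      by simpa using (div_lt_one hε).1 h1.2⟩
  rw [this, mul_zero]

lemma integral_rescale (hφ : Function.support φ ⊆ Ioo 0 1) (hint : ∫ u, φ u = 1)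
    (hε : ε ∈ Ioo (0 : ℝ) 1) : ∫ u in (0 : ℝ)..1, rescale φ ε u = 1 := by
  have hsupp : Function.support (rescale φ ε) ⊆ Ioc 0 1 := by
    intro u hu
    by_contra h
    refine hu (rescale_eq_zero hφ hε.1 fun h' => h ⟨h'.1, h'.2.le.trans hε.2.le⟩)
  rw [intervalIntegral.integral_eq_integral_of_support_subset hsupp]
  unfold rescale
  rw [integral_const_mul, Measure.integral_comp_div φ ε, hint, abs_of_pos hε.1, smul_eq_mul,
    mul_one, inv_mul_cancel₀ hε.1.ne']

lemma exists_abs_riemannSum_rescale_sub_one_le (hφ : ContDiff ℝ 1 φ)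
    (hsupp : Function.support φ ⊆ Ioo 0 1) (hint : ∫ u, φ u = 1) (hε : ε ∈ Ioo (0 : ℝ) 1) :
    ∃ L, 0 ≤ L ∧ ∀ (n : ℕ) [NeZero n],
      |1 / (n : ℝ) * (∑ x : ZMod n, rescale φ ε (pos x)) - 1| ≤ L / n := by
  have hr : ContDiff ℝ 1 (rescale φ ε) := by
    unfold rescale
    fun_prop
  obtain ⟨L, hL⟩ := (isCompact_Icc (a := (0 : ℝ)) (b := 2)).exists_bound_of_continuousOn
    (hr.continuous_deriv le_rfl).continuousOn
  have hL0 : 0 ≤ L := (norm_nonneg _).trans (hL 0 (by simp))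
  refine ⟨L, hL0, fun n _ => ?_⟩
  have h := abs_riemannSum_sub_integral_le (n := n) hr.continuous hL0 fun u hu v hv =>
    abs_sub_le_of_abs_deriv_le (convex_Icc 0 2) (hr.differentiable one_ne_zero) hL hu hv
  rwa [integral_rescale hsupp hint hε] at h

end Mollifier

/-! ### The integrand as a combination of bond gradients. -/

section Functional

variable {n : ℕ} [NeZero n]

lemma charge_eq_div {ι : Type*} {α : ι → ℝ} {η : ι → Bool} {x : ι} (h0 : 0 < α x) (h1 : α x < 1) :
    charge α η x = ((if η x then 1 else 0) - α x) / (α x * (1 - α x)) := by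
  have h2 : 1 - α x ≠ 0 := (sub_pos.2 h1).ne'
  unfold charge
  split_ifs
  · field_simp
  · field_simp; simp

lemma abs_charge_sub_le {ι : Type*} {α β : ι → ℝ} {e d : ℝ} (he : 0 < e)
    (hα : ∀ x, α x ∈ Icc e (1 - e)) (hβ : ∀ x, β x ∈ Icc e (1 - e))
    (hd : ∀ x, |α x - β x| ≤ d) (η : ι → Bool) (x : ι) :
    |charge α η x - charge β η x| ≤ d / e ^ 2 := by
  have key : ∀ a b : ℝ, e ≤ a → e ≤ b → |a - b| ≤ d → |1 / a - 1 / b| ≤ d / e ^ 2 := by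
    intro a b ha hb hab
    have ha0 := he.trans_le ha
    have hb0 := he.trans_le hb
    have hd0 := (abs_nonneg _).trans hab
    have : 1 / a - 1 / b = -((a - b) / (a * b)) := by field_simp; ring
    rw [this, abs_neg, abs_div, abs_of_pos (by positivity : 0 < a * b), sq]
    gcongr
  unfold charge
  split_ifs
  · exact key _ _ (hα x).1 (hβ x).1 (hd x)
  · rw [show -(1 / (1 - α x)) - -(1 / (1 - β x)) = -(1 / (1 - α x) - 1 / (1 - β x)) by ring, abs_neg]
    refine key _ _ (by linarith [(hα x).2]) (by linarith [(hβ x).2]) ?_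
    rw [show 1 - α x - (1 - β x) = -(α x - β x) by ring, abs_neg]
    exact hd x

/-- The integrand of `Z - Γ`, as a function of the configuration. -/
def discrepancy (n : ℕ) [NeZero n] (g : ℝ → ℝ) (r : ℝ → ℝ) (q : ℝ) (η : Config n) : ℝ :=
  (1 / √(n : ℝ)) * ∑ x : ZMod n, (occ η x - r (pos x)) *
      (g (pos x) * compressibility (r 0) / (q * compressibility (r (pos x)))) -
    √(n : ℝ) * ((occ η 0 - r 0) / q)

/-- The ratio of compressibilities in the test function turns every centred occupation variable into
a charge, so that both terms share one prefactor. -/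
lemma discrepancy_eq {g r : ℝ → ℝ} {q : ℝ} (hr0 : ∀ u, 0 < r u) (hr1 : ∀ u, r u < 1)
    (hq : 0 < q) (η : Config n) :
    discrepancy n g r q η = √(n : ℝ) * (compressibility (r 0) / q) *
      (1 / n * ∑ x : ZMod n, g (pos x) * charge (fun x => r (pos x)) η x -
        charge (fun x => r (pos x)) η 0) := by
  have hnpos : (0 : ℝ) < n := by exact_mod_cast NeZero.pos n
  have hs : √(n : ℝ) * √(n : ℝ) = n := Real.mul_self_sqrt hnpos.le
  have hs0 : 0 < √(n : ℝ) := Real.sqrt_pos.2 hnpos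
  have hch : ∀ x : ZMod n, charge (fun x => r (pos x)) η x =
      (occ η x - r (pos x)) / compressibility (r (pos x)) := fun x =>
    charge_eq_div (hr0 _) (hr1 _)
  have hχ : ∀ u, compressibility (r u) ≠ 0 := fun u =>
    (mul_pos (hr0 u) (sub_pos.2 (hr1 u))).ne'
  have hp0 : pos (0 : ZMod n) = 0 := by simp [pos]
  have h1 : 1 / √(n : ℝ) = √(n : ℝ) * (1 / n) := by
    rw [eq_comm, mul_one_div, div_eq_div_iff hnpos.ne' hs0.ne', hs, one_mul]
  unfold discrepancy
  simp only [hch]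
  rw [hp0, h1, mul_sub, Finset.mul_sum, Finset.mul_sum, Finset.mul_sum]
  congr 1
  · refine Finset.sum_congr rfl fun x _ => ?_
    have := hχ (pos x)
    field_simp
  · have := hχ 0
    field_simp

/-- After summation by parts, two errors of order 1/n remain in front of the prefactor √n. Charges
of r are replaced by charges of α, at cost 2κ in the sum (its mass is at most 2) and κ at the site
0; and the Riemann sum of g differs from 1 by at most L / n. -/
lemma abs_discrepancy_sub_le (hn : 2 ≤ n) {e κ M L : ℝ} (he : 0 < e) {g r : ℝ → ℝ}
    (hg : ∀ u, 0 ≤ g u) (hg0 : g 0 = 0) {q : ℝ} (hq : 1 / M ≤ q) (hM : 0 < M)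
    (hr : ∀ u, r u ∈ Icc e (1 - e)) {α : ZMod n → ℝ} (hα : ∀ x, α x ∈ Icc e (1 - e))
    (hd : ∀ x, |α x - r (pos x)| ≤ κ / n)
    (hL : |1 / (n : ℝ) * (∑ x : ZMod n, g (pos x)) - 1| ≤ L / n) (hLn : L ≤ n) (η : Config n) :
    |discrepancy n g r q η - ∑ y, √(n : ℝ) * (compressibility (r 0) / q) * tail n g y *
      (charge α η (y + 1) - charge α η y)| ≤ M * (3 * κ / e ^ 2 + L / e) / √(n : ℝ) := by
  have hnpos : (0 : ℝ) < n := by exact_mod_cast NeZero.pos n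
  have hq0 : 0 < q := lt_of_lt_of_le (by positivity) hq
  have hr0 : ∀ u, 0 < r u := fun u => he.trans_le (hr u).1
  have hr1 : ∀ u, r u < 1 := fun u => by linarith [(hr u).2]
  set c := compressibility (r 0) / q
  set S := 1 / (n : ℝ) * ∑ x : ZMod n, g (pos x)
  have hc0 : 0 ≤ c := div_nonneg (mul_nonneg (hr0 0).le (sub_pos.2 (hr1 0)).le) hq0.le
  have hcM : c ≤ M := by
    have h1 : compressibility (r 0) ≤ 1 := by
      unfold compressibility; nlinarith [hr0 0, hr1 0]
    rw [div_le_iff₀ hq0]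
    rw [div_le_iff₀ hM] at hq
    linarith
  have hS : S ≤ 2 := by
    have : L / n ≤ 1 := by rw [div_le_one hnpos]; exact hLn
    linarith [(abs_le.1 hL).2]
  have hκ0 : 0 ≤ κ / n := (abs_nonneg _).trans (hd 0)
  have hcd := abs_charge_sub_le he (fun x : ZMod n => hr (pos x)) hα
    (fun x => by rw [abs_sub_comm]; exact hd x) η
  set A : ZMod n → ℝ := charge α η
  set R : ZMod n → ℝ := charge (fun x => r (pos x)) η
  have e1 : discrepancy n g r q η - ∑ y, √(n : ℝ) * c * tail n g y * (A (y + 1) - A y) =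
      √(n : ℝ) * c * (1 / n * ∑ x : ZMod n, g (pos x) * (R x - A x) + ((S - 1) * A 0 -
        (R 0 - A 0))) := by
    rw [discrepancy_eq hr0 hr1 hq0]
    have := sum_tail_mul_eq hn hg0 A
    have h2 : ∑ y, √(n : ℝ) * c * tail n g y * (A (y + 1) - A y) =
        √(n : ℝ) * c * ∑ y, tail n g y * (A (y + 1) - A y) := by
      rw [Finset.mul_sum]; exact Finset.sum_congr rfl fun y _ => by ring
    rw [h2, this]
    simp only [mul_sub (g _), Finset.sum_sub_distrib]
    ring
  have b1 : |1 / (n : ℝ) * ∑ x : ZMod n, g (pos x) * (R x - A x)| ≤ 2 * (κ / n / e ^ 2) := by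
    rw [abs_mul, abs_of_pos (by positivity : (0 : ℝ) < 1 / n)]
    calc _ ≤ 1 / (n : ℝ) * ∑ x : ZMod n, g (pos x) * (κ / n / e ^ 2) := by
          refine mul_le_mul_of_nonneg_left ((Finset.abs_sum_le_sum_abs _ _).trans
            (Finset.sum_le_sum fun x _ => ?_)) (by positivity)
          rw [abs_mul, abs_of_nonneg (hg _)]
          exact mul_le_mul_of_nonneg_left (hcd x) (hg _)
      _ = S * (κ / n / e ^ 2) := by rw [← Finset.sum_mul, ← mul_assoc]
      _ ≤ _ := mul_le_mul_of_nonneg_right hS (by positivity)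
  have b2 : |(S - 1) * A 0| ≤ L / n * (1 / e) := by
    rw [abs_mul]
    exact mul_le_mul hL (abs_charge_le he hα η 0) (abs_nonneg _) ((abs_nonneg _).trans hL)
  have b3 := abs_add_le (1 / (n : ℝ) * ∑ x : ZMod n, g (pos x) * (R x - A x))
    ((S - 1) * A 0 - (R 0 - A 0))
  have b4 := abs_sub ((S - 1) * A 0) (R 0 - A 0)
  have b5 : |1 / (n : ℝ) * ∑ x : ZMod n, g (pos x) * (R x - A x) +
      ((S - 1) * A 0 - (R 0 - A 0))| ≤ (3 * κ / e ^ 2 + L / e) / n := by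
    have : (3 * κ / e ^ 2 + L / e) / n = 3 * (κ / n / e ^ 2) + L / n * (1 / e) := by ring
    linarith [hcd 0]
  rw [e1, abs_mul, abs_mul, abs_of_nonneg (Real.sqrt_nonneg _), abs_of_nonneg hc0]
  calc _ ≤ √(n : ℝ) * M * ((3 * κ / e ^ 2 + L / e) / n) := by gcongr
    _ = _ := by
      have hs : √(n : ℝ) * √(n : ℝ) = n := Real.mul_self_sqrt hnpos.le
      have hs0 : √(n : ℝ) ≠ 0 := (Real.sqrt_pos.2 hnpos).ne'
      field_simp
      rw [sq, hs]
      ring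

lemma sum_sq_tail_weight_le {g r : ℝ → ℝ} {q M ε : ℝ} (hq : 1 / M ≤ q) (hM : 0 < M)
    (hr : r 0 ∈ Icc (0 : ℝ) 1) (hg : ∀ u, 0 ≤ g u) (hε : 0 < ε)
    (hgε : ∀ u, ε ≤ u → g u = 0) (hS : 1 / n * ∑ x : ZMod n, g (pos x) ≤ 2) (hn : 1 ≤ ε * n) :
    (∑ y : ZMod n, (√(n : ℝ) * (compressibility (r 0) / q) * tail n g y) ^ 2) / (n : ℝ) ^ 2 ≤
      8 * M ^ 2 * ε := by
  have hnpos : (0 : ℝ) < n := by exact_mod_cast NeZero.pos n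
  have hq0 : 0 < q := lt_of_lt_of_le (by positivity) hq
  set c := compressibility (r 0) / q
  have hc0 : 0 ≤ c := div_nonneg (mul_nonneg hr.1 (sub_nonneg.2 hr.2)) hq0.le
  have hcM : c ≤ M := by
    have h1 : compressibility (r 0) ≤ 1 := by
      unfold compressibility; nlinarith [hr.1, hr.2]
    rw [div_le_iff₀ hq0]
    rw [div_le_iff₀ hM] at hq
    linarith
  have h := sum_tail_sq_le hg hε hgε hS hn
  have e1 : ∑ y : ZMod n, (√(n : ℝ) * c * tail n g y) ^ 2 =
      n * c ^ 2 * ∑ y : ZMod n, tail n g y ^ 2 := by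
    rw [Finset.mul_sum]
    refine Finset.sum_congr rfl fun y _ => ?_
    rw [mul_pow, mul_pow, Real.sq_sqrt hnpos.le]
  rw [e1, div_le_iff₀ (by positivity)]
  calc _ ≤ n * M ^ 2 * (2 * 2 ^ 2 * (ε * n)) := by gcongr
    _ = _ := by ring

end Functional

/-! ### The accelerated process as a finite Markov chain. -/

section Dynamics

variable {n : ℕ} [NeZero n] {F : ℝ → ℝ}

lemma sum_toMatrix_mul (F : ℝ → ℝ) (v : Config n → ℝ) (i : Config n) :
    ∑ j, ((n : ℝ) ^ 2 • LinearMap.toMatrix' (generator F n)) i j * v j =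
      (n : ℝ) ^ 2 * generator F n v i := by
  have h := congrFun (LinearMap.toMatrix'_mulVec (generator F n) v) i
  rw [← h, Matrix.mulVec, dotProduct, Finset.mul_sum]
  exact Finset.sum_congr rfl fun j _ => by rw [Matrix.smul_apply, smul_eq_mul, mul_assoc]

lemma rate_nonneg (hF : ∀ x : ZMod n, |F (pos x)| ≤ n) (x y : ZMod n) : 0 ≤ rate F n x y := by
  have hnpos : (0 : ℝ) < n := by exact_mod_cast NeZero.pos n
  have h : |F (pos x) / n| ≤ 1 := by
    rw [abs_div, abs_of_pos hnpos, div_le_one hnpos]; exact hF x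
  have h1 := abs_le.1 h
  unfold rate
  refine add_nonneg ?_ ?_ <;> split_ifs <;> linarith [h1.1, h1.2]

lemma isRateMatrix_generator (hF : ∀ x : ZMod n, |F (pos x)| ≤ n) :
    IsRateMatrix ((n : ℝ) ^ 2 • LinearMap.toMatrix' (generator F n)) where
  nonneg i j hij := by
    have hocc : ∀ (η : Config n) x, 0 ≤ occ η x ∧ 0 ≤ 1 - occ η x := by
      intro η x; unfold occ; split_ifs <;> simp
    have h1 : ((n : ℝ) ^ 2 • LinearMap.toMatrix' (generator F n)) i j =
        (n : ℝ) ^ 2 * generator F n (fun k => if k = j then 1 else 0) i := by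
      rw [← sum_toMatrix_mul]; simp
    rw [h1]
    refine mul_nonneg (by positivity) ?_
    show 0 ≤ ∑ x, ∑ y, rate F n x y * occ i x * (1 - occ i y) *
      ((if exchange i x y = j then 1 else 0) - (if i = j then 1 else 0))
    refine Finset.sum_nonneg fun x _ => Finset.sum_nonneg fun y _ => ?_
    rw [if_neg hij, sub_zero]
    refine mul_nonneg (mul_nonneg (mul_nonneg (rate_nonneg hF x y) (hocc i x).1) (hocc i y).2) ?_
    split_ifs <;> simp
  row_sum i := by
    have h := sum_toMatrix_mul F (fun _ => (1 : ℝ)) i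
    simp only [mul_one] at h
    rw [h]
    show (n : ℝ) ^ 2 * ∑ x, ∑ y, rate F n x y * occ i x * (1 - occ i y) * (1 - 1) = 0
    simp

/-- Multiplying time by n² multiplies the generator by n². In a finite discrete space, right
continuity means being locally constant to the right. -/
lemma IsProcess.isChain {μ : Measure (Config n)} {Ω : Type*} [MeasurableSpace Ω] {P : Measure Ω}
    {η : ℝ → Ω → Config n} (h : IsProcess F n μ P η) :
    IsChain ((n : ℝ) ^ 2 • LinearMap.toMatrix' (generator F n)) μ P
      (fun r => η (r * (n : ℝ) ^ 2)) where
  measurable t ht := h.measurable _ (by positivity)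
  right_continuous a t ht := by
    have h1 := h.right_continuous a (t * (n : ℝ) ^ 2) (by positivity)
    have h2 : ∀ᶠ r in 𝓝[≥] (t * (n : ℝ) ^ 2), η r a = η (t * (n : ℝ) ^ 2) a :=
      h1.eventually ((isOpen_discrete {η (t * (n : ℝ) ^ 2) a}).mem_nhds rfl)
    have h3 : Tendsto (fun r : ℝ => r * (n : ℝ) ^ 2) (𝓝[≥] t) (𝓝[≥] (t * (n : ℝ) ^ 2)) := by
      refine tendsto_nhdsWithin_iff.2 ⟨?_, ?_⟩
      · exact ((continuous_mul_const ((n : ℝ) ^ 2)).tendsto t).mono_left nhdsWithin_le_nhds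
      · filter_upwards [self_mem_nhdsWithin] with r hr
        exact mul_le_mul_of_nonneg_right (mem_Ici.1 hr) (sq_nonneg (n : ℝ))
    exact h3.eventually h2
  finite_dim k τ hτ hτ0 ξ := by
    have h1 := h.finite_dim k (fun i => τ i * (n : ℝ) ^ 2)
      (fun i j hij => mul_le_mul_of_nonneg_right (hτ hij) (by positivity)) (by simp [hτ0]) ξ
    rw [h1]
    simp only [transition, ← sub_mul, smul_smul]

end Dynamics

/-! ### Continuity in time of the coefficients. -/

section Continuity

variable {n : ℕ} [NeZero n] {s : Set ℝ}

lemma continuousOn_residual {e ε : ℝ} {α b θ : ℝ → ZMod n → ℝ} {I : ℝ → Config n → ℝ}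
    (hα : ∀ x, ContinuousOn (fun r => α r x) s)
    (hc : ∀ η x, ContinuousOn (fun r => charge (α r) η x) s)
    (hb : ∀ x, ContinuousOn (fun r => b r x) s) (hθ : ∀ x, ContinuousOn (fun r => θ r x) s)
    (hI : ∀ η, ContinuousOn (fun r => I r η) s) (η : Config n) :
    ContinuousOn (fun r => residual e ε (α r) (b r) (θ r) (I r) η) s := by
  have hs : ∀ y, ContinuousOn (fun r => spread (α r) (b r) η y) s := fun y =>
    continuousOn_finsetSum _ fun x _ => continuousOn_const.mul ((hb x).mul (hc η x))
  have hg : ∀ y, ContinuousOn (fun r => bondGrad (α r) η y) s := fun y =>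
    ((hc η (y + 1)).sub (hc η y)).add
      (((hα (y + 1)).sub (hα y)).mul ((hc η y).mul (hc η (y + 1))))
  have hm : ContinuousOn (fun r => meanField (α r) (b r) η) s :=
    continuousOn_const.mul (((continuousOn_finsetSum _ fun x _ => (hb x).mul (hc η x)).mul
      (continuousOn_finsetSum _ fun x _ => hc η x)).sub
      (continuousOn_finsetSum _ fun x _ => (hb x).mul ((hc η x).pow 2)))
  have hcub : ContinuousOn (fun r => cubic (α r) (b r) η) s :=
    continuousOn_finsetSum _ fun y _ => (((hα (y + 1)).sub (hα y)).mul (hs y)).mul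
      ((hc η y).mul (hc η (y + 1)))
  exact ((hm.abs.add hcub.abs).add (continuousOn_const.mul (continuousOn_const.add
    ((continuousOn_finsetSum _ fun y _ => (hs y).pow 2).div_const _)))).add
    ((((hI η).sub (continuousOn_finsetSum _ fun y _ => (hθ y).mul (hg y))).pow 2).div_const _)

variable {ρ : ℝ → ℝ → ℝ} {q : ℝ → ℝ}

lemma continuousOn_compressibility (hρ : ∀ u, ContinuousOn (fun r => ρ r u) s) (u : ℝ) :
    ContinuousOn (fun r => compressibility (ρ r u)) s :=
  (hρ u).mul (continuousOn_const.sub (hρ u))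

lemma continuousOn_field (hρ : ∀ u, ContinuousOn (fun r => ρ r u) s) (hq : ContinuousOn q s)
    (hρ0 : ∀ r ∈ s, ∀ u, 0 < ρ r u) (hρ1 : ∀ r ∈ s, ∀ u, ρ r u < 1) (hq0 : ∀ r ∈ s, 0 < q r)
    (g : ℝ → ℝ) (η : Config n) :
    ContinuousOn (fun r => (1 / √(n : ℝ)) * ∑ x : ZMod n, (occ η x - ρ r (pos x)) *
      (g (pos x) * compressibility (ρ r 0) / (q r * compressibility (ρ r (pos x))))) s := by
  refine continuousOn_const.mul (continuousOn_finsetSum _ fun x _ =>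
    (continuousOn_const.sub (hρ _)).mul ((continuousOn_const.mul
      (continuousOn_compressibility hρ 0)).div (hq.mul (continuousOn_compressibility hρ _))
      fun r hr => ?_))
  exact (mul_pos (hq0 r hr) (mul_pos (hρ0 r hr _) (sub_pos.2 (hρ1 r hr _)))).ne'

omit [NeZero n] in
lemma continuousOn_occupation (hρ : ∀ u, ContinuousOn (fun r => ρ r u) s) (hq : ContinuousOn q s)
    (hq0 : ∀ r ∈ s, 0 < q r) (η : Config n) :
    ContinuousOn (fun r => (occ η 0 - ρ r 0) / q r) s :=
  (continuousOn_const.sub (hρ 0)).div hq fun r hr => (hq0 r hr).ne'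

lemma continuousOn_discrepancy (hρ : ∀ u, ContinuousOn (fun r => ρ r u) s)
    (hq : ContinuousOn q s) (hρ0 : ∀ r ∈ s, ∀ u, 0 < ρ r u) (hρ1 : ∀ r ∈ s, ∀ u, ρ r u < 1)
    (hq0 : ∀ r ∈ s, 0 < q r) (g : ℝ → ℝ) (η : Config n) :
    ContinuousOn (fun r => discrepancy n g (ρ r) (q r) η) s :=
  (continuousOn_field hρ hq hρ0 hρ1 hq0 g η).sub
    (continuousOn_const.mul (continuousOn_occupation hρ hq hq0 η))

end Continuity

/-! ### Increments of Z − Γ. -/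

section Increments

variable {n : ℕ} [NeZero n] {A : Matrix (Config n) (Config n) ℝ} {μ : Measure (Config n)}
  {Ω : Type*} [MeasurableSpace Ω] {P : Measure Ω} {η : ℝ → Ω → Config n}

/-- The increments of `Z - Γ` as time integrals. -/
lemma increment_eq_integral_discrepancy
    (hζ : IsChain A μ P (fun r => η (r * (n : ℝ) ^ 2))) {T : ℝ} {ρ : ℝ → ℝ → ℝ} {q : ℝ → ℝ}
    (hρ : ∀ u, ContinuousOn (fun r => ρ r u) (Icc 0 T)) (hq : ContinuousOn q (Icc 0 T))
    (hρ0 : ∀ r ∈ Icc 0 T, ∀ u, 0 < ρ r u) (hρ1 : ∀ r ∈ Icc 0 T, ∀ u, ρ r u < 1)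
    (hq0 : ∀ r ∈ Icc 0 T, 0 < q r) (φ : ℝ → ℝ) (ε : ℝ) {s t : ℝ} (hs : 0 ≤ s) (hst : s ≤ t)
    (ht : t ≤ T) (a : Ω) :
    Z n φ q ρ ε (fun r => η r a) t - Z n φ q ρ ε (fun r => η r a) s
        - (Γ n q ρ (fun r => η r a) t - Γ n q ρ (fun r => η r a) s) =
      ∫ r in s..t, discrepancy n (rescale φ ε) (ρ r) (q r) (η (r * (n : ℝ) ^ 2) a) := by
  set f : ℝ → Config n → ℝ := fun r ξ => (1 / √(n : ℝ)) * ∑ x : ZMod n, (occ ξ x - ρ r (pos x)) *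
      (rescale φ ε (pos x) * compressibility (ρ r 0) / (q r * compressibility (ρ r (pos x))))
  set g : ℝ → Config n → ℝ := fun r ξ => (occ ξ 0 - ρ r 0) / q r
  have hf : ∀ u v : ℝ, 0 ≤ u → u ≤ v → v ≤ T →
      IntervalIntegrable (fun r => f r (η (r * (n : ℝ) ^ 2) a)) volume u v := fun u v hu huv hv =>
    hζ.intervalIntegrable hu huv (fun ξ => (continuousOn_field hρ hq hρ0 hρ1 hq0 _ ξ).mono
      (Icc_subset_Icc hu hv)) a
  have hg : ∀ u v : ℝ, 0 ≤ u → u ≤ v → v ≤ T →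
      IntervalIntegrable (fun r => g r (η (r * (n : ℝ) ^ 2) a)) volume u v := fun u v hu huv hv =>
    hζ.intervalIntegrable hu huv (fun ξ => (continuousOn_occupation hρ hq hq0 ξ).mono
      (Icc_subset_Icc hu hv)) a
  have hZ : Z n φ q ρ ε (fun r => η r a) t - Z n φ q ρ ε (fun r => η r a) s =
      ∫ r in s..t, f r (η (r * (n : ℝ) ^ 2) a) :=
    intervalIntegral.integral_interval_sub_left (hf 0 t le_rfl (hs.trans hst) ht)
      (hf 0 s le_rfl hs (hst.trans ht))
  have hΓ : Γ n q ρ (fun r => η r a) t - Γ n q ρ (fun r => η r a) s =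
      √(n : ℝ) * ∫ r in s..t, g r (η (r * (n : ℝ) ^ 2) a) := by
    rw [← intervalIntegral.integral_interval_sub_left (hg 0 t le_rfl (hs.trans hst) ht)
      (hg 0 s le_rfl hs (hst.trans ht)), mul_sub]
    rfl
  rw [hZ, hΓ, ← intervalIntegral.integral_const_mul,
    ← intervalIntegral.integral_sub (hf s t hs hst ht) ((hg s t hs hst ht).const_mul _)]
  rfl

end Increments

/-- Comparison of moments of order at most two of a bounded variable with its second moment. -/
lemma integrable_and_integral_abs_rpow_le {Ω : Type*} [MeasurableSpace Ω] {P : Measure Ω}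
    [IsProbabilityMeasure P] {X : Ω → ℝ} (hX : Measurable X) {C : ℝ} (hC : ∀ a, |X a| ≤ C)
    {p : ℝ} (hp : p ∈ Ioo (1 : ℝ) 2) :
    Integrable (fun a => |X a| ^ p) P ∧ ∫ a, |X a| ^ p ∂P ≤ (∫ a, X a ^ 2 ∂P) ^ (p / 2) := by
  have hp0 : 0 < p := by linarith [hp.1]
  have hm : Measurable fun a => |X a| ^ p := by fun_prop
  have hint : Integrable (fun a => |X a| ^ p) P :=
    Integrable.of_bound hm.aestronglyMeasurable (C ^ p) (Eventually.of_forall fun a => by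
      rw [Real.norm_of_nonneg (by positivity)]
      exact Real.rpow_le_rpow (abs_nonneg _) (hC a) hp0.le)
  have hint2 : Integrable (fun a => X a ^ 2) P :=
    Integrable.of_bound (hX.pow_const 2).aestronglyMeasurable (C ^ 2)
      (Eventually.of_forall fun a => by
        rw [Real.norm_of_nonneg (by positivity), ← sq_abs]
        exact pow_le_pow_left₀ (abs_nonneg _) (hC a) 2)
  have heq : ∀ a, |X a| ^ p = (X a ^ 2) ^ (p / 2) := by
    intro a
    rw [← sq_abs, ← Real.rpow_natCast, ← Real.rpow_mul (abs_nonneg _)]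
    congr 1
    push_cast
    ring
  refine ⟨hint, ?_⟩
  simp only [heq] at hint ⊢
  -- Jensen's inequality for the concave power p / 2 < 1.
  have hconc := Real.concaveOn_rpow (p := p / 2) (by positivity) (by linarith [hp.2])
  exact hconc.le_map_integral (Real.continuous_rpow_const (by positivity)).continuousOn
    isClosed_Ici (Eventually.of_forall fun a => sq_nonneg (X a)) hint2 hint

/-! ### Second moment of the time integral. -/

section SecondMoment

variable {n : ℕ} [NeZero n] {T : ℝ} {F ρ₀ : ℝ → ℝ} {ρ : ℝ → ℝ → ℝ} {q : ℝ → ℝ}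

lemma abs_flux_le {t κ B u : ℝ} (hb : ρ t u ∈ Icc (0 : ℝ) 1) (hκ : |deriv (ρ t) u| ≤ κ)
    (hB : |F u| ≤ B) : |flux F ρ t u| ≤ κ + 2 * B := by
  have hB0 : 0 ≤ B := (abs_nonneg _).trans hB
  have h1 : |ρ t u * (1 - ρ t u)| ≤ 1 := by
    rw [abs_le]; constructor <;> nlinarith [hb.1, hb.2]
  have h2 : |2 * (ρ t u * (1 - ρ t u) * F u)| ≤ 2 * B := by
    rw [abs_mul, abs_mul, abs_two]
    have : |ρ t u * (1 - ρ t u)| * |F u| ≤ 1 * B :=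
      mul_le_mul h1 hB (abs_nonneg _) zero_le_one
    linarith
  exact (abs_sub _ _).trans (add_le_add hκ h2)

/-- Second moment of the time integral of the discrepancy, for a fixed large size of the torus. -/
lemma integral_sq_discrepancy_le (hρ : IsHydrodynamicSolution T F ρ₀ ρ) (hF : ContDiff ℝ 1 F)
    (hF_per : Function.Periodic F 1) (hn : 2 ≤ n) {e κ M K B L Ls D ε c B' : ℝ} (he : 0 < e)
    (hM : 0 < M) (hK : 0 ≤ K) (hε : 0 < ε) (hc : 0 < c) (hB' : 0 ≤ B')
    (hb : ∀ t ∈ Icc 0 T, ∀ u, ρ t u ∈ Icc e (1 - e))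
    (hκ : ∀ t ∈ Icc 0 T, ∀ u, |deriv (ρ t) u| ≤ κ) (hq : ContinuousOn q (Icc 0 T))
    (hqM : ∀ r ∈ Icc 0 T, 1 / M ≤ q r)
    (hD : ∀ t ∈ Icc 0 T, ∀ u ∈ Icc (0 : ℝ) 2, |deriv (deriv (ρ t)) u| ≤ D)
    (hL : ∀ u ∈ Icc (0 : ℝ) 2, |deriv F u| ≤ L) (hB : ∀ u ∈ Icc (0 : ℝ) 2, |F u| ≤ B)
    {g : ℝ → ℝ} (hg : ∀ u, 0 ≤ g u) (hg0 : g 0 = 0) (hgε : ∀ u, ε ≤ u → g u = 0)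
    (hgL : |1 / (n : ℝ) * (∑ x : ZMod n, g (pos x)) - 1| ≤ Ls / n)
    (hn1 : (D + L + 6 * κ * B) ^ 2 ≤ n) (hn2 : 2 * B ≤ n) (hn3 : Ls ≤ n) (hn4 : 1 ≤ ε * n)
    (hn5 : (M * (3 * κ / e ^ 2 + Ls / e)) ^ 2 ≤ ε * n)
    (hres : ∀ (α b θ : ZMod n → ℝ) (I : Config n → ℝ),
      (∀ x, α x ∈ Icc e (1 - e)) → (∀ x, |α (x + 1) - α x| ≤ κ / n) →
      (∀ x, |b x| ≤ 1 + (κ + 2 * B) * κ) →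
      (∀ y, y + 1 = 0 → θ y = 0) → (∑ x, θ x ^ 2) / (n : ℝ) ^ 2 ≤ 8 * M ^ 2 * ε →
      (∀ η, |I η - ∑ y, θ y * (charge α η (y + 1) - charge α η y)| ≤ √ε) →
      ∑ η, bernWeight α η * Real.exp (c * residual e ε α b θ I η) ≤ Real.exp B')
    {μ : Measure (Config n)} [IsProbabilityMeasure μ]
    (hμ : InformationTheory.klDiv μ (productMeasure n ρ₀) ≤ ENNReal.ofReal K)
    {Ω : Type*} [MeasurableSpace Ω] {P : Measure Ω} [IsProbabilityMeasure P]
    {η : ℝ → Ω → Config n} (hη : IsProcess F n μ P η) {s t : ℝ} (hs : 0 ≤ s) (hst : s < t)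
    (ht : t ≤ T) :
    ∫ a, (∫ r in s..t, discrepancy n g (ρ r) (q r) (η (r * (n : ℝ) ^ 2) a)) ^ 2 ∂P ≤
      4 * (6 * (8 * M ^ 2) / e ^ 4 + 1) *
        (1 + (1 + T / c) * (Real.exp (T / c) * (K + κ / e + B') + B')) * ((t - s) * ε) := by
  have hnpos : (0 : ℝ) < n := by exact_mod_cast NeZero.pos n
  have hT0 : (0 : ℝ) ∈ Icc 0 T := ⟨le_rfl, hs.trans (hst.le.trans ht)⟩
  have hκ0 : 0 ≤ κ := (abs_nonneg _).trans (hκ 0 hT0 0)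
  have hB0 : 0 ≤ B := (abs_nonneg _).trans (hB 0 (by simp))
  have hpos2 : ∀ x : ZMod n, pos x ∈ Icc (0 : ℝ) 2 := fun x =>
    ⟨(pos_mem_Ico x).1, by linarith [(pos_mem_Ico x).2]⟩
  have hFn : ∀ x : ZMod n, |F (pos x)| ≤ n / 2 := fun x => (hB _ (hpos2 x)).trans (by linarith)
  have hρ01 : ∀ r ∈ Icc 0 T, ∀ u, ρ r u ∈ Icc (0 : ℝ) 1 := fun r hr u =>
    ⟨he.le.trans (hb r hr u).1, (hb r hr u).2.trans (by linarith)⟩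
  have hq0 : ∀ r ∈ Icc 0 T, 0 < q r := fun r hr => lt_of_lt_of_le (by positivity) (hqM r hr)
  set α : ℝ → ZMod n → ℝ := cellAverage n ρ
  set Φ : ℝ → ZMod n → ℝ := fun r x => flux F ρ r (pos x)
  set θ : ℝ → ZMod n → ℝ := fun r y => √(n : ℝ) * (compressibility (ρ r 0) / q r) * tail n g y
  set b : ℝ → ZMod n → ℝ := fun r x => -(n * Φ r (x + 1) * (α r (x + 1) - α r x))
  set I : ℝ → Config n → ℝ := fun r ξ => discrepancy n g (ρ r) (q r) ξ
  have hα : ∀ r ∈ Icc 0 T, ∀ x, α r x ∈ Icc e (1 - e) := fun r hr x =>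
    hρ.cellAverage_mem hr (hb r hr) x
  have hα0 : ∀ r ∈ Icc 0 T, ∀ x, 0 < α r x := fun r hr x => he.trans_le (hα r hr x).1
  have hα1 : ∀ r ∈ Icc 0 T, ∀ x, α r x < 1 := fun r hr x => by linarith [(hα r hr x).2]
  have hαc : ∀ x, ContinuousOn (fun r => α r x) (Icc 0 T) := fun x => hρ.continuousOn_cellAverage x
  have hΦc : ∀ x, ContinuousOn (fun r => Φ r x) (Icc 0 T) := fun x => hρ.continuousOn_flux _
  have hcc : ∀ ξ x, ContinuousOn (fun r => charge (α r) ξ x) (Icc 0 T) := fun ξ x =>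
    continuousOn_charge hαc hα0 hα1 ξ x
  have hρc := fun u => hρ.continuousOn_time u
  have hIc : ∀ ξ, ContinuousOn (fun r => I r ξ) (Icc 0 T) := fun ξ =>
    continuousOn_discrepancy hρc hq (fun r hr u => he.trans_le (hb r hr u).1)
      (fun r hr u => by linarith [(hb r hr u).2]) hq0 g ξ
  have hθc : ∀ x, ContinuousOn (fun r => θ r x) (Icc 0 T) := fun x =>
    (continuousOn_const.mul ((continuousOn_compressibility hρc 0).div hq
      fun r hr => (hq0 r hr).ne')).mul continuousOn_const
  have hbc : ∀ x, ContinuousOn (fun r => b r x) (Icc 0 T) := fun x =>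
    ((continuousOn_const.mul (hΦc (x + 1))).mul ((hαc (x + 1)).sub (hαc x))).neg
  have hd : ∀ r ∈ Icc 0 T, ∀ x, |α r (x + 1) - α r x| ≤ κ / n := fun r hr x =>
    hρ.abs_cellAverage_add_one_sub_le hn hr (hκ r hr) x
  have hS : 1 / (n : ℝ) * ∑ x : ZMod n, g (pos x) ≤ 2 := by
    have : Ls / n ≤ 1 := by rw [div_le_one hnpos]; exact hn3
    linarith [(abs_le.1 hgL).2]
  have hθb : ∀ r ∈ Icc 0 T, (∑ x, θ r x ^ 2) / (n : ℝ) ^ 2 ≤ 8 * M ^ 2 * ε := fun r hr =>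
    sum_sq_tail_weight_le (hqM r hr) hM (hρ01 r hr 0) hg hε hgε hS hn4
  have hRest : ∀ r ∈ Icc 0 T, ∀ ξ,
      |I r ξ - ∑ y, θ r y * (charge (α r) ξ (y + 1) - charge (α r) ξ y)| ≤ √ε := by
    intro r hr ξ
    refine (abs_discrepancy_sub_le hn he hg hg0 (hqM r hr) hM (hb r hr) (hα r hr)
      (fun x => hρ.abs_cellAverage_sub_le hr (hκ r hr) x) hgL hn3 ξ).trans ?_
    rw [div_le_iff₀ (Real.sqrt_pos.2 hnpos), ← Real.sqrt_mul hε.le]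
    exact Real.le_sqrt_of_sq_le hn5
  have hbb : ∀ r ∈ Icc 0 T, ∀ x, |b r x| ≤ 1 + (κ + 2 * B) * κ := by
    intro r hr x
    have h1 := abs_flux_le (F := F) (hρ01 r hr (pos (x + 1))) (hκ r hr _) (hB _ (hpos2 (x + 1)))
    have h2 : |b r x| ≤ n * (κ + 2 * B) * (κ / n) := by
      simp only [b]
      rw [abs_neg, abs_mul, abs_mul, abs_of_pos hnpos]
      gcongr
      exact hd r hr x
    refine h2.trans ?_
    have : n * (κ + 2 * B) * (κ / n) = (κ + 2 * B) * κ := by field_simp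
    linarith
  -- Half of the constant in `spectral_bound`, to match the 2Λγ² of `IsChain.integral_sq_le`. It is
  -- proportional to ε, which is how ε enters the conclusion.
  set Λ := (6 * (8 * M ^ 2) / e ^ 4 + 1) * ε / 2
  have hΛ : 0 < Λ := by positivity
  have hent : relEntropy (fun ξ => μ.real {ξ}) (bernWeight (α 0)) ≤ K + κ / e := by
    refine relEntropy_bernWeight_le he hK (g := ρ₀) (fun u => ?_) (hα 0 hT0) (fun x => ?_) hμ
    · rw [← hρ.initial]; exact hb 0 hT0 u
    · rw [← hρ.initial]; exact hρ.abs_cellAverage_sub_le hT0 (hκ 0 hT0) x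
  have hderiv : ∀ r ∈ Ioo 0 T, ∀ ξ, HasDerivAt (fun r => bernWeight (α r) ξ)
      (bernWeight (α r) ξ * ∑ x, n * (Φ r (x + 1) - Φ r x) * charge (α r) ξ x) r := fun r hr ξ =>
    hasDerivAt_bernWeight (fun x => hρ.hasDerivAt_cellAverage hF hF_per hn hr x)
      (hα0 r (Ioo_subset_Icc_self hr)) (hα1 r (Ioo_subset_Icc_self hr)) ξ
  have hspec : ∀ r ∈ Icc 0 T, ∀ (γ : ℝ) (v : Config n → ℝ),
      2 * ∑ i, bernWeight (α r) i * v i *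
          ∑ j, ((n : ℝ) ^ 2 • LinearMap.toMatrix' (generator F n)) i j * v j +
        2 * γ * ∑ i, bernWeight (α r) i * I r i * v i ^ 2 -
        ∑ i, bernWeight (α r) i * (∑ x, n * (Φ r (x + 1) - Φ r x) * charge (α r) i x) * v i ^ 2 ≤
      ∑ i, bernWeight (α r) i * residual e ε (α r) (b r) (θ r) (I r) i * v i ^ 2 +
        2 * Λ * γ ^ 2 * ∑ i, bernWeight (α r) i * v i ^ 2 := by
    intro r hr γ v
    have h := spectral_bound (Φ := Φ r) he hε hn (hα r hr) hFn
      (hρ.sum_sq_current_error_le hF hF_per hn hr (hρ01 r hr) (hκ r hr) (hD r hr) hL hB hn1)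
      (hθb r hr) (I r) v γ
    have e1 : 2 * ∑ i, bernWeight (α r) i * v i *
        ∑ j, ((n : ℝ) ^ 2 • LinearMap.toMatrix' (generator F n)) i j * v j =
        2 * (n : ℝ) ^ 2 * ∑ i, bernWeight (α r) i * v i * generator F n v i := by
      simp only [sum_toMatrix_mul, Finset.mul_sum]
      exact Finset.sum_congr rfl fun i _ => by ring
    have e2 : 2 * Λ * γ ^ 2 = (6 * (8 * M ^ 2) / e ^ 4 + 1) * ε * γ ^ 2 := by
      simp only [Λ]; ring
    rw [e1, e2]
    exact h
  have hexp : ∀ r ∈ Icc 0 T, ∑ ξ, bernWeight (α r) ξ *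
      Real.exp (c * residual e ε (α r) (b r) (θ r) (I r) ξ) ≤ Real.exp B' := fun r hr =>
    hres (α r) (b r) (θ r) (I r) (hα r hr) (hd r hr) (hbb r hr)
      (fun y hy => by simp only [θ]; rw [tail_last hn g hy, mul_zero]) (hθb r hr) (hRest r hr)
  have hm'c : ∀ ξ, ContinuousOn (fun r => bernWeight (α r) ξ *
      ∑ x, n * (Φ r (x + 1) - Φ r x) * charge (α r) ξ x) (Icc 0 T) := fun ξ =>
    (continuousOn_bernWeight hαc ξ).mul (continuousOn_finsetSum _ fun x _ =>
      (continuousOn_const.mul ((hΦc (x + 1)).sub (hΦc x))).mul (hcc ξ x))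
  have key := hη.isChain.integral_sq_le
    (isRateMatrix_generator fun x => (hFn x).trans (by linarith))
    (m := fun r ξ => bernWeight (α r) ξ)
    (m' := fun r ξ => bernWeight (α r) ξ *
      ∑ x, n * (Φ r (x + 1) - Φ r x) * charge (α r) ξ x)
    (I := I) (U := fun r ξ => residual e ε (α r) (b r) (θ r) (I r) ξ) (T := T) (c := c) (B := B')
    (K := K + κ / e) (Λ := Λ) hc hB' (by positivity) hΛ
    (fun r hr ξ => bernWeight_pos (hα0 r hr) (hα1 r hr) ξ)
    (fun r _ => sum_bernWeight _) (fun ξ => continuousOn_bernWeight hαc ξ) hm'c hIc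
    (fun ξ => continuousOn_residual hαc hcc hbc hθc hIc ξ) hderiv hspec hexp hent hs hst ht
  refine key.trans (le_of_eq ?_)
  simp only [Λ]
  ring

end SecondMoment

/-- The second moment bound behind the local replacement lemma. -/
lemma exists_integral_sq_discrepancy_le {T : ℝ} (hT : 0 < T) {F : ℝ → ℝ} (hF : ContDiff ℝ 1 F)
    (hF_per : Function.Periodic F 1) {φ : ℝ → ℝ} (hφ : ContDiff ℝ 1 φ) (hφ_nonneg : ∀ u, 0 ≤ φ u)
    (hφ_supp : Function.support φ ⊆ Ioo 0 1) (hφ_int : ∫ u, φ u = 1) {e κ M K : ℝ} (he : 0 < e)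
    (hκ : 0 < κ) (hM : 0 < M) (hK : 0 ≤ K) :
    ∃ C : ℝ, 0 < C ∧ ∀ (ρ₀ : ℝ → ℝ) (ρ : ℝ → ℝ → ℝ) (q : ℝ → ℝ),
      IsHydrodynamicSolution T F ρ₀ ρ → (∀ t ∈ Icc 0 T, ∀ u, ρ t u ∈ Icc e (1 - e)) →
      (∀ t ∈ Icc 0 T, ∀ u, |deriv (ρ t) u| ≤ κ) → ContinuousOn q (Icc 0 T) →
      (∀ s ∈ Icc 0 T, 1 / M ≤ q s) → ∀ ε ∈ Ioo (0 : ℝ) 1, ∃ n₀ : ℕ, ∀ (n : ℕ) [NeZero n], n₀ ≤ n →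
        ∀ (μ : Measure (Config n)) [IsProbabilityMeasure μ],
          InformationTheory.klDiv μ (productMeasure n ρ₀) ≤ ENNReal.ofReal K →
          ∀ (Ω : Type*) [MeasurableSpace Ω] (P : Measure Ω) [IsProbabilityMeasure P]
            (η : ℝ → Ω → Config n), IsProcess F n μ P η → ∀ s t : ℝ, 0 ≤ s → s < t → t ≤ T →
            ∫ a, (∫ r in s..t, discrepancy n (rescale φ ε) (ρ r) (q r)
              (η (r * (n : ℝ) ^ 2) a)) ^ 2 ∂P ≤ C * ((t - s) * ε) := by
  obtain ⟨B, hB⟩ := (isCompact_Icc (a := (0 : ℝ)) (b := 2)).exists_bound_of_continuousOn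
    hF.continuous.continuousOn
  obtain ⟨L, hL⟩ := (isCompact_Icc (a := (0 : ℝ)) (b := 2)).exists_bound_of_continuousOn
    (hF.continuous_deriv le_rfl).continuousOn
  have hB0 : 0 ≤ B := (norm_nonneg _).trans (hB 0 (by simp))
  have hL0 : 0 ≤ L := (norm_nonneg _).trans (hL 0 (by simp))
  obtain ⟨c, B', hc, hB', hres⟩ := exists_sum_exp_residual_le he hκ
    -- The coefficients b are bounded by (κ + 2B) κ; the 1 is added to meet the requirement that the
    -- bound be at least 1. The value of D is the constant of `sum_sq_tail_weight_le`.
    (B := 1 + (κ + 2 * B) * κ) (D := 8 * M ^ 2) (by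
      have : 0 ≤ (κ + 2 * B) * κ := by positivity
      linarith) (by positivity)
  refine ⟨4 * (6 * (8 * M ^ 2) / e ^ 4 + 1) *
        (1 + (1 + T / c) * (Real.exp (T / c) * (K + κ / e + B') + B')), by positivity, ?_⟩
  intro ρ₀ ρ q hρ hb hκ' hq hqM ε hε
  obtain ⟨D, hD⟩ := ((isCompact_Icc (a := (0 : ℝ)) (b := T)).prod
    (isCompact_Icc (a := (0 : ℝ)) (b := 2))).exists_bound_of_continuousOn
    (hρ.continuousOn_deriv_deriv.mono (prod_mono le_rfl (subset_univ _)))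
  obtain ⟨Ls, hLs0, hLs⟩ := exists_abs_riemannSum_rescale_sub_one_le hφ hφ_supp hφ_int hε
  have hε0 := hε.1
  -- Each summand secures one of the largeness conditions on n. D depends on ρ and Ls on ε, so both
  -- may enter n₀ but not the constant C.
  refine ⟨⌈2 + (D + L + 6 * κ * B) ^ 2 + 2 * B + Ls + 1 / ε +
    (M * (3 * κ / e ^ 2 + Ls / e)) ^ 2 / ε⌉₊, ?_⟩
  intro n _ hn μ _ hμ Ω _ P _ η hη s t hs hst ht
  have hn' := Nat.ceil_le.1 hn
  have p1 : 0 ≤ (D + L + 6 * κ * B) ^ 2 := sq_nonneg _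
  have p2 : 0 < 1 / ε := by positivity
  have p3 : 0 ≤ (M * (3 * κ / e ^ 2 + Ls / e)) ^ 2 / ε := by positivity
  have hn2 : 2 ≤ n := by
    have : (2 : ℝ) ≤ n := by linarith
    exact_mod_cast this
  have hnε : ∀ y : ℝ, y / ε ≤ n → y ≤ ε * n := by
    intro y hy
    rw [div_le_iff₀ hε0] at hy
    linarith
  exact integral_sq_discrepancy_le hρ hF hF_per hn2 he hM hK hε0 hc hB' hb hκ' hq hqM
    (fun t ht u hu => hD (t, u) ⟨ht, hu⟩) hL hB
    (g := rescale φ ε) (Ls := Ls)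
    (fun u => mul_nonneg (inv_nonneg.2 hε0.le) (hφ_nonneg _))
    (rescale_eq_zero hφ_supp hε0 fun h => lt_irrefl _ h.1)
    (fun u hu => rescale_eq_zero hφ_supp hε0 fun h => not_lt.2 hu h.2)
    (hLs n) (by linarith) (by linarith) (by linarith) (hnε 1 (by linarith))
    (hnε _ (by linarith))
    (fun α b θ I h1 h2 h3 h4 h5 h6 => hres n hn2 α b θ I ε hε0 h1 h2 h3 h4 h5 h6)
    hμ hη hs hst ht

end WASEP

end

/-! ### From the second moment to the moments of order λ. -/

theorem lemma3p5
    (T : ℝ) (hT : 0 < T)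
    (F : ℝ → ℝ) (hF : ContDiff ℝ ∞ F) (hF_per : Function.Periodic F 1)
    (φ : ℝ → ℝ) (hφ : ContDiff ℝ ∞ φ) (hφ_nonneg : ∀ u, 0 ≤ φ u)
    (hφ_supp : Function.support φ ⊆ Ioo 0 1) (hφ_int : ∫ u, φ u = 1)
    (ε₀ : ℝ) (hε₀ : ε₀ ∈ Ioo (0 : ℝ) (1 / 2)) (κ : ℝ) (hκ : 0 < κ) (M : ℝ) (hM : 1 ≤ M)
    (K : ℝ) (hK : 0 ≤ K) (lam : ℝ) (hlam : lam ∈ Ioo (1 : ℝ) 2) :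
    ∃ C : ℝ, 0 < C ∧
      ∀ (ρ₀ : ℝ → ℝ) (ρ : ℝ → ℝ → ℝ) (q : ℝ → ℝ),
        ContDiff ℝ ∞ ρ₀ →
        WASEP.IsHydrodynamicSolution T F ρ₀ ρ →
        (∀ t ∈ Icc 0 T, ∀ u, ρ t u ∈ Ioo ε₀ (1 - ε₀)) →
        (∀ t ∈ Icc 0 T, ∀ n : ℕ, 0 < n → ∀ x : ℤ,
          n * |ρ t (((x : ℝ) + 1) / n) - ρ t ((x : ℝ) / n)| ≤ κ) →
        ContDiffOn ℝ ∞ q (Icc 0 T) →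
        (∀ s ∈ Icc 0 T, 1 / M ≤ q s ∧ q s ≤ M) →
        ∀ ε ∈ Ioo (0 : ℝ) 1, ∃ n₀ : ℕ, ∀ (n : ℕ) [NeZero n], n₀ ≤ n →
          ∀ (μ : Measure (WASEP.Config n)) [IsProbabilityMeasure μ],
            InformationTheory.klDiv μ (WASEP.productMeasure n ρ₀) ≤ ENNReal.ofReal K →
            ∀ (Ω : Type*) [MeasurableSpace Ω] (P : Measure Ω) [IsProbabilityMeasure P]
              (η : ℝ → Ω → WASEP.Config n), WASEP.IsProcess F n μ P η →
              ∀ s t : ℝ, 0 ≤ s → s < t → t ≤ T →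
                Integrable (fun a =>
                  |WASEP.Z n φ q ρ ε (fun r => η r a) t - WASEP.Z n φ q ρ ε (fun r => η r a) s
                    - (WASEP.Γ n q ρ (fun r => η r a) t - WASEP.Γ n q ρ (fun r => η r a) s)|
                    ^ lam) P ∧
                ∫ a,
                  |WASEP.Z n φ q ρ ε (fun r => η r a) t - WASEP.Z n φ q ρ ε (fun r => η r a) s
                    - (WASEP.Γ n q ρ (fun r => η r a) t - WASEP.Γ n q ρ (fun r => η r a) s)|
                    ^ lam ∂P ≤ C * |t - s| ^ (lam / 2) * ε ^ (lam / 2) := by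
  have hF1 : ContDiff ℝ 1 F := hF.of_le (by exact_mod_cast le_top)
  have hφ1 : ContDiff ℝ 1 φ := hφ.of_le (by exact_mod_cast le_top)
  have hM0 : 0 < M := by linarith
  obtain ⟨C, hC, h⟩ := WASEP.exists_integral_sq_discrepancy_le hT hF1 hF_per hφ1 hφ_nonneg hφ_supp
    hφ_int hε₀.1 hκ hM0 hK
  -- The second moment is at most C (t − s) ε, and the power λ/2 distributes over this product.
  refine ⟨C ^ (lam / 2), Real.rpow_pos_of_pos hC _, ?_⟩
  intro ρ₀ ρ q _ hρ hb hslope hq hqM ε hε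
  have hqc : ContinuousOn q (Icc 0 T) := hq.continuousOn
  obtain ⟨n₀, hn₀⟩ := h ρ₀ ρ q hρ (fun t ht u => Ioo_subset_Icc_self (hb t ht u))
    (fun t ht => WASEP.abs_deriv_le_of_slope_le
      ((hρ.contDiff t ht).of_le (by norm_num)) (hslope t ht)) hqc (fun s hs => (hqM s hs).1) ε hε
  refine ⟨n₀, ?_⟩
  intro n _ hn μ _ hμ Ω _ P _ η hη s t hs hst ht
  have hsub : Icc s t ⊆ Icc 0 T := Icc_subset_Icc hs ht
  have hρ0 : ∀ r ∈ Icc 0 T, ∀ u, 0 < ρ r u := fun r hr u => hε₀.1.trans (hb r hr u).1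
  have hρ1 : ∀ r ∈ Icc 0 T, ∀ u, ρ r u < 1 := fun r hr u => by linarith [(hb r hr u).2, hε₀.1]
  have hq0 : ∀ r ∈ Icc 0 T, 0 < q r := fun r hr =>
    lt_of_lt_of_le (by positivity) (hqM r hr).1
  have hIc : ∀ ξ : WASEP.Config n, ContinuousOn
      (fun r => WASEP.discrepancy n (WASEP.rescale φ ε) (ρ r) (q r) ξ) (Icc s t) := fun ξ =>
    (WASEP.continuousOn_discrepancy (fun u => hρ.continuousOn_time u) hqc hρ0 hρ1 hq0 _ ξ).mono hsub
  obtain ⟨B, -, hB⟩ := WASEP.exists_abs_le_of_continuousOn hIc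
  simp only [WASEP.increment_eq_integral_discrepancy hη.isChain
    (fun u => hρ.continuousOn_time u) hqc hρ0 hρ1 hq0 φ ε hs hst.le ht]
  obtain ⟨h1, h2⟩ := WASEP.integrable_and_integral_abs_rpow_le (P := P)
    (hη.isChain.measurable_integral hs hst.le hIc) (C := B * (t - s))
    (WASEP.abs_integral_path_le hst.le hB) hlam
  refine ⟨h1, h2.trans ?_⟩
  have h3 := hn₀ n hn μ hμ Ω P η hη s t hs hst ht
  have hts : 0 < t - s := sub_pos.2 hst
  calc _ ≤ (C * ((t - s) * ε)) ^ (lam / 2) :=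
        Real.rpow_le_rpow (integral_nonneg fun a => sq_nonneg _) h3 (by linarith [hlam.1])
    _ = C ^ (lam / 2) * |t - s| ^ (lam / 2) * ε ^ (lam / 2) := by
        rw [Real.mul_rpow hC.le (mul_nonneg hts.le hε.1.le), Real.mul_rpow hts.le hε.1.le,
          abs_of_pos hts, mul_assoc]
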